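/- **Notation.** Let $\dot{\mathbb C}=\mathbb C\setminus\{0,1\}$, let $\mathcal D(\dot{\mathbb C})$ be the space of smooth complex-valued functions with compact support in $\dot{\mathbb C}$, and let $$\Pi=\{(a,b)\in\mathbb R^2:\ 0<a+b<2,\ -1<a-b<1\}.$$ For $(a,b)\in\Pi$ put $\mu_{a,b}(z)=|z|^{2a+2b-2}|1-z|^{2a-2b}$ and $$\mathfrak D=z(1-z)\frac{\partial^2}{\partial z^2}+\bigl(a+b-(2a+1)z\bigr)\frac{\partial}{\partial z}-a^2,\qquad \overline{\mathfrak D}=\bar z(1-\bar z)\frac{\partial^2}{\partial \bar z^2}+\bigl(a+b-(2a+1)\bar z\bigr)\frac{\partial}{\partial\bar z}-a^2 .$$ For $z\in\mathbb C\setminus\{0\}$ and $p-p'\in\mathbb Z$ write $z^{p|p'}=e^{p\ln z+p'\overline{\ln z}}$, let $\Gamma^{\mathbb C}(p|p')=i^{p-p'}\Gamma(p)/\Gamma(1-p')=i^{p'-p}\Gamma(p')/\Gamma(1-p)$, let $B^{\mathbb C}(\mathbf p,\mathbf q)=\Gamma^{\mathbb C}(\mathbf p)\Gamma^{\mathbb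 C}(\mathbf q)/\Gamma^{\mathbb C}(\mathbf p+\mathbf q)$, and let $${}_2F_1^{\mathbb C}[\mathbf p,\mathbf q;\mathbf r;z]=\frac1{\pi B^{\mathbb C}(\mathbf q,\mathbf r-\mathbf q)}\int_{\mathbb C}t^{\mathbf q-\mathbf 1}(1-t)^{\mathbf r-\mathbf q-\mathbf 1}(1-zt)^{-\mathbf p}\,d^2t,\qquad \mathbf 1=1|1 ,$$ $d^2t$ being Lebesgue measure. Let $\Lambda=\{\tfrac12(k+is):k\in\mathbb Z,\ s\in\mathbb R\}$. For $\lambda\in\Lambda$, $z\in\dot{\mathbb C}$ the kernel is $$\mathcal K_{a,b}(z,\lambda)=\frac1{\Gamma^{\mathbb C}(a+b|a+b)}\,{}_2F_1^{\mathbb C}\bigl[a+\lambda|a-\bar\lambda,\ a-\lambda|a+\bar\lambda;\ a+b|a+b;\ z\bigr].$$ The integral converges for $0<\Re a,\Re b<1$; in general $\mathcal K_{a,b}(z,\lambda)$ is understood by analytic continuation in complex parameters $(a,b)$ with $(\Re a,\Re b)\in\Pi$, outside the poles, which lie where one of $a\pm\lambda|a\mp\bar\lambda$, $b\pm\lambda|b\mp\bar\lambda$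 is a pair of positive integers (for real $(a,b)\in\Pi$: where $\lambda=0$ and $a=1$ or $b=1$). Put $$J_{a,b}f(\lambda)=\int_{\mathbb C}\mathcal K_{a,b}(z,\lambda)f(z)\mu_{a,b}(z)\,d^2z .$$ If $(a,b)\in\Pi$ and not both of $a,b$ lie in $[0,1]$, the support of the Plancherel measure contains two further points $\pm(r|r)$. There the kernel $v$ and the number $r$ are as follows, with $g_1=\Gamma^{\mathbb C}(a+b|a+b)$ and $g_2=\Gamma^{\mathbb C}(2-a-b|2-a-b)$: * $a<0$: $r=a$, $v(z)=1/g_1$; * $b<0$: $r=b$, $v(z)=|1-z|^{2(b-a)}/g_1$; * $a>1$: $r=1-a$, $v(z)=|z|^{2(1-a-b)}|1-z|^{2(b-a)}/g_2$; * $b>1$: $r=1-b$, $v(z)=|z|^{2(1-a-b)}/g_2$; and $J_{a,b}f(\pm r|\pm r)=\int_{\mathbb C} v(z)f(z)\mu_{a,b}(z)\,d^2z$. **Theorem.** Let $(a,b)\in\Pi$. The analytic continuation that defines the kernel exists for all $\lambda\in\Lambda$ and $z\in\dot{\mathbb C}$. Let $\lambda\in\Lambda$, with $\lambda\ne0$ if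 $a=1$ or $b=1$. Then $\mathcal K_{a,b}(\cdot,\lambda)$ is smooth on $\dot{\mathbb C}$ and is a joint eigenfunction, $$\mathfrak D\,\mathcal K_{a,b}(z,\lambda)=-\lambda^2\,\mathcal K_{a,b}(z,\lambda),\qquad \overline{\mathfrak D}\,\mathcal K_{a,b}(z,\lambda)=-\bar\lambda^{2}\,\mathcal K_{a,b}(z,\lambda)\qquad(z\in\dot{\mathbb C}),$$ and for every $f\in\mathcal D(\dot{\mathbb C})$ the integral $J_{a,b}f(\lambda)$ converges absolutely and $$J_{a,b}\mathfrak Df(\lambda)=-\lambda^2J_{a,b}f(\lambda),\qquad J_{a,b}\overline{\mathfrak D}f(\lambda)=-\bar\lambda^{2}J_{a,b}f(\lambda).$$ If $a$ and $b$ are not both in $[0,1]$, the same holds at the additional points $\pm(r|r)$, with kernel $v$ and with both eigenvalues equal to $-r^2$. -/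

import Mathlib

open scoped ContDiff ComplexConjugate
open MeasureTheory

noncomputable section

namespace ComplexJacobi

/-- The twice punctured plane `ℂ \ {0, 1}`. -/
def puncturedPlane : Set ℂ := {z | z ≠ 0 ∧ z ≠ 1}

/-- Smooth complex-valued functions whose support is a compact subset of `ℂ \ {0, 1}`. -/
def IsTestFunction (f : ℂ → ℂ) : Prop :=
  ContDiff ℝ ∞ f ∧ HasCompactSupport f ∧ tsupport f ⊆ puncturedPlane

/-- The open square `0 < a + b < 2`, `-1 < a - b < 1`. -/
def paramDomain : Set (ℝ × ℝ) :=
  {p | 0 < p.1 + p.2 ∧ p.1 + p.2 < 2 ∧ -1 < p.1 - p.2 ∧ p.1 - p.2 < 1}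

/-- The part `0 ≤ a ≤ 1`, `0 ≤ b ≤ 1` of the square. -/
def paramDomainCont : Set (ℝ × ℝ) :=
  {p | p ∈ paramDomain ∧ 0 ≤ p.1 ∧ p.1 ≤ 1 ∧ 0 ≤ p.2 ∧ p.2 ≤ 1}

/-- The numbers `(k + i s) / 2` with `k` an integer and `s` real; such a number `l` stands for
the pair `l | -conj l`. -/
def Lam : Set ℂ := {l | ∃ (k : ℤ) (s : ℝ), l = ((k : ℂ) + (s : ℂ) * Complex.I) / 2}

/-- The Wirtinger derivative `∂/∂z`. -/
def dz (f : ℂ → ℂ) (z : ℂ) : ℂ :=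
  (fderiv ℝ f z 1 - Complex.I * fderiv ℝ f z Complex.I) / 2

/-- The Wirtinger derivative `∂/∂(conj z)`. -/
def dzbar (f : ℂ → ℂ) (z : ℂ) : ℂ :=
  (fderiv ℝ f z 1 + Complex.I * fderiv ℝ f z Complex.I) / 2

/-- The hypergeometric operator `z(1-z) ∂² + (a + b - (2a+1) z) ∂ - a²`. -/
def opD (a b : ℝ) (f : ℂ → ℂ) (z : ℂ) : ℂ :=
  z * (1 - z) * dz (dz f) z + ((a : ℂ) + b - (2 * a + 1) * z) * dz f z - (a : ℂ) ^ 2 * f z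

/-- The complex conjugate hypergeometric operator. -/
def opDbar (a b : ℝ) (f : ℂ → ℂ) (z : ℂ) : ℂ :=
  conj z * (1 - conj z) * dzbar (dzbar f) z
    + ((a : ℂ) + b - (2 * a + 1) * conj z) * dzbar f z - (a : ℂ) ^ 2 * f z

/-- The weight `|z|^(2a+2b-2) |1-z|^(2a-2b)`. -/
def weight (a b : ℝ) (z : ℂ) : ℝ :=
  ‖z‖ ^ (2 * a + 2 * b - 2) * ‖1 - z‖ ^ (2 * a - 2 * b)

/-- The generalized power `z^(p | p') = exp (p log z + p' conj (log z))` for `z ≠ 0`; it is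
single-valued for `p - p'` an integer. -/
def gpow (z : ℂ) (p : ℂ × ℂ) : ℂ :=
  Complex.exp (p.1 * Complex.log z + p.2 * conj (Complex.log z))

open Classical in
/-- The gamma function of the complex field,
`Γ(p)/Γ(1-p') i^(p-p') = Γ(p')/Γ(1-p) i^(p'-p)` for `p - p'` an integer. The second expression is
used where the first one is of the form `∞/∞`. The function has poles exactly where `p` and `p'`
are both nonpositive integers; there the value is `0`, so that the reciprocal is correct. -/
def gammaC (p : ℂ × ℂ) : ℂ :=
  if ∃ n : ℕ, p.1 = -(n : ℂ) then
    Complex.I ^ (p.2 - p.1) * (Complex.Gamma p.2 / Complex.Gamma (1 - p.1))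
  else
    Complex.I ^ (p.1 - p.2) * (Complex.Gamma p.1 / Complex.Gamma (1 - p.2))

/-- The beta function of the complex field. -/
def betaC (p q : ℂ × ℂ) : ℂ := gammaC p * gammaC q / gammaC (p + q)

/-- The hypergeometric function of the complex field, defined by the Euler type integral (for
parameters where the integral converges). -/
def hypC (p q r : ℂ × ℂ) (z : ℂ) : ℂ :=
  1 / ((Real.pi : ℂ) * betaC q (r - q)) *
    ∫ t : ℂ, gpow t (q - 1) * gpow (1 - t) (r - q - 1) * gpow (1 - z * t) (-p)

/-- The pair `a + l | a - conj l`. -/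
def pairPlus (a l : ℂ) : ℂ × ℂ := (a + l, a - conj l)

/-- The pair `a - l | a + conj l`. -/
def pairMinus (a l : ℂ) : ℂ × ℂ := (a - l, a + conj l)

/-- Both members of the pair are positive integers. -/
def IsPosIntPair (p : ℂ × ℂ) : Prop := ∃ m n : ℕ, p = ((m : ℂ) + 1, (n : ℂ) + 1)

/-- Complex parameters `(a, b)` whose real parts lie in the open square, without the poles of the
kernel, which are located where one of the parameters `𝐚`, `𝐛`, `𝐜 - 𝐚`, `𝐜 - 𝐛` of the
hypergeometric function is a pair of positive integers. -/
def kernelDomain (l : ℂ) : Set (ℂ × ℂ) :=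
  {p | (p.1.re, p.2.re) ∈ paramDomain ∧
    ¬ IsPosIntPair (pairPlus p.1 l) ∧ ¬ IsPosIntPair (pairMinus p.1 l) ∧
    ¬ IsPosIntPair (pairPlus p.2 l) ∧ ¬ IsPosIntPair (pairMinus p.2 l)}

/-- `G` is the continuation in the (complex) parameters `(a, b)` of
`(1 / Γ^ℂ(a+b | a+b)) ₂F₁^ℂ[a + l | a - conj l, a - l | a + conj l; a+b | a+b; z]`
from the domain `0 < Re a < 1`, `0 < Re b < 1` of convergence of the Euler integral. (On
`a + b = 1` the factor `1 / Γ^ℂ(a+b | a+b)` has a pole and the other factor vanishes; there the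
product is understood by continuation, too.) -/
def IsKernelContinuation (z l : ℂ) (G : ℂ × ℂ → ℂ) : Prop :=
  AnalyticOnNhd ℂ G (kernelDomain l) ∧
  ∀ a b : ℂ, 0 < a.re → a.re < 1 → 0 < b.re → b.re < 1 → a + b ≠ 1 →
    G (a, b) = 1 / gammaC (a + b, a + b) *
      hypC (pairPlus a l) (pairMinus a l) (a + b, a + b) z

/-- The pole set: in the relevant strip `IsPosIntPair` can hold only at one point of real part `1`. -/
theorem eq_of_isPosIntPair {w u v : ℂ} (huv : v = -conj u) (hw : w.re < 3 / 2)
    (h : IsPosIntPair (w + u, w + v)) : w = 1 - u ∧ w.re = 1 := by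
  obtain ⟨m, n, hmn⟩ := h
  rw [Prod.mk.injEq] at hmn
  obtain ⟨h1, h2⟩ := hmn
  have r1 := congrArg Complex.re h1
  have r2 := congrArg Complex.re h2
  simp [huv] at r1 r2
  have hlt : ((m + n : ℕ) : ℝ) < 1 := by push_cast; linarith
  have h0 : m + n = 0 := by
    have : m + n < 1 := by exact_mod_cast hlt
    omega
  obtain ⟨rfl, rfl⟩ : m = 0 ∧ n = 0 := by omega
  refine ⟨by rw [eq_sub_iff_add_eq, h1]; simp, ?_⟩
  push_cast at r1 r2
  linarith

theorem bad_subsingleton {w c : ℂ} (hc : c.re = 1) (hwc : w ≠ c) :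
    {y : ℝ | ∃ θ : ℝ, w + θ * ((1 / 2 : ℝ) + y * Complex.I - w) = c}.Subsingleton := by
  rintro y ⟨θ, h⟩ y' ⟨θ', h'⟩
  have r := congrArg Complex.re h
  have r' := congrArg Complex.re h'
  have i := congrArg Complex.im h
  have i' := congrArg Complex.im h'
  simp [hc] at r r' i i'
  have hne : (1 / 2 - w.re) ≠ 0 := by
    intro h0
    have : w.re = 1 / 2 := by linarith
    rw [this] at r
    norm_num at r
  have hθ : θ = θ' := by
    apply mul_right_cancel₀ hne
    linarith
  subst hθ
  have hθ0 : θ ≠ 0 := by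
    rintro rfl
    apply hwc
    simpa using h
  apply mul_left_cancel₀ hθ0
  linarith

/-- The continuation is unique, so that `kernel` below does not depend on any choice. -/
theorem IsKernelContinuation.eqOn {z l : ℂ} {G H : ℂ × ℂ → ℂ}
    (hG : IsKernelContinuation z l G) (hH : IsKernelContinuation z l H) :
    Set.EqOn G H (kernelDomain l) := by
  intro p hp
  obtain ⟨⟨q1, q2, q3, q4⟩, n1, n2, n3, n4⟩ := hp
  simp only at q1 q2 q3 q4
  -- the points that the segment has to avoid
  have hfin : ∀ w c : ℂ, (w ≠ c ∧ c.re = 1) ∨ c.re ≠ 1 → Set.Finite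
      {y : ℝ | c.re = 1 ∧ ∃ θ : ℝ, w + θ * ((1 / 2 : ℝ) + y * Complex.I - w) = c} := by
    rintro w c (⟨h1, h2⟩ | h)
    · exact (bad_subsingleton h2 h1).finite.subset fun y hy => hy.2
    · exact Set.Finite.subset Set.finite_empty fun y hy => h hy.1
  have key : ∀ w u : ℂ, ¬ IsPosIntPair (w + u, w + -conj u) →
      (w ≠ 1 - u ∧ (1 - u).re = 1) ∨ (1 - u).re ≠ 1 := by
    intro w u h
    by_cases hu : (1 - u).re = 1
    · refine Or.inl ⟨?_, hu⟩
      rintro rfl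
      apply h
      refine ⟨0, 0, ?_⟩
      have hu0 : u.re = 0 := by simpa using hu
      ext1
      · simp
      · apply Complex.ext
        · simp [hu0]
        · simp
    · exact Or.inr hu
  have e1 : ∀ a : ℂ, pairPlus a l = (a + l, a + -conj l) := fun a => by
    simp [pairPlus, sub_eq_add_neg]
  have e2 : ∀ a : ℂ, pairMinus a l = (a + -l, a + -conj (-l)) := fun a => by
    simp [pairMinus, sub_eq_add_neg]
  rw [e1] at n1 n3
  rw [e2] at n2 n4
  have hF := ((hfin _ _ (key _ _ n1)).union (hfin _ _ (key _ _ n2))).union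
    (((hfin _ _ (key _ _ n3)).union (hfin _ _ (key _ _ n4))).union (Set.finite_singleton 0))
  obtain ⟨y, hy⟩ := hF.exists_notMem
  simp only [Set.mem_union, not_or, Set.mem_singleton_iff] at hy
  obtain ⟨⟨y1, y2⟩, ⟨y3, y4⟩, y0⟩ := hy
  set c : ℂ := (1 / 2 : ℝ) + y * Complex.I with hc
  have hcre : c.re = 1 / 2 := by simp [hc]
  set U : Set (ℂ × ℂ) := segment ℝ p (c, c) with hU
  have avoid : ∀ (w u : ℂ) (θ : ℝ),
      y ∉ {y : ℝ | (1 - u).re = 1 ∧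
        ∃ θ : ℝ, w + θ * ((1 / 2 : ℝ) + y * Complex.I - w) = 1 - u} →
      (w + θ * (c - w)).re < 3 / 2 →
      ¬ IsPosIntPair (w + θ * (c - w) + u, w + θ * (c - w) + -conj u) := by
    intro w u θ hy hlt hpos
    obtain ⟨h1, h2⟩ := eq_of_isPosIntPair rfl hlt hpos
    exact hy ⟨by rw [← h1]; exact h2, θ, h1⟩
  have hUsub : U ⊆ kernelDomain l := by
    intro x hx
    rw [hU, segment_eq_image'] at hx
    obtain ⟨θ, ⟨t0, t1⟩, rfl⟩ := hx
    have x1 : (p + θ • ((c, c) - p)).1 = p.1 + θ * (c - p.1) := by simp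
    have x2 : (p + θ • ((c, c) - p)).2 = p.2 + θ * (c - p.2) := by simp
    have r1 : (p.1 + θ * (c - p.1)).re = p.1.re + θ * (1 / 2 - p.1.re) := by simp [hcre]
    have r2 : (p.2 + θ * (c - p.2)).re = p.2.re + θ * (1 / 2 - p.2.re) := by simp [hcre]
    have hsq : 0 < (p.1.re + θ * (1 / 2 - p.1.re)) + (p.2.re + θ * (1 / 2 - p.2.re)) ∧
        (p.1.re + θ * (1 / 2 - p.1.re)) + (p.2.re + θ * (1 / 2 - p.2.re)) < 2 ∧
        -1 < (p.1.re + θ * (1 / 2 - p.1.re)) - (p.2.re + θ * (1 / 2 - p.2.re)) ∧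
        (p.1.re + θ * (1 / 2 - p.1.re)) - (p.2.re + θ * (1 / 2 - p.2.re)) < 1 := by
      have h1 : 0 ≤ 1 - θ := by linarith
      have hh : ∀ A B : ℝ, 0 < A → 0 < B → 0 < (1 - θ) * A + θ * B := by
        intro A B hA hB
        rcases lt_or_ge 0 θ with h | h
        · have := mul_nonneg h1 hA.le
          have := mul_pos h hB
          linarith
        · obtain rfl : θ = 0 := le_antisymm h t0
          simpa using hA
      have a1 := hh _ 1 q1 one_pos
      have a2 := hh (2 - (p.1.re + p.2.re)) 1 (by linarith) one_pos
      have a3 := hh (1 + (p.1.re - p.2.re)) 1 (by linarith) one_pos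
      have a4 := hh (1 - (p.1.re - p.2.re)) 1 (by linarith) one_pos
      exact ⟨by linarith, by linarith, by linarith, by linarith⟩
    rw [kernelDomain, Set.mem_setOf_eq, x1, x2, e1, e1, e2, e2]
    refine ⟨by rw [r1, r2]; exact hsq, avoid _ _ _ y1 ?_, avoid _ _ _ y2 ?_, avoid _ _ _ y3 ?_,
      avoid _ _ _ y4 ?_⟩
    · rw [r1]; linarith [hsq.2.1, hsq.2.2.2]
    · rw [r1]; linarith [hsq.2.1, hsq.2.2.2]
    · rw [r2]; linarith [hsq.2.1, hsq.2.2.1]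
    · rw [r2]; linarith [hsq.2.1, hsq.2.2.1]
  have hev : G =ᶠ[nhds (c, c)] H := by
    have ho : IsOpen {x : ℂ × ℂ | (0 < x.1.re ∧ x.1.re < 1) ∧ (0 < x.2.re ∧ x.2.re < 1) ∧
        x.1 + x.2 ≠ 1} := by
      have c1 : Continuous fun x : ℂ × ℂ => x.1.re := by fun_prop
      have c2 : Continuous fun x : ℂ × ℂ => x.2.re := by fun_prop
      refine ((isOpen_lt continuous_const c1).inter (isOpen_lt c1 continuous_const)).inter
        (((isOpen_lt continuous_const c2).inter (isOpen_lt c2 continuous_const)).inter ?_)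
      exact isOpen_ne_fun (by fun_prop) continuous_const
    have hm : (c, c) ∈ {x : ℂ × ℂ | (0 < x.1.re ∧ x.1.re < 1) ∧ (0 < x.2.re ∧ x.2.re < 1) ∧
        x.1 + x.2 ≠ 1} := by
      refine ⟨by simp only [hcre]; norm_num, by simp only [hcre]; norm_num, fun h => y0 ?_⟩
      have := congrArg Complex.im h
      simp [hc] at this
      linarith
    filter_upwards [ho.mem_nhds hm] with x hx
    obtain ⟨⟨a1, a2⟩, ⟨a3, a4⟩, a5⟩ := hx
    exact (hG.2 x.1 x.2 a1 a2 a3 a4 a5).trans (hH.2 x.1 x.2 a1 a2 a3 a4 a5).symm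
  exact (hG.1.mono hUsub).eqOn_of_preconnected_of_eventuallyEq (hH.1.mono hUsub)
    (convex_segment p (c, c)).isPreconnected (right_mem_segment ℝ p (c, c)) hev
    (left_mem_segment ℝ p (c, c))

open Classical in
/-- The kernel `𝒦_{a,b}(z, l)`: the value at `(a, b)` of the continuation. The default value `0` is
used only if there is no continuation, and the theorem asserts that there is one; it is unique by
`IsKernelContinuation.eqOn`. -/
def kernel (a b z l : ℂ) : ℂ :=
  if h : ∃ G, IsKernelContinuation z l G then Classical.choose h (a, b) else 0

/-- The transform `J_{a,b} f (l) = ∫ 𝒦_{a,b}(z, l) f(z) μ_{a,b}(z) dz`. -/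
def transform (a b : ℝ) (f : ℂ → ℂ) (l : ℂ) : ℂ :=
  ∫ z : ℂ, kernel a b z l * f z * (weight a b z : ℂ)

/-- For `(a, b)` in the open square with `a` or `b` outside of `[0, 1]`, the support of the
Plancherel measure contains two more points `±(r | r)`. This is the number `r`. -/
def discretePoint (a b : ℝ) : ℝ :=
  if a < 0 then a else if b < 0 then b else if 1 < a then 1 - a else 1 - b

/-- The kernel at the two additional points: the constant `1 / Γ^ℂ(a+b | a+b)` if `a < 0`, and its
images under the homographic transformations `(a,b) ↦ (b,a), (1-a,1-b), (1-b,1-a)` otherwise. -/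
def discreteKernel (a b : ℝ) (z : ℂ) : ℂ :=
  if a < 0 then 1 / gammaC ((a : ℂ) + b, (a : ℂ) + b)
  else if b < 0 then
    ((‖1 - z‖ ^ (2 * (b - a)) : ℝ) : ℂ) / gammaC ((a : ℂ) + b, (a : ℂ) + b)
  else if 1 < a then
    ((‖z‖ ^ (2 * (1 - a - b)) * ‖1 - z‖ ^ (2 * (b - a)) : ℝ) : ℂ)
      / gammaC (2 - (a : ℂ) - b, 2 - (a : ℂ) - b)
  else
    ((‖z‖ ^ (2 * (1 - a - b)) : ℝ) : ℂ) / gammaC (2 - (a : ℂ) - b, 2 - (a : ℂ) - b)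

/-- The common value of `J_{a,b} f` at the two additional points. -/
def discreteTransform (a b : ℝ) (f : ℂ → ℂ) : ℂ :=
  ∫ z : ℂ, discreteKernel a b z * f z * (weight a b z : ℂ)

end ComplexJacobi

end

/-! Write λ = θ + k/2 with θ purely imaginary and k an integer. All exponent pairs then have the
form x + m/2 | x − m/2 with m an integer, and for fixed m everything is holomorphic in x. The
substitution t ↦ 1/t turns the Euler integral into K(z) = ∫ t^α (t−1)^β (t−z)^γ d²t with α =
θ−b+k/2, β = b−1+θ+k/2, γ = −a−θ−k/2 as holomorphic exponents. It converges when the three real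
parts x exceed −1 and their sum is below −1, which for the kernel means 0 < Re a, Re b < 1.

Smoothness of K in z comes from a cutoff near z. Away from z one differentiates under the integral.
Near z the integral is a convolution with a locally integrable power, and the derivatives fall on
the smooth factor. Both parts are holomorphic in the exponents together with all their z-derivatives
(`Nice`, `nice_K`).

The integral of a total derivative vanishes (`K_parts`). Applied to simple multiples of the
integrand this gives four first order operators (`raise0` to `raise3`), which send a K with shifted
holomorphic exponents to a linear factor times K. The first of them, combined with ∂K = −γ K(γ−1),
is the hypergeometric equation; complex conjugation gives its antiholomorphic companion (`isSol_K`).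

The same operators give the continuation. A holomorphic shift by one changes the real part x by only
one half, and every point of Π lies within less than one half of the square 0 < a, b < 1 in each
coordinate, with at most one coordinate outside. So one operator, divided by its linear factor,
reaches each of the four corners. For a ≤ 0 or b ≤ 0 the linear factor is absorbed by the reciprocal
gamma factor. For a ≥ 1 or b ≥ 1 it can vanish only for k = 0, where it gives one of the poles. The
differential equations persist by the identity theorem on convex boxes of exponents (`cont_local`).
Osgood's lemma turns differentiability in (a, b) into joint analyticity, and uniqueness of the
continuation identifies the result with `kernel`.

The statement on the transform is Green's formula: the weight makes the operator formally symmetric,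
so u·𝔇f − f·𝔇u times the weight is a total derivative of a compactly supported function
(`integral_opD`). At the two additional points the kernel is a product of powers of |z| and |1−z|
with the local exponents of the equation at 0 and 1, and a direct computation applies. -/

noncomputable section

namespace ComplexJacobi

/-! ### Wirtinger calculus -/

/-- The real-linear map `v ↦ p v + q conj v`. -/
def wirt (p q : ℂ) : ℂ →L[ℝ] ℂ :=
  p • (ContinuousLinearMap.id ℝ ℂ) + q • (Complex.conjCLE : ℂ →L[ℝ] ℂ)

@[simp] theorem wirt_apply (p q v : ℂ) : wirt p q v = p * v + q * conj v := by
  simp [wirt]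

theorem eq_wirt (L : ℂ →L[ℝ] ℂ) :
    L = wirt ((L 1 - Complex.I * L Complex.I) / 2) ((L 1 + Complex.I * L Complex.I) / 2) := by
  ext v
  have hv : v = v.re • (1 : ℂ) + v.im • Complex.I := by
    apply Complex.ext <;> simp
  have h : L v = (v.re : ℂ) * L 1 + (v.im : ℂ) * L Complex.I := by
    conv_lhs => rw [hv]
    rw [map_add, map_smul, map_smul, Complex.real_smul, Complex.real_smul]
  rw [wirt_apply, h]
  have e1 : v = v.re + v.im * Complex.I := (Complex.re_add_im v).symm
  have e2 : conj v = v.re - v.im * Complex.I := by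
    apply Complex.ext <;> simp
  rw [e2]
  nth_rewrite 3 [e1]
  linear_combination ((L Complex.I) * v.im) * Complex.I_sq

/-- `f` is real-differentiable at `z` with Wirtinger derivatives `p` and `q`. -/
def HasW (f : ℂ → ℂ) (p q z : ℂ) : Prop := HasFDerivAt f (wirt p q) z

theorem HasW.dz_eq {f : ℂ → ℂ} {p q z : ℂ} (h : HasW f p q z) : dz f z = p := by
  have h' : fderiv ℝ f z = wirt p q := HasFDerivAt.fderiv h
  simp only [dz, h', wirt_apply, map_one, Complex.conj_I]
  linear_combination (-p + q) / 2 * Complex.I_sq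

theorem HasW.dzbar_eq {f : ℂ → ℂ} {p q z : ℂ} (h : HasW f p q z) : dzbar f z = q := by
  have h' : fderiv ℝ f z = wirt p q := HasFDerivAt.fderiv h
  simp only [dzbar, h', wirt_apply, map_one, Complex.conj_I]
  linear_combination (p - q) / 2 * Complex.I_sq

theorem HasW.differentiableAt {f : ℂ → ℂ} {p q z : ℂ} (h : HasW f p q z) :
    DifferentiableAt ℝ f z := HasFDerivAt.differentiableAt h

theorem hasW_of_differentiableAt {f : ℂ → ℂ} {z : ℂ} (h : DifferentiableAt ℝ f z) :
    HasW f (dz f z) (dzbar f z) z := by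
  have := h.hasFDerivAt
  rw [eq_wirt (fderiv ℝ f z)] at this
  exact this

theorem HasW.congr {f g : ℂ → ℂ} {p q z : ℂ} (h : HasW f p q z) (hfg : g =ᶠ[nhds z] f) :
    HasW g p q z := HasFDerivAt.congr_of_eventuallyEq h hfg

theorem dz_congr {f g : ℂ → ℂ} {z : ℂ} (hfg : f =ᶠ[nhds z] g) : dz f z = dz g z := by
  simp only [dz, hfg.fderiv_eq]

theorem dzbar_congr {f g : ℂ → ℂ} {z : ℂ} (hfg : f =ᶠ[nhds z] g) : dzbar f z = dzbar g z := by
  simp only [dzbar, hfg.fderiv_eq]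

theorem hasW_const (c z : ℂ) : HasW (fun _ => c) 0 0 z := by
  have : wirt 0 0 = 0 := by ext; simp
  rw [HasW, this]
  exact hasFDerivAt_const c z

theorem hasW_id (z : ℂ) : HasW (fun w => w) 1 0 z := by
  have : wirt 1 0 = ContinuousLinearMap.id ℝ ℂ := by ext; simp
  rw [HasW, this]
  exact hasFDerivAt_id z

theorem HasW.add {f g : ℂ → ℂ} {p q p' q' z : ℂ} (hf : HasW f p q z) (hg : HasW g p' q' z) :
    HasW (fun w => f w + g w) (p + p') (q + q') z := by
  have : wirt (p + p') (q + q') = wirt p q + wirt p' q' := by ext; simp; ring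
  rw [HasW, this]
  exact HasFDerivAt.add hf hg

theorem HasW.mul {f g : ℂ → ℂ} {p q p' q' z : ℂ} (hf : HasW f p q z) (hg : HasW g p' q' z) :
    HasW (fun w => f w * g w) (p * g z + f z * p') (q * g z + f z * q') z := by
  have : wirt (p * g z + f z * p') (q * g z + f z * q')
      = f z • wirt p' q' + g z • wirt p q := by ext; simp; ring
  rw [HasW, this]
  exact HasFDerivAt.mul hf hg

theorem HasW.const_mul {f : ℂ → ℂ} {p q z : ℂ} (c : ℂ) (hf : HasW f p q z) :
    HasW (fun w => c * f w) (c * p) (c * q) z := by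
  simpa using (hasW_const c z).mul hf

/-- Composition with a holomorphic function on the left. -/
theorem HasW.hol_comp {f g : ℂ → ℂ} {p q g' z : ℂ} (hf : HasW f p q z)
    (hg : HasDerivAt g g' (f z)) : HasW (fun w => g (f w)) (g' * p) (g' * q) z := by
  have h := (hg.hasFDerivAt.restrictScalars ℝ).comp z hf
  have e : wirt (g' * p) (g' * q)
      = (ContinuousLinearMap.restrictScalars ℝ (ContinuousLinearMap.toSpanSingleton ℂ g')).comp
        (wirt p q) := by
    ext v; simp; ring
  rw [HasW, e]
  exact h

/-- Composition with a holomorphic function on the right. -/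
theorem HasW.comp_hol {f g : ℂ → ℂ} {p q g' z : ℂ} (hf : HasW f p q (g z))
    (hg : HasDerivAt g g' z) : HasW (fun w => f (g w)) (p * g') (q * conj g') z := by
  have h := HasFDerivAt.comp z hf (hg.hasFDerivAt.restrictScalars ℝ)
  have e : wirt (p * g') (q * conj g') = (wirt p q).comp
      (ContinuousLinearMap.restrictScalars ℝ (ContinuousLinearMap.toSpanSingleton ℂ g')) := by
    ext v; simp; ring
  rw [HasW, e]
  exact h

theorem HasW.conj {f : ℂ → ℂ} {p q z : ℂ} (hf : HasW f p q z) :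
    HasW (fun w => conj (f w)) (conj q) (conj p) z := by
  have h := (Complex.conjCLE : ℂ →L[ℝ] ℂ).hasFDerivAt.comp z hf
  have e : wirt (starRingEnd ℂ q) (starRingEnd ℂ p)
      = (Complex.conjCLE : ℂ →L[ℝ] ℂ).comp (wirt p q) := by
    ext v; simp; ring
  rw [HasW, e]
  exact h

theorem hasW_of_hasDerivAt {g : ℂ → ℂ} {g' z : ℂ} (hg : HasDerivAt g g' z) : HasW g g' 0 z := by
  simpa using (hasW_id z).hol_comp hg

theorem dzbar_conj {f : ℂ → ℂ} {z : ℂ} (h : DifferentiableAt ℝ f z) :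
    dzbar (fun w => conj (f w)) z = conj (dz f z) := (hasW_of_differentiableAt h).conj.dzbar_eq

theorem fderiv_eq_wirt (f : ℂ → ℂ) (z : ℂ) : fderiv ℝ f z = wirt (dz f z) (dzbar f z) :=
  eq_wirt _

/-! ### Powers with two exponents -/

/-- The pair `x + m/2 | x - m/2`. -/
def pr (x : ℂ) (m : ℤ) : ℂ × ℂ := (x + m / 2, x - m / 2)

/-- The power `t^(x + m/2 | x - m/2)`. -/
def gp (x : ℂ) (m : ℤ) (t : ℂ) : ℂ :=
  Complex.exp (2 * x * Real.log ‖t‖) * (t / ‖t‖) ^ m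

/-- `gpow` uses the principal logarithm, whereas `gp` separates modulus and phase. With an integer
phase exponent no branch is involved, so `gp` is visibly smooth across the cut, multiplicative in t
and entire in x. -/
theorem gpow_pr {t : ℂ} (ht : t ≠ 0) (x : ℂ) (m : ℤ) : gpow t (pr x m) = gp x m t := by
  have hn : (‖t‖ : ℂ) ≠ 0 := by simpa using ht
  have h1 : t / ‖t‖ = Complex.exp (Complex.arg t * Complex.I) := by
    rw [div_eq_iff hn, mul_comm]
    exact (Complex.norm_mul_exp_arg_mul_I t).symm
  have h2 : Complex.log t = Real.log ‖t‖ + Complex.arg t * Complex.I := rfl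
  have h3 : conj (Complex.log t) = Real.log ‖t‖ - Complex.arg t * Complex.I := by
    rw [h2]; apply Complex.ext <;> simp
  rw [gpow, gp, h1, ← Complex.exp_int_mul, ← Complex.exp_add, h3, h2, pr]
  congr 1
  ring

theorem norm_gp {t : ℂ} (ht : t ≠ 0) (x : ℂ) (m : ℤ) : ‖gp x m t‖ = ‖t‖ ^ (2 * x.re) := by
  have hn : ‖t‖ ≠ 0 := by simpa using ht
  rw [gp, norm_mul, norm_zpow, norm_div, Complex.norm_real, norm_norm, div_self hn, one_zpow,
    mul_one, Complex.norm_exp, Real.rpow_def_of_pos (by positivity)]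
  congr 1
  simp
  ring

theorem gp_mul {s t : ℂ} (hs : s ≠ 0) (ht : t ≠ 0) (x : ℂ) (m : ℤ) :
    gp x m (s * t) = gp x m s * gp x m t := by
  have h1 : ‖s‖ ≠ 0 := by simpa using hs
  have h2 : ‖t‖ ≠ 0 := by simpa using ht
  rw [gp, gp, gp, norm_mul, Real.log_mul h1 h2]
  push_cast
  rw [mul_div_mul_comm, mul_zpow, mul_add, Complex.exp_add]
  ring

theorem gp_add {t : ℂ} (ht : t ≠ 0) (x y : ℂ) (m n : ℤ) :
    gp (x + y) (m + n) t = gp x m t * gp y n t := by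
  have h1 : (t / ‖t‖ : ℂ) ≠ 0 := by simpa using ht
  rw [gp, gp, gp, zpow_add₀ h1, mul_add, add_mul, Complex.exp_add]
  ring

theorem gp_zero {t : ℂ} : gp 0 0 t = 1 := by simp [gp]

theorem gp_ne_zero {t : ℂ} (ht : t ≠ 0) (x : ℂ) (m : ℤ) : gp x m t ≠ 0 := by
  have h1 : (t / ‖t‖ : ℂ) ≠ 0 := by simpa using ht
  exact mul_ne_zero (Complex.exp_ne_zero _) (zpow_ne_zero _ h1)

theorem gp_half_one {t : ℂ} : gp (1 / 2) 1 t = t := by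
  by_cases ht : t = 0
  · simp [ht, gp]
  have h1 : (‖t‖ : ℂ) ≠ 0 := by simpa using ht
  have : Complex.exp (2 * (1 / 2) * Real.log ‖t‖) = ‖t‖ := by
    rw [mul_one_div_cancel two_ne_zero, one_mul, ← Complex.ofReal_exp, Real.exp_log]
    simpa using ht
  rw [gp, this, zpow_one]
  field_simp

theorem gp_half_neg_one {t : ℂ} : gp (1 / 2) (-1) t = conj t := by
  by_cases ht : t = 0
  · simp [ht, gp]
  have h1 : (‖t‖ : ℂ) ≠ 0 := by simpa using ht
  have : Complex.exp (2 * (1 / 2) * Real.log ‖t‖) = ‖t‖ := by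
    rw [mul_one_div_cancel two_ne_zero, one_mul, ← Complex.ofReal_exp, Real.exp_log]
    simpa using ht
  rw [gp, this, zpow_neg, zpow_one, inv_div]
  field_simp
  rw [← Complex.mul_conj']

/-- Raising only the holomorphic exponent by one is the shift (1/2, 1) in the coordinates (x, m).
Convergence depends on Re x alone, so such a shift costs one half and not one. -/
theorem gp_up {t : ℂ} (ht : t ≠ 0) (x : ℂ) (m : ℤ) :
    gp (x + 1 / 2) (m + 1) t = gp x m t * t := by
  rw [gp_add ht, gp_half_one]

theorem gp_down {t : ℂ} (ht : t ≠ 0) (x : ℂ) (m : ℤ) :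
    gp (x - 1 / 2) (m - 1) t = gp x m t / t := by
  rw [eq_div_iff ht, ← gp_up ht]
  congr 1 <;> ring

theorem gp_down_bar {t : ℂ} (ht : t ≠ 0) (x : ℂ) (m : ℤ) :
    gp (x - 1 / 2) (m + 1) t = gp x m t / conj t := by
  have h : (starRingEnd ℂ) t ≠ 0 := by simpa using ht
  rw [eq_div_iff h, ← gp_half_neg_one, ← gp_add ht]
  congr 1 <;> ring

theorem conj_gp (x : ℂ) (m : ℤ) (t : ℂ) : conj (gp x m t) = gp (conj x) (-m) t := by
  by_cases ht : t = 0
  · simp [gp, ht, zero_zpow_eq]; split_ifs <;> simp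
  have h1 : (‖t‖ : ℂ) ≠ 0 := by simpa using ht
  rw [gp, gp, map_mul, ← Complex.exp_conj, map_zpow₀, zpow_neg, ← inv_zpow]
  congr 2
  · simp only [map_mul, Complex.conj_ofReal, map_ofNat]
  · rw [map_div₀, Complex.conj_ofReal, inv_div, div_eq_div_iff h1 ht, ← sq, ← Complex.mul_conj' t]
    ring

theorem gp_inv {t : ℂ} (ht : t ≠ 0) (x : ℂ) (m : ℤ) : gp x m t⁻¹ = gp (-x) (-m) t := by
  have h : gp x m t⁻¹ * gp x m t = 1 := by
    rw [← gp_mul (inv_ne_zero ht) ht, inv_mul_cancel₀ ht]; simp [gp]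
  have h' : gp (-x) (-m) t * gp x m t = 1 := by
    rw [← gp_add ht, neg_add_cancel, neg_add_cancel, gp_zero]
  exact mul_right_cancel₀ (gp_ne_zero ht x m) (h.trans h'.symm)

/-- No global logarithm is needed: for s near t the quotient s/t is near 1, where the principal
branch is holomorphic, and the power of s is the power of t times that of s/t. -/
theorem hasW_gp {t : ℂ} (ht : t ≠ 0) (x : ℂ) (m : ℤ) :
    HasW (gp x m) ((x + m / 2) * gp (x - 1 / 2) (m - 1) t)
      ((x - m / 2) * gp (x - 1 / 2) (m + 1) t) t := by
  have hlog : HasW (fun s => Complex.log (s / t)) (1 / t) 0 t := by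
    have h0 : HasDerivAt (fun s : ℂ => s / t) (1 / t) t := (hasDerivAt_id t).div_const t
    have h1 : t / t ∈ Complex.slitPlane := by rw [div_self ht]; exact Complex.one_mem_slitPlane
    have := hasW_of_hasDerivAt (h0.clog h1)
    simpa [div_self ht] using this
  have hE := ((hlog.const_mul (x + m / 2)).add (hlog.conj.const_mul (x - m / 2))).hol_comp
    (Complex.hasDerivAt_exp _)
  have hF := hE.const_mul (gp x m t)
  have hev : gp x m =ᶠ[nhds t] fun s => gp x m t * Complex.exp
      ((x + m / 2) * Complex.log (s / t) + (x - m / 2) * conj (Complex.log (s / t))) := by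
    filter_upwards [isOpen_ne.mem_nhds ht] with s hs
    have hst : s / t ≠ 0 := div_ne_zero hs ht
    conv_lhs => rw [show s = t * (s / t) by field_simp]
    rw [gp_mul ht hst, ← gpow_pr hst]
    rfl
  have := hF.congr hev
  convert this using 1
  · rw [gp_down ht]; simp [div_self ht]; ring
  · rw [gp_down_bar ht]; simp [div_self ht]; ring

theorem gp_differentiable (m : ℤ) (t : ℂ) : Differentiable ℂ (fun x : ℂ => gp x m t) := by
  unfold gp
  fun_prop

theorem measurable_gp (x : ℂ) (m : ℤ) : Measurable (gp x m) := by
  unfold gp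
  fun_prop

theorem contDiffAt_gp {t : ℂ} (ht : t ≠ 0) (x : ℂ) (m : ℤ) : ContDiffAt ℝ ∞ (gp x m) t := by
  have hn : ContDiffAt ℝ ∞ (fun s : ℂ => ‖s‖) t := contDiffAt_norm ℝ ht
  have h1 : (‖t‖ : ℂ) ≠ 0 := by simpa using ht
  have hn' : ContDiffAt ℝ ∞ (fun s : ℂ => (‖s‖ : ℂ)) t :=
    Complex.ofRealCLM.contDiff.contDiffAt.comp t hn
  have hl : ContDiffAt ℝ ∞ (fun s : ℂ => ((Real.log ‖s‖ : ℝ) : ℂ)) t :=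
    Complex.ofRealCLM.contDiff.contDiffAt.comp t (hn.log (by simpa using ht))
  have hq : ContDiffAt ℝ ∞ (fun s : ℂ => s / (‖s‖ : ℂ)) t := by
    simp only [div_eq_mul_inv]
    exact contDiffAt_id.mul (hn'.inv h1)
  have hz : ContDiffAt ℝ ∞ (fun s : ℂ => (s / (‖s‖ : ℂ)) ^ m) t := by
    cases m with
    | ofNat k => simpa using hq.pow k
    | negSucc k =>
      simp only [zpow_negSucc]
      exact (hq.pow (k + 1)).inv (pow_ne_zero _ (div_ne_zero ht h1))
  exact ((contDiffAt_const.mul hl).cexp).mul hz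

/-! ### Integrals depending holomorphically on parameters -/

/-- A local integrable majorant of the integrand suffices; none is required for its derivative. A
bounded holomorphic function on a ball is Lipschitz on a smaller ball, and dominated differentiation
applies with that Lipschitz constant. -/
theorem differentiableOn_integral {E : Type*} [NormedAddCommGroup E] [NormedSpace ℂ E]
    [FiniteDimensional ℂ E] {Ω : Set E} (hΩ : IsOpen Ω) {Ψ : E → ℂ → ℂ}
    (hm : ∀ q ∈ Ω, AEStronglyMeasurable (Ψ q) volume)
    (hd : ∀ t, DifferentiableOn ℂ (fun q => Ψ q t) Ω)
    (hb : ∀ q₀ ∈ Ω, ∃ U ∈ nhds q₀, ∃ B : ℂ → ℝ, Integrable B ∧ ∀ᵐ t, ∀ q ∈ U, ‖Ψ q t‖ ≤ B t) :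
    DifferentiableOn ℂ (fun q => ∫ t, Ψ q t) Ω := by
  intro q₀ hq₀
  obtain ⟨U, hU, B, hB, hle⟩ := hb q₀ hq₀
  obtain ⟨r, hr, hball⟩ := Metric.mem_nhds_iff.1 (Filter.inter_mem hU (hΩ.mem_nhds hq₀))
  have hsub : ∀ {x}, x ∈ Metric.ball q₀ (r / 2) → Metric.ball x (r / 2) ⊆ U ∩ Ω := by
    intro x hx y hy
    apply hball
    rw [Metric.mem_ball] at *
    linarith [dist_triangle y x q₀]
  have hB0 : ∀ᵐ t, 0 ≤ B t := by
    filter_upwards [hle] with t ht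
    exact (norm_nonneg _).trans (ht q₀ (mem_of_mem_nhds hU))
  have hdiff : ∀ t, DifferentiableAt ℂ (fun q => Ψ q t) q₀ :=
    fun t => (hd t).differentiableAt (hΩ.mem_nhds hq₀)
  let b := Module.finBasis ℂ E
  -- Each directional derivative is a limit of measurable difference quotients; a finite basis
  -- assembles them.
  have hF' : AEStronglyMeasurable (fun t => fderiv ℂ (fun q => Ψ q t) q₀) volume := by
    have hv : ∀ v : E, AEStronglyMeasurable (fun t => fderiv ℂ (fun q => Ψ q t) q₀ v) volume := by
      intro v
      have hc : Filter.Tendsto (fun n : ℕ => ‖((n : ℂ) + 1)‖) Filter.atTop Filter.atTop := by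
        have : ∀ n : ℕ, ‖((n : ℂ) + 1)‖ = (n : ℝ) + 1 := by
          intro n; exact_mod_cast Complex.norm_natCast (n + 1)
        simp only [this]
        exact Filter.tendsto_atTop_add_const_right _ _ tendsto_natCast_atTop_atTop
      have hlim : Filter.Tendsto (fun n : ℕ => q₀ + ((n : ℂ) + 1)⁻¹ • v) Filter.atTop (nhds q₀) := by
        have h0 : Filter.Tendsto (fun n : ℕ => ((n : ℂ) + 1)⁻¹) Filter.atTop (nhds 0) :=
          tendsto_zero_iff_norm_tendsto_zero.2 (by
            simp only [norm_inv]; exact hc.inv_tendsto_atTop)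
        simpa using tendsto_const_nhds.add (h0.smul_const v)
      obtain ⟨N, hN⟩ := Filter.eventually_atTop.1 (hlim.eventually (hΩ.mem_nhds hq₀))
      refine aestronglyMeasurable_of_tendsto_ae Filter.atTop
        (f := fun (n : ℕ) t => (((n + N : ℕ) : ℂ) + 1) •
          (Ψ (q₀ + (((n + N : ℕ) : ℂ) + 1)⁻¹ • v) t - Ψ q₀ t)) ?_ ?_
      · intro n
        exact ((hm _ (hN (n + N) (by omega))).sub (hm _ hq₀)).const_smul (((n + N : ℕ) : ℂ) + 1)
      · refine Filter.Eventually.of_forall fun t => ?_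
        exact ((hdiff t).hasFDerivAt.lim v hc).comp (Filter.tendsto_add_atTop_nat N)
    have : (fun t => fderiv ℂ (fun q => Ψ q t) q₀) = fun t => ∑ i, fderiv ℂ (fun q => Ψ q t) q₀ (b i) •
        LinearMap.toContinuousLinearMap (b.coord i) := by
      funext t
      ext v
      conv_lhs => rw [← b.sum_repr v]
      rw [map_sum]
      simp [mul_comm]
    rw [this]
    refine Finset.aestronglyMeasurable_fun_sum _ fun i _ => ?_
    exact (hv (b i)).smul_const _
  refine (hasFDerivAt_integral_of_dominated_loc_of_lip (bound := fun t => 2 * B t / (r / 2))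
    (s := Metric.ball q₀ (r / 2 / 2)) (Metric.ball_mem_nhds _ (by positivity)) ?_ ?_ hF' ?_ ?_
    (Filter.Eventually.of_forall fun t => (hdiff t).hasFDerivAt)).2.differentiableAt.differentiableWithinAt
  · filter_upwards [hΩ.mem_nhds hq₀] with q hq using hm q hq
  · refine hB.mono' (hm _ hq₀) ?_
    filter_upwards [hle] with t ht using ht q₀ (mem_of_mem_nhds hU)
  · filter_upwards [hle, hB0] with t ht h0
    refine LipschitzOnWith.of_dist_le_mul fun y hy x hx => ?_
    have hx' : x ∈ Metric.ball q₀ (r / 2) := Metric.ball_subset_ball (by linarith) hx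
    have hxy : y ∈ Metric.ball x (r / 2) := by
      rw [Metric.mem_ball] at *
      linarith [dist_triangle_right y x q₀]
    -- Schwarz lemma on the ball of radius r/2 about x: the increments of Ψ are bounded there by 2B.
    have := Complex.dist_le_div_mul_dist_of_mapsTo_ball (f := fun q => Ψ q t) (R₂ := 2 * B t)
      ((hd t).mono ((hsub hx').trans Set.inter_subset_right)) (fun w hw => by
        rw [Metric.mem_closedBall, dist_eq_norm]
        have h1 := ht w (hsub hx' hw).1
        have h2 := ht x (hsub hx' (Metric.mem_ball_self (by positivity))).1
        linarith [norm_sub_le (Ψ w t) (Ψ x t)]) hxy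
    simp only [Real.coe_nnabs]
    rwa [abs_of_nonneg (by positivity)]
  · exact (hB.const_mul 2).div_const _

/-! ### Integrals of derivatives -/

theorem integral_complex_eq (g : ℂ → ℂ) :
    ∫ z, g z = ∫ p : ℝ × ℝ, g (p.1 + p.2 * Complex.I) := by
  rw [← (Complex.volume_preserving_equiv_real_prod.symm).integral_comp
    Complex.measurableEquivRealProd.symm.measurableEmbedding]
  refine integral_congr_ae (Filter.Eventually.of_forall fun p => ?_)
  simp [Complex.measurableEquivRealProd_symm_apply, Complex.mk_eq_add_mul_I]

theorem integrable_complex_prod {g : ℂ → ℂ} (hg : Integrable g) :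
    Integrable (fun p : ℝ × ℝ => g (p.1 + p.2 * Complex.I)) (volume.prod volume) := by
  have := (Complex.volume_preserving_equiv_real_prod.symm.integrable_comp_emb
    Complex.measurableEquivRealProd.symm.measurableEmbedding).2 hg
  refine this.congr (Filter.Eventually.of_forall fun p => ?_)
  simp [Complex.measurableEquivRealProd_symm_apply, Complex.mk_eq_add_mul_I]

/-- By Fubini it is enough to integrate along horizontal lines. Almost all of them miss the
countable set S and carry an integrable function with integrable derivative, so the fundamental
theorem of calculus gives 0. No discs around the singular points have to be cut out. -/
theorem integral_line_derivative_eq_zero {S : Set ℂ} (hS : S.Countable) {f : ℂ → ℂ}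
    (hd : ∀ z ∉ S, DifferentiableAt ℝ f z) (hf : Integrable f)
    (hf' : Integrable (fun z => fderiv ℝ f z 1)) : ∫ z, fderiv ℝ f z 1 = 0 := by
  rw [integral_complex_eq, Measure.volume_eq_prod,
    integral_prod_symm _ (integrable_complex_prod hf')]
  refine integral_eq_zero_of_ae ?_
  have h0 : ∀ᵐ y : ℝ, y ∉ Complex.im '' S := (hS.image _).ae_notMem _
  filter_upwards [h0, (integrable_complex_prod hf).prod_left_ae,
    (integrable_complex_prod hf').prod_left_ae] with y hy h1 h2
  refine integral_eq_zero_of_hasDerivAt_of_integrable (fun x => ?_) h2 h1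
  have hz : DifferentiableAt ℝ f (x + y * Complex.I) := by
    refine hd _ fun h => hy ⟨_, h, by simp⟩
  have hl : HasDerivAt (fun x : ℝ => (x : ℂ) + y * Complex.I) 1 x :=
    (Complex.ofRealCLM.hasDerivAt.add_const _)
  exact hz.hasFDerivAt.comp_hasDerivAt x hl

theorem integral_line_derivative_I_eq_zero {S : Set ℂ} (hS : S.Countable) {f : ℂ → ℂ}
    (hd : ∀ z ∉ S, DifferentiableAt ℝ f z) (hf : Integrable f)
    (hf' : Integrable (fun z => fderiv ℝ f z Complex.I)) :
    ∫ z, fderiv ℝ f z Complex.I = 0 := by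
  rw [integral_complex_eq, Measure.volume_eq_prod,
    integral_prod _ (integrable_complex_prod hf')]
  refine integral_eq_zero_of_ae ?_
  have h0 : ∀ᵐ x : ℝ, x ∉ Complex.re '' S := (hS.image _).ae_notMem _
  filter_upwards [h0, (integrable_complex_prod hf).prod_right_ae,
    (integrable_complex_prod hf').prod_right_ae] with x hx h1 h2
  refine integral_eq_zero_of_hasDerivAt_of_integrable (fun y => ?_) h2 h1
  have hz : DifferentiableAt ℝ f (x + y * Complex.I) := by
    refine hd _ fun h => hx ⟨_, h, by simp⟩
  have hl : HasDerivAt (fun y : ℝ => (x : ℂ) + y * Complex.I) Complex.I y := by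
    simpa using (Complex.ofRealCLM.hasDerivAt.mul_const Complex.I).const_add (x : ℂ)
  exact hz.hasFDerivAt.comp_hasDerivAt y hl

theorem integral_dz_eq_zero {S : Set ℂ} (hS : S.Countable) {f : ℂ → ℂ}
    (hd : ∀ z ∉ S, DifferentiableAt ℝ f z) (hf : Integrable f) (h1 : Integrable (dz f))
    (h2 : Integrable (dzbar f)) : ∫ z, dz f z = 0 := by
  have e1 : ∀ z, fderiv ℝ f z 1 = dz f z + dzbar f z := fun z => by
    rw [fderiv_eq_wirt]; simp
  have e2 : ∀ z, fderiv ℝ f z Complex.I = Complex.I * dz f z - Complex.I * dzbar f z := fun z => by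
    rw [fderiv_eq_wirt]; simp; ring
  have i1 : Integrable (fun z => fderiv ℝ f z 1) := by
    simp only [e1]; exact h1.add h2
  have i2 : Integrable (fun z => fderiv ℝ f z Complex.I) := by
    simp only [e2]; exact (h1.const_mul _).sub (h2.const_mul _)
  have z1 := integral_line_derivative_eq_zero hS hd hf i1
  have z2 := integral_line_derivative_I_eq_zero hS hd hf i2
  have : ∫ z, dz f z = (∫ z, fderiv ℝ f z 1 - Complex.I * fderiv ℝ f z Complex.I) / 2 := by
    rw [← integral_div]; rfl
  rw [this, integral_sub i1 (i2.const_mul _), integral_const_mul, z1, z2]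
  simp

/-! ### Integrability of products of powers -/

/-- In polar coordinates the question is the integrability of y^(s+1) at 0. -/
theorem integrableAtFilter_norm_rpow {s : ℝ} (hs : -2 < s) (c : ℂ) :
    IntegrableAtFilter (fun t : ℂ => ‖t - c‖ ^ s) (nhds c) := by
  refine ⟨Metric.ball c 1, Metric.ball_mem_nhds _ one_pos, ?_⟩
  have h : IntegrableOn (fun t : ℂ => ‖t‖ ^ s) (Metric.ball 0 1) := by
    rw [integrableOn_fun_norm_addHaar volume (f := fun y : ℝ => y ^ s)]
    have : IntegrableOn (fun y : ℝ => y ^ (s + 1)) (Set.Ioo 0 1) :=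
      (intervalIntegral.integrableOn_Ioo_rpow_iff one_pos).2 (by linarith)
    refine this.congr_fun (fun y hy => ?_) measurableSet_Ioo
    simp only [Complex.finrank_real_complex, smul_eq_mul]
    rw [Real.rpow_add hy.1, Real.rpow_one]
    ring
  have h2 := ((measurePreserving_sub_right volume c).integrableOn_comp_preimage
    (MeasurableEquiv.subRight c).measurableEmbedding).2 h
  have hset : (fun x : ℂ => x - c) ⁻¹' Metric.ball 0 1 = Metric.ball c 1 := by
    ext t
    simp [dist_eq_norm]
  rwa [hset] at h2

theorem integrableAtFilter_norm_rpow_mul {s : ℝ} (hs : -2 < s) {c : ℂ} {g : ℂ → ℝ}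
    (hg : ContinuousAt g c) (hm : Measurable g) :
    IntegrableAtFilter (fun t : ℂ => ‖t - c‖ ^ s * g t) (nhds c) := by
  refine Asymptotics.IsBigO.integrableAtFilter (g := fun t : ℂ => ‖t - c‖ ^ s) ?_ ?_
    (integrableAtFilter_norm_rpow hs c)
  · simpa using (Asymptotics.isBigO_refl (fun t : ℂ => ‖t - c‖ ^ s) (nhds c)).mul
      (hg.norm.isBoundedUnder_le.isBigO_one ℝ)
  · exact (Measurable.aestronglyMeasurable (by fun_prop)).stronglyMeasurableAtFilter

/-- The quotient of |t − c| and 1 + |t| tends to 1, so its powers remain bounded for either sign of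
s. -/
theorem norm_sub_rpow_isBigO (c : ℂ) (s : ℝ) :
    (fun t : ℂ => ‖t - c‖ ^ s) =O[Filter.cocompact ℂ] fun t => (1 + ‖t‖) ^ s := by
  have h1 : Filter.Tendsto (fun t : ℂ => ‖t - c‖ / (1 + ‖t‖)) (Filter.cocompact ℂ) (nhds 1) := by
    have hn : Filter.Tendsto (fun t : ℂ => 1 + ‖t‖) (Filter.cocompact ℂ) Filter.atTop :=
      Filter.tendsto_atTop_add_const_left _ _ (tendsto_norm_cocompact_atTop)
    have h0 : Filter.Tendsto (fun t : ℂ => (1 + ‖c‖) / (1 + ‖t‖)) (Filter.cocompact ℂ) (nhds 0) :=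
      hn.const_div_atTop _
    rw [tendsto_iff_dist_tendsto_zero]
    refine squeeze_zero (fun _ => dist_nonneg) (fun t => ?_) h0
    have hp : 0 < 1 + ‖t‖ := by positivity
    rw [Real.dist_eq, div_sub_one hp.ne', abs_div, abs_of_pos hp]
    gcongr
    rw [abs_le]
    constructor
    · have := norm_sub_norm_le t c; linarith
    · have := norm_sub_le t c; linarith
  have h2 := h1.rpow_const (p := s) (Or.inl one_ne_zero)
  rw [Real.one_rpow] at h2
  refine Asymptotics.isBigO_of_div_tendsto_nhds ?_ 1 (h2.congr fun t => ?_)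
  · refine Filter.Eventually.of_forall fun t ht => absurd ht ?_
    positivity
  · rw [Pi.div_apply, Real.div_rpow (norm_nonneg _) (by positivity)]

theorem integrable_of_locally_of_isBigO {f : ℂ → ℝ} {s : ℝ} (hs : s < -2)
    (hloc : ∀ c, IntegrableAtFilter f (nhds c))
    (hO : f =O[Filter.cocompact ℂ] fun t => (1 + ‖t‖) ^ s) : Integrable f := by
  have hloc' : LocallyIntegrable f volume := hloc
  refine hloc'.integrable_of_isBigO_cocompact hO ?_
  have : Integrable (fun t : ℂ => (1 + ‖t‖) ^ s) := by
    simpa using integrable_one_add_norm (E := ℂ) (μ := volume) (r := -s) (by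
      rw [Complex.finrank_real_complex]; push_cast; linarith)
  exact this.integrableAtFilter _

theorem continuousAt_norm_sub_rpow {c t : ℂ} (h : t ≠ c) (s : ℝ) :
    ContinuousAt (fun t : ℂ => ‖t - c‖ ^ s) t := by
  have : ‖t - c‖ ≠ 0 := by simpa [sub_eq_zero] using h
  exact ContinuousAt.rpow_const (by fun_prop) (Or.inl this)

theorem integrableAtFilter_two {α β : ℝ} (hα : -2 < α) (hβ : -2 < β) {h : ℂ → ℝ} {c : ℂ}
    (hh : ContinuousAt h c) (hm : Measurable h) :
    IntegrableAtFilter (fun t : ℂ => ‖t‖ ^ α * ‖t - 1‖ ^ β * h t) (nhds c) := by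
  have k0 : ∀ t : ℂ, t ≠ 0 → ContinuousAt (fun t : ℂ => ‖t‖ ^ α) t := fun t ht => by
    simpa using continuousAt_norm_sub_rpow ht α
  by_cases c0 : c = 0
  · subst c0
    have := integrableAtFilter_norm_rpow_mul (c := 0) hα (g := fun t => ‖t - 1‖ ^ β * h t)
      ((continuousAt_norm_sub_rpow zero_ne_one β).mul hh) (by fun_prop)
    simpa [mul_assoc] using this
  by_cases c1 : c = 1
  · subst c1
    have := integrableAtFilter_norm_rpow_mul (c := 1) hβ (g := fun t => ‖t‖ ^ α * h t)
      ((k0 1 one_ne_zero).mul hh) (by fun_prop)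
    refine this.congr (Filter.Eventually.of_forall fun t => by ring)
  · have := integrableAtFilter_norm_rpow_mul (c := c) (s := 0) (by norm_num)
      (g := fun t => ‖t‖ ^ α * ‖t - 1‖ ^ β * h t)
      (((k0 c c0).mul (continuousAt_norm_sub_rpow c1 β)).mul hh) (by fun_prop)
    simpa using this

theorem integrable_two {α β γ : ℝ} (hα : -2 < α) (hβ : -2 < β) (hs : α + β + γ < -2) :
    Integrable (fun t : ℂ => ‖t‖ ^ α * ‖t - 1‖ ^ β * (1 + ‖t‖) ^ γ) := by
  refine integrable_of_locally_of_isBigO hs (fun c => ?_) ?_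
  · refine integrableAtFilter_two hα hβ (ContinuousAt.rpow_const (by fun_prop) (Or.inl ?_))
      (by fun_prop)
    positivity
  · have h0 := norm_sub_rpow_isBigO 0 α
    simp only [sub_zero] at h0
    refine ((h0.mul (norm_sub_rpow_isBigO 1 β)).mul (Asymptotics.isBigO_refl _ _)).congr_right
      fun t => ?_
    have : 0 < 1 + ‖t‖ := by positivity
    rw [Real.rpow_add this, Real.rpow_add this]

theorem integrable_three {α β γ : ℝ} (hα : -2 < α) (hβ : -2 < β) (hγ : -2 < γ)
    (hs : α + β + γ < -2) {z : ℂ} (hz : z ∈ puncturedPlane) :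
    Integrable (fun t : ℂ => ‖t‖ ^ α * ‖t - 1‖ ^ β * ‖t - z‖ ^ γ) := by
  refine integrable_of_locally_of_isBigO hs (fun c => ?_) ?_
  · by_cases hc : c = z
    · subst hc
      have k0 : ContinuousAt (fun t : ℂ => ‖t‖ ^ α) c := by
        simpa using continuousAt_norm_sub_rpow hz.1 α
      have := integrableAtFilter_norm_rpow_mul (c := c) hγ
        (g := fun t => ‖t‖ ^ α * ‖t - 1‖ ^ β)
        (k0.mul (continuousAt_norm_sub_rpow hz.2 β)) (by fun_prop)
      exact this.congr (Filter.Eventually.of_forall fun t => by ring)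
    · exact integrableAtFilter_two hα hβ (continuousAt_norm_sub_rpow hc γ) (by fun_prop)
  · have h0 := norm_sub_rpow_isBigO 0 α
    simp only [sub_zero] at h0
    refine ((h0.mul (norm_sub_rpow_isBigO 1 β)).mul (norm_sub_rpow_isBigO z γ)).congr_right
      fun t => ?_
    have : 0 < 1 + ‖t‖ := by positivity
    rw [Real.rpow_add this, Real.rpow_add this]

theorem locallyIntegrable_norm_sub_rpow {γ : ℝ} (hγ : -2 < γ) (z : ℂ) :
    LocallyIntegrable (fun t : ℂ => ‖t - z‖ ^ γ) := by
  intro c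
  by_cases hc : c = z
  · subst hc; exact integrableAtFilter_norm_rpow hγ c
  · have := integrableAtFilter_norm_rpow_mul (c := c) (s := 0) (by norm_num)
      (continuousAt_norm_sub_rpow hc γ) (by fun_prop)
    simpa using this

/-! ### Families that are holomorphic in parameters and smooth in the variable -/

/-- `F q z` is holomorphic in `q ∈ Ω`, and so are its Wirtinger derivatives with respect to
`z ∈ V` up to the order `k`. -/
def Nice {E : Type*} [NormedAddCommGroup E] [NormedSpace ℂ E] :
    ℕ → Set E → Set ℂ → (E → ℂ → ℂ) → Prop
  | 0, Ω, V, F => ∀ z ∈ V, DifferentiableOn ℂ (fun q => F q z) Ω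
  | k + 1, Ω, V, F => (∀ z ∈ V, DifferentiableOn ℂ (fun q => F q z) Ω) ∧
      (∀ q ∈ Ω, ∀ z ∈ V, DifferentiableAt ℝ (F q) z) ∧
      Nice k Ω V (fun q => dz (F q)) ∧ Nice k Ω V (fun q => dzbar (F q))

section Nice

variable {E : Type*} [NormedAddCommGroup E] [NormedSpace ℂ E] {Ω : Set E} {V : Set ℂ}
  {F G : E → ℂ → ℂ} {k : ℕ}

theorem Nice.hol (h : Nice k Ω V F) {z : ℂ} (hz : z ∈ V) :
    DifferentiableOn ℂ (fun q => F q z) Ω := by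
  cases k with
  | zero => exact h z hz
  | succ k => exact h.1 z hz

theorem Nice.differentiableAt (h : Nice (k + 1) Ω V F) {q : E} (hq : q ∈ Ω) {z : ℂ} (hz : z ∈ V) :
    DifferentiableAt ℝ (F q) z := h.2.1 q hq z hz

theorem Nice.pred (h : Nice (k + 1) Ω V F) : Nice k Ω V F := by
  induction k generalizing F with
  | zero => exact h.1
  | succ k ih => exact ⟨h.1, h.2.1, ih h.2.2.1, ih h.2.2.2⟩

theorem Nice.congr (hV : IsOpen V) (h : Nice k Ω V F) (hFG : ∀ q ∈ Ω, ∀ z ∈ V, G q z = F q z) :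
    Nice k Ω V G := by
  induction k generalizing F G with
  | zero => exact fun z hz => (h z hz).congr fun q hq => hFG q hq z hz
  | succ k ih =>
    have hev : ∀ q ∈ Ω, ∀ z ∈ V, G q =ᶠ[nhds z] F q := fun q hq z hz => by
      filter_upwards [hV.mem_nhds hz] with w hw using hFG q hq w hw
    refine ⟨fun z hz => (h.1 z hz).congr fun q hq => hFG q hq z hz, fun q hq z hz =>
      (h.2.1 q hq z hz).congr_of_eventuallyEq (hev q hq z hz), ih h.2.2.1 fun q hq z hz =>
      dz_congr (hev q hq z hz), ih h.2.2.2 fun q hq z hz => dzbar_congr (hev q hq z hz)⟩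

theorem Nice.mono {Ω' : Set E} {V' : Set ℂ} (h : Nice k Ω V F) (hΩ : Ω' ⊆ Ω) (hV : V' ⊆ V) :
    Nice k Ω' V' F := by
  induction k generalizing F with
  | zero => exact fun z hz => (h z (hV hz)).mono hΩ
  | succ k ih =>
    exact ⟨fun z hz => (h.1 z (hV hz)).mono hΩ, fun q hq z hz => h.2.1 q (hΩ hq) z (hV hz),
      ih h.2.2.1, ih h.2.2.2⟩

theorem nice_of_locally (h : ∀ z ∈ V, ∃ V', z ∈ V' ∧ Nice k Ω V' F) : Nice k Ω V F := by
  induction k generalizing F with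
  | zero =>
    intro z hz
    obtain ⟨V', hz', h'⟩ := h z hz
    exact h' z hz'
  | succ k ih =>
    refine ⟨fun z hz => ?_, fun q hq z hz => ?_, ih fun z hz => ?_, ih fun z hz => ?_⟩ <;>
      obtain ⟨V', hz', h'⟩ := h z hz
    exacts [h'.1 z hz', h'.2.1 q hq z hz', ⟨V', hz', h'.2.2.1⟩, ⟨V', hz', h'.2.2.2⟩]

theorem nice_succ_of_hasW (hV : IsOpen V) {P Q : E → ℂ → ℂ}
    (h0 : ∀ z ∈ V, DifferentiableOn ℂ (fun q => F q z) Ω)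
    (hW : ∀ q ∈ Ω, ∀ z ∈ V, HasW (F q) (P q z) (Q q z) z) (hP : Nice k Ω V P)
    (hQ : Nice k Ω V Q) : Nice (k + 1) Ω V F :=
  ⟨h0, fun q hq z hz => (hW q hq z hz).differentiableAt,
    hP.congr hV fun q hq z hz => (hW q hq z hz).dz_eq,
    hQ.congr hV fun q hq z hz => (hW q hq z hz).dzbar_eq⟩

theorem Nice.hasW (h : Nice (k + 1) Ω V F) {q : E} (hq : q ∈ Ω) {z : ℂ} (hz : z ∈ V) :
    HasW (F q) (dz (F q) z) (dzbar (F q) z) z :=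
  hasW_of_differentiableAt (h.2.1 q hq z hz)

theorem Nice.add (hV : IsOpen V) (hF : Nice k Ω V F) (hG : Nice k Ω V G) :
    Nice k Ω V (fun q z => F q z + G q z) := by
  induction k generalizing F G with
  | zero => exact fun z hz => (hF z hz).add (hG z hz)
  | succ k ih =>
    exact nice_succ_of_hasW hV (fun z hz => (hF.1 z hz).add (hG.1 z hz))
      (fun q hq z hz => (hF.hasW hq hz).add (hG.hasW hq hz))
      (ih hF.2.2.1 hG.2.2.1) (ih hF.2.2.2 hG.2.2.2)

theorem Nice.mul (hV : IsOpen V) (hF : Nice k Ω V F) (hG : Nice k Ω V G) :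
    Nice k Ω V (fun q z => F q z * G q z) := by
  induction k generalizing F G with
  | zero => exact fun z hz => (hF z hz).mul (hG z hz)
  | succ k ih =>
    exact nice_succ_of_hasW hV (fun z hz => (hF.1 z hz).mul (hG.1 z hz))
      (fun q hq z hz => (hF.hasW hq hz).mul (hG.hasW hq hz))
      ((ih hF.2.2.1 hG.pred).add hV (ih hF.pred hG.2.2.1))
      ((ih hF.2.2.2 hG.pred).add hV (ih hF.pred hG.2.2.2))

theorem nice_param (hV : IsOpen V) {g : E → ℂ} (hg : DifferentiableOn ℂ g Ω) :
    Nice k Ω V (fun q _ => g q) := by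
  induction k generalizing g with
  | zero => exact fun _ _ => hg
  | succ k ih =>
    exact nice_succ_of_hasW hV (fun _ _ => hg) (fun q _ z _ => hasW_const (g q) z)
      (ih (differentiableOn_const 0)) (ih (differentiableOn_const 0))

theorem nice_id (hV : IsOpen V) : Nice k Ω V (fun _ z => z) := by
  cases k with
  | zero => exact fun _ _ => differentiableOn_const _
  | succ k =>
    exact nice_succ_of_hasW hV (fun _ _ => differentiableOn_const _) (fun q _ z _ => hasW_id z)
      (nice_param hV (differentiableOn_const 1)) (nice_param hV (differentiableOn_const 0))

theorem Nice.comp_param {E' : Type*} [NormedAddCommGroup E'] [NormedSpace ℂ E'] {Ω' : Set E'}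
    {φ : E' → E} (h : Nice k Ω V F) (hφ : DifferentiableOn ℂ φ Ω') (hm : Set.MapsTo φ Ω' Ω) :
    Nice k Ω' V (fun q => F (φ q)) := by
  induction k generalizing F with
  | zero => exact fun z hz => (h z hz).comp hφ hm
  | succ k ih =>
    exact ⟨fun z hz => (h.1 z hz).comp hφ hm, fun q hq z hz => h.2.1 _ (hm hq) z hz,
      ih h.2.2.1, ih h.2.2.2⟩

/-- One order is lost because the derivatives of top order are not known to be continuous in z. For
k = 0 there is no information on regularity in z at all, hence the alternative. -/
theorem Nice.contDiffOn (hV : IsOpen V) (h : Nice k Ω V F) {q : E} (hq : q ∈ Ω) :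
    ContDiffOn ℝ (k - 1 : ℕ) (F q) V ∨ k = 0 := by
  induction k generalizing F with
  | zero => exact Or.inr rfl
  | succ k ih =>
    left
    have hd : DifferentiableOn ℝ (F q) V := fun z hz => (h.2.1 q hq z hz).differentiableWithinAt
    cases k with
    | zero => exact contDiffOn_zero.2 hd.continuousOn
    | succ k =>
      have h1 := (ih h.2.2.1).resolve_right (by omega)
      have h2 := (ih h.2.2.2).resolve_right (by omega)
      simp only [Nat.add_sub_cancel] at h1 h2 ⊢
      push_cast
      rw [contDiffOn_succ_iff_fderiv_of_isOpen hV]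
      refine ⟨hd, by simp, ?_⟩
      have : (fun z => fderiv ℝ (F q) z) = fun z =>
          dz (F q) z • (ContinuousLinearMap.id ℝ ℂ) +
            dzbar (F q) z • (Complex.conjCLE : ℂ →L[ℝ] ℂ) := by
        funext z
        exact fderiv_eq_wirt _ _
      change ContDiffOn ℝ k (fun z => fderiv ℝ (F q) z) V
      rw [this]
      exact (h1.smul contDiffOn_const).add (h2.smul contDiffOn_const)

theorem contDiffOn_of_nice (hV : IsOpen V) (h : ∀ k, Nice k Ω V F) {q : E} (hq : q ∈ Ω) :
    ContDiffOn ℝ ∞ (F q) V := by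
  rw [contDiffOn_infty]
  intro k
  exact ((h (k + 1)).contDiffOn hV hq).resolve_right (by omega)

end Nice

/-! ### The identity theorem on convex sets -/

/-- Restricted to the complex line through a point of N and the given point, the domain is a convex
subset of ℂ, and the identity theorem in one variable applies. -/
theorem eqOn_zero_of_convex {E : Type*} [NormedAddCommGroup E] [NormedSpace ℂ E]
    {Ω N : Set E} (hΩ : IsOpen Ω) (hc : Convex ℝ Ω) (hN : IsOpen N) (hne : N.Nonempty)
    (hNΩ : N ⊆ Ω) {f : E → ℂ} (hf : DifferentiableOn ℂ f Ω) (h0 : ∀ q ∈ N, f q = 0) :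
    ∀ q ∈ Ω, f q = 0 := by
  intro x hx
  obtain ⟨y, hy⟩ := hne
  let φ : ℂ → E := fun s => y + s • (x - y)
  have hφ : Continuous φ := by fun_prop
  have hφd : Differentiable ℂ φ := by fun_prop
  have hU : IsOpen (φ ⁻¹' Ω) := hΩ.preimage hφ
  have hUc : Convex ℝ (φ ⁻¹' Ω) := by
    intro s hs t ht a b ha hb hab
    have : φ (a • s + b • t) = a • φ s + b • φ t := by
      have hb' : (b : ℂ) = 1 - a := by rw [← Complex.ofReal_one, ← Complex.ofReal_sub]; congr 1; linarith
      simp only [φ, ← Complex.coe_smul, hb']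
      module
    rw [Set.mem_preimage, this]
    exact hc hs ht ha hb hab
  have hg : AnalyticOnNhd ℂ (fun s => f (φ s)) (φ ⁻¹' Ω) :=
    (hf.comp hφd.differentiableOn (Set.mapsTo_preimage _ _)).analyticOnNhd hU
  have h0' : (0 : ℂ) ∈ φ ⁻¹' Ω := by
    rw [Set.mem_preimage, show φ 0 = y by simp [φ]]
    exact hNΩ hy
  have hev : (fun s => f (φ s)) =ᶠ[nhds 0] 0 := by
    have : φ ⁻¹' N ∈ nhds (0 : ℂ) := by
      refine (hN.preimage hφ).mem_nhds ?_
      rw [Set.mem_preimage, show φ 0 = y by simp [φ]]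
      exact hy
    filter_upwards [this] with s hs using h0 _ hs
  have := hg.eqOn_zero_of_preconnected_of_eventuallyEq_zero hUc.isPreconnected h0' hev
    (show (1 : ℂ) ∈ φ ⁻¹' Ω by rw [Set.mem_preimage, show φ 1 = x by simp [φ]]; exact hx)
  simpa [φ] using this

/-! ### Test functions -/

theorem isOpen_puncturedPlane : IsOpen puncturedPlane :=
  (isOpen_ne (x := (0 : ℂ))).inter (isOpen_ne (x := (1 : ℂ)))

/-- The behaviour of g at 0 and 1 is irrelevant, since χ vanishes near both points. -/
theorem IsTestFunction.mul_of_contDiffAt {χ g : ℂ → ℂ} (hχ : IsTestFunction χ)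
    (hg : ∀ z ∈ puncturedPlane, ContDiffAt ℝ ∞ g z) : IsTestFunction (fun z => χ z * g z) := by
  refine ⟨contDiff_iff_contDiffAt.2 fun z => ?_, hχ.2.1.mul_right,
    (tsupport_mul_subset_left (f := χ) (g := g)).trans hχ.2.2⟩
  by_cases hz : z ∈ tsupport χ
  · exact hχ.1.contDiffAt.mul (hg z (hχ.2.2 hz))
  · have : (fun z => χ z * g z) =ᶠ[nhds z] fun _ => 0 := by
      filter_upwards [notMem_tsupport_iff_eventuallyEq.1 hz] with w hw
      simp [hw]
    exact contDiffAt_const.congr_of_eventuallyEq this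

theorem IsTestFunction.continuous_norm_mul {χ : ℂ → ℂ} {g : ℂ → ℝ} (hχ : IsTestFunction χ)
    (hg : ∀ z ∈ puncturedPlane, ContinuousAt g z) : Continuous (fun z => ‖χ z‖ * g z) := by
  refine continuous_iff_continuousAt.2 fun z => ?_
  by_cases hz : z ∈ tsupport χ
  · exact hχ.1.continuous.norm.continuousAt.mul (hg z (hχ.2.2 hz))
  · have : (fun z => ‖χ z‖ * g z) =ᶠ[nhds z] fun _ => 0 := by
      filter_upwards [notMem_tsupport_iff_eventuallyEq.1 hz] with w hw
      simp [hw]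
    exact continuousAt_const.congr this.symm

theorem IsTestFunction.fderiv_apply {χ : ℂ → ℂ} (hχ : IsTestFunction χ) (v : ℂ) :
    IsTestFunction (fun z => fderiv ℝ χ z v) :=
  ⟨(hχ.1.fderiv_right (m := ∞) le_rfl).clm_apply contDiff_const, hχ.2.1.fderiv_apply ℝ v,
    (tsupport_fderiv_apply_subset ℝ v).trans hχ.2.2⟩

theorem IsTestFunction.const_mul {χ : ℂ → ℂ} (hχ : IsTestFunction χ) (c : ℂ) :
    IsTestFunction (fun z => c * χ z) := by
  simpa [mul_comm] using hχ.mul_of_contDiffAt (g := fun _ => c) fun _ _ => contDiffAt_const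

theorem IsTestFunction.add {χ ψ : ℂ → ℂ} (hχ : IsTestFunction χ) (hψ : IsTestFunction ψ) :
    IsTestFunction (fun z => χ z + ψ z) :=
  ⟨hχ.1.add hψ.1, hχ.2.1.add hψ.2.1,
    (tsupport_add (f := χ) (g := ψ)).trans (Set.union_subset hχ.2.2 hψ.2.2)⟩

theorem IsTestFunction.dz {χ : ℂ → ℂ} (hχ : IsTestFunction χ) : IsTestFunction (dz χ) := by
  have := ((hχ.fderiv_apply 1).add ((hχ.fderiv_apply Complex.I).const_mul (-Complex.I))).const_mul
    (1 / 2)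
  convert this using 2 with z
  rw [ComplexJacobi.dz]
  ring

theorem IsTestFunction.dzbar {χ : ℂ → ℂ} (hχ : IsTestFunction χ) : IsTestFunction (dzbar χ) := by
  have := ((hχ.fderiv_apply 1).add ((hχ.fderiv_apply Complex.I).const_mul (Complex.I))).const_mul
    (1 / 2)
  convert this using 2 with z
  rw [ComplexJacobi.dzbar]
  ring

theorem IsTestFunction.hasW {χ : ℂ → ℂ} (hχ : IsTestFunction χ) (z : ℂ) :
    HasW χ (ComplexJacobi.dz χ z) (ComplexJacobi.dzbar χ z) z :=
  hasW_of_differentiableAt (hχ.1.differentiable (by simp) z)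

theorem IsTestFunction.integrable {χ : ℂ → ℂ} (hχ : IsTestFunction χ) : Integrable χ :=
  hχ.1.continuous.integrable_of_hasCompactSupport hχ.2.1

theorem IsTestFunction.integral_dz {χ : ℂ → ℂ} (hχ : IsTestFunction χ) :
    ∫ z, ComplexJacobi.dz χ z = 0 :=
  integral_dz_eq_zero Set.countable_empty (fun z _ => (hχ.hasW z).differentiableAt) hχ.integrable
    hχ.dz.integrable hχ.dzbar.integrable

/-! ### The Euler type integral -/

/-- The integral of `ρ(t) t^a (t - 1)^b (t - z)^c`, where the real parts of the exponents are
given by the vector `q` and the half differences by `m`, `n`, `l`. -/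
def J (ρ : ℂ → ℂ) (m n l : ℤ) (q : ℂ × ℂ × ℂ) (z : ℂ) : ℂ :=
  ∫ t, ρ t * (gp q.1 m t * gp q.2.1 n (t - 1) * gp q.2.2 l (t - z))

/-- The modulus of the integrand of `J`. -/
def wt (r : ℝ × ℝ × ℝ) (z t : ℂ) : ℝ :=
  ‖t‖ ^ (2 * r.1) * ‖t - 1‖ ^ (2 * r.2.1) * ‖t - z‖ ^ (2 * r.2.2)

/-- The real parts of a parameter vector. -/
def reVec (q : ℂ × ℂ × ℂ) : ℝ × ℝ × ℝ := (q.1.re, q.2.1.re, q.2.2.re)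

theorem continuous_reVec : Continuous reVec := by unfold reVec; fun_prop

theorem wt_nonneg (r : ℝ × ℝ × ℝ) (z t : ℂ) : 0 ≤ wt r z t := by unfold wt; positivity

theorem measurable_wt (r : ℝ × ℝ × ℝ) (z : ℂ) : Measurable (wt r z) := by unfold wt; fun_prop

theorem ae_ne (c : ℂ) : ∀ᵐ t : ℂ, t ≠ c := by
  simp [ae_iff]

theorem norm_integrand {z t : ℂ} (h0 : t ≠ 0) (h1 : t ≠ 1) (hz : t ≠ z) (m n l : ℤ)
    (q : ℂ × ℂ × ℂ) :
    ‖gp q.1 m t * gp q.2.1 n (t - 1) * gp q.2.2 l (t - z)‖ = wt (reVec q) z t := by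
  rw [norm_mul, norm_mul, norm_gp h0, norm_gp (sub_ne_zero.2 h1), norm_gp (sub_ne_zero.2 hz)]
  rfl

theorem measurable_integrand (m n l : ℤ) (q : ℂ × ℂ × ℂ) (z : ℂ) :
    Measurable (fun t => gp q.1 m t * gp q.2.1 n (t - 1) * gp q.2.2 l (t - z)) := by
  have h1 := measurable_gp q.1 m
  have h2 := (measurable_gp q.2.1 n).comp (measurable_sub_const 1)
  have h3 := (measurable_gp q.2.2 l).comp (measurable_sub_const z)
  exact (h1.mul h2).mul h3

theorem integrable_integrand {ρ : ℂ → ℂ} (hρ : Measurable ρ) (m n l : ℤ) {q : ℂ × ℂ × ℂ} {z : ℂ}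
    (hi : Integrable (fun t => ‖ρ t‖ * wt (reVec q) z t)) :
    Integrable (fun t => ρ t * (gp q.1 m t * gp q.2.1 n (t - 1) * gp q.2.2 l (t - z))) := by
  refine hi.mono' (hρ.mul (measurable_integrand m n l q z)).aestronglyMeasurable ?_
  filter_upwards [ae_ne 0, ae_ne 1, ae_ne z] with t h0 h1 hz
  rw [norm_mul, norm_integrand h0 h1 hz]

theorem rpow_le_add {t a b s : ℝ} (ht : 0 < t) (ha : a ≤ s) (hb : s ≤ b) :
    t ^ s ≤ t ^ a + t ^ b := by
  have h1 : 0 ≤ t ^ a := by positivity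
  have h2 : 0 ≤ t ^ b := by positivity
  rcases le_total 1 t with h | h
  · linarith [Real.rpow_le_rpow_of_exponent_le h hb]
  · linarith [Real.rpow_le_rpow_of_exponent_ge ht h ha]

/-- On a small cube of exponents each power of a modulus is at most the sum of its values at the two
end exponents. Multiplied out, the weights at the eight corners of the cube form a common majorant,
and they are integrable because R is open. -/
theorem differentiableOn_J {R : Set (ℝ × ℝ × ℝ)} (hR : IsOpen R) {ρ : ℂ → ℂ} (hρ : Measurable ρ)
    (m n l : ℤ) {z : ℂ} (hi : ∀ r ∈ R, Integrable (fun t => ‖ρ t‖ * wt r z t)) :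
    DifferentiableOn ℂ (fun q => J ρ m n l q z) (reVec ⁻¹' R) := by
  refine differentiableOn_integral (hR.preimage continuous_reVec)
    (fun q _ => (hρ.mul (measurable_integrand m n l q z)).aestronglyMeasurable) (fun t => ?_) ?_
  · have h1 := (gp_differentiable m t).comp (differentiable_fst (𝕜 := ℂ) (E := ℂ) (F := ℂ × ℂ))
    have h2 := (gp_differentiable n (t - 1)).comp
      ((differentiable_fst (𝕜 := ℂ) (E := ℂ) (F := ℂ)).comp
        (differentiable_snd (𝕜 := ℂ) (E := ℂ) (F := ℂ × ℂ)))
    have h3 := (gp_differentiable l (t - z)).comp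
      ((differentiable_snd (𝕜 := ℂ) (E := ℂ) (F := ℂ)).comp
        (differentiable_snd (𝕜 := ℂ) (E := ℂ) (F := ℂ × ℂ)))
    exact (((h1.mul h2).mul h3).const_mul (ρ t)).differentiableOn
  · intro q₀ hq₀
    obtain ⟨e, he, hball⟩ := Metric.isOpen_iff.1 hR _ hq₀
    set a := (reVec q₀).1
    set b := (reVec q₀).2.1
    set c := (reVec q₀).2.2
    have hv : ∀ s₁ s₂ s₃ : ℝ, |s₁| ≤ 1 → |s₂| ≤ 1 → |s₃| ≤ 1 →
        Integrable (fun t => ‖ρ t‖ *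
          wt (a + s₁ * (e / 2), b + s₂ * (e / 2), c + s₃ * (e / 2)) z t) := by
      intro s₁ s₂ s₃ h1 h2 h3
      apply hi
      apply hball
      have hs : ∀ s : ℝ, |s| ≤ 1 → |s * (e / 2)| < e := fun s hs => by
        rw [abs_mul, abs_of_pos (half_pos he)]
        nlinarith
      rw [Metric.mem_ball, Prod.dist_eq, Prod.dist_eq, max_lt_iff, max_lt_iff]
      simp only [Real.dist_eq]
      refine ⟨?_, ?_, ?_⟩ <;>
      · rw [add_sub_cancel_left]
        exact hs _ (by assumption)
    refine ⟨reVec ⁻¹' Metric.ball (reVec q₀) (e / 2),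
      continuous_reVec.continuousAt.preimage_mem_nhds (Metric.ball_mem_nhds _ (half_pos he)),
      fun t => ‖ρ t‖ * ((‖t‖ ^ (2 * (a - e / 2)) + ‖t‖ ^ (2 * (a + e / 2))) *
        (‖t - 1‖ ^ (2 * (b - e / 2)) + ‖t - 1‖ ^ (2 * (b + e / 2))) *
        (‖t - z‖ ^ (2 * (c - e / 2)) + ‖t - z‖ ^ (2 * (c + e / 2)))), ?_, ?_⟩
    · have h := fun s₁ s₂ s₃ h1 h2 h3 => hv s₁ s₂ s₃ h1 h2 h3
      have p : |(1 : ℝ)| ≤ 1 := by simp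
      have n : |(-1 : ℝ)| ≤ 1 := by simp
      have := ((((h 1 1 1 p p p).add (h 1 1 (-1) p p n)).add
        ((h 1 (-1) 1 p n p).add (h 1 (-1) (-1) p n n))).add
        (((h (-1) 1 1 n p p).add (h (-1) 1 (-1) n p n)).add
        ((h (-1) (-1) 1 n n p).add (h (-1) (-1) (-1) n n n))))
      refine this.congr (Filter.Eventually.of_forall fun t => ?_)
      simp only [Pi.add_apply, wt, one_mul, neg_one_mul, ← sub_eq_add_neg]
      ring
    · filter_upwards [ae_ne 0, ae_ne 1, ae_ne z] with t h0 h1 hz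
      intro q hq
      rw [norm_mul, norm_integrand h0 h1 hz, wt]
      rw [Set.mem_preimage, Metric.mem_ball, Prod.dist_eq, Prod.dist_eq, max_lt_iff, max_lt_iff]
        at hq
      simp only [Real.dist_eq, abs_lt] at hq
      obtain ⟨⟨q1, q2⟩, ⟨q3, q4⟩, q5, q6⟩ := hq
      have p0 : 0 < ‖t‖ := norm_pos_iff.2 h0
      have p1 : 0 < ‖t - 1‖ := norm_pos_iff.2 (sub_ne_zero.2 h1)
      have p2 : 0 < ‖t - z‖ := norm_pos_iff.2 (sub_ne_zero.2 hz)
      gcongr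
      · exact rpow_le_add p0 (by linarith) (by linarith)
      · exact rpow_le_add p1 (by linarith) (by linarith)
      · exact rpow_le_add p2 (by linarith) (by linarith)

/-! #### Weights with compact support in the punctured plane -/

theorem continuousAt_two_weights (a b : ℝ) {z : ℂ} (hz : z ∈ puncturedPlane) :
    ContinuousAt (fun t : ℂ => ‖t‖ ^ a * ‖t - 1‖ ^ b) z := by
  have k0 : ContinuousAt (fun t : ℂ => ‖t‖ ^ a) z := by
    simpa using continuousAt_norm_sub_rpow hz.1 a
  exact k0.mul (continuousAt_norm_sub_rpow hz.2 b)

theorem integrable_test_wt {χ : ℂ → ℂ} (hχ : IsTestFunction χ) {r : ℝ × ℝ × ℝ}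
    (hr : -1 < r.2.2) (z : ℂ) : Integrable (fun t => ‖χ t‖ * wt r z t) := by
  have h1 := hχ.continuous_norm_mul (g := fun t => ‖t‖ ^ (2 * r.1) * ‖t - 1‖ ^ (2 * r.2.1))
    fun z hz => continuousAt_two_weights _ _ hz
  have h2 : HasCompactSupport
      (fun t : ℂ => ‖χ t‖ * (‖t‖ ^ (2 * r.1) * ‖t - 1‖ ^ (2 * r.2.1))) := hχ.2.1.norm.mul_right
  have := (locallyIntegrable_norm_sub_rpow (γ := 2 * r.2.2) (by linarith)
    z).integrable_smul_left_of_hasCompactSupport h1 h2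
  refine this.congr (Filter.Eventually.of_forall fun t => ?_)
  simp only [wt, smul_eq_mul]
  ring

/-- The parameters for which the integral converges locally at `z`. -/
def regInner : Set (ℝ × ℝ × ℝ) := {r | -1 < r.2.2}

theorem isOpen_regInner : IsOpen regInner := isOpen_lt continuous_const (by fun_prop)

theorem integral_lin_three {A B C : ℂ → ℂ} (hA : Integrable A) (hB : Integrable B)
    (hC : Integrable C) (b c : ℂ) :
    (∫ t, A t) + (b * (∫ t, B t) + c * ∫ t, C t) = ∫ t, (A t + (b * B t + c * C t)) := by
  have h1 := integral_add hA ((hB.const_mul b).add (hC.const_mul c))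
  have h2 := integral_add (hB.const_mul b) (hC.const_mul c)
  simp only [Pi.add_apply] at h1
  rw [h1, h2, integral_const_mul, integral_const_mul]

/-- Differentiating the power of t − z could destroy integrability at z. Instead `J` is read as a
convolution of that locally integrable power with a test function, and the derivative falls on the
test function. The exponent at z is unchanged, so the step can be iterated without leaving
`regInner`. -/
theorem hasW_J_test {χ : ℂ → ℂ} (hχ : IsTestFunction χ) (m n l : ℤ) {q : ℂ × ℂ × ℂ}
    (hq : reVec q ∈ regInner) (z : ℂ) :
    HasW (J χ m n l q)
      (J (dz χ) m n l q z + ((q.1 + m / 2) * J χ (m - 1) n l (q.1 - 1 / 2, q.2.1, q.2.2) z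
        + (q.2.1 + n / 2) * J χ m (n - 1) l (q.1, q.2.1 - 1 / 2, q.2.2) z))
      (J (dzbar χ) m n l q z + ((q.1 - m / 2) * J χ (m + 1) n l (q.1 - 1 / 2, q.2.1, q.2.2) z
        + (q.2.1 - n / 2) * J χ m (n + 1) l (q.1, q.2.1 - 1 / 2, q.2.2) z)) z := by
  set G : ℂ → ℂ := fun t => χ t * (gp q.1 m t * gp q.2.1 n (t - 1)) with hG
  -- The reflected power: H(z − t) is the power of t − z.
  set H : ℂ → ℂ := fun u => gp q.2.2 l (-u) with hH
  have hGt : IsTestFunction G := hχ.mul_of_contDiffAt fun t ht =>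
    (contDiffAt_gp ht.1 _ _).mul
      ((contDiffAt_gp (sub_ne_zero.2 ht.2) q.2.1 n).comp t (contDiffAt_id.sub contDiffAt_const))
  have hHl : LocallyIntegrable H := by
    have h := locallyIntegrable_norm_sub_rpow (γ := 2 * q.2.2.re)
      (by have : -1 < q.2.2.re := hq; linarith) 0
    refine h.mono ((measurable_gp _ _).comp measurable_neg).aestronglyMeasurable ?_
    filter_upwards [ae_ne 0] with t ht
    rw [hH, norm_gp (neg_ne_zero.2 ht), norm_neg, sub_zero]
    exact le_abs_self _
  have conv_eq : ∀ (g : ℂ → ℂ) (w : ℂ),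
      convolution H g (ContinuousLinearMap.mul ℝ ℂ) volume w
        = ∫ t, g t * gp q.2.2 l (t - w) := by
    intro g w
    rw [convolution_def, ← integral_sub_left_eq_self _ _ w]
    refine integral_congr_ae (Filter.Eventually.of_forall fun t => ?_)
    simp only [hH, ContinuousLinearMap.mul_apply', neg_sub, sub_sub_cancel]
    ring
  have hJ : J χ m n l q = convolution H G (ContinuousLinearMap.mul ℝ ℂ) volume := by
    funext w
    rw [conv_eq, J]
    refine integral_congr_ae (Filter.Eventually.of_forall fun t => ?_)
    simp only [hG]
    ring
  have hder := hGt.2.1.hasFDerivAt_convolution_right (ContinuousLinearMap.mul ℝ ℂ) hHl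
    (hGt.1.of_le (by simp)) z
  have hW := hasW_of_differentiableAt hder.differentiableAt
  have hdir : ∀ v, fderiv ℝ (convolution H G (ContinuousLinearMap.mul ℝ ℂ) volume) z v
      = ∫ t, fderiv ℝ G t v * gp q.2.2 l (t - z) := by
    intro v
    rw [hder.fderiv, convolution_precompR_apply _ hHl (hGt.2.1.fderiv ℝ)
      (hGt.1.continuous_fderiv (by simp)), conv_eq]
  have hint : ∀ v, Integrable (fun t => fderiv ℝ G t v * gp q.2.2 l (t - z)) := by
    intro v
    have hl : LocallyIntegrable (fun t => gp q.2.2 l (t - z)) := by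
      have h := locallyIntegrable_norm_sub_rpow (γ := 2 * q.2.2.re)
        (by have : -1 < q.2.2.re := hq; linarith) z
      refine h.mono ((measurable_gp _ _).comp (measurable_sub_const z)).aestronglyMeasurable ?_
      filter_upwards [ae_ne z] with t ht
      rw [norm_gp (sub_ne_zero.2 ht)]
      exact le_abs_self _
    have := hl.integrable_smul_left_of_hasCompactSupport (hGt.fderiv_apply v).1.continuous
      (hGt.fderiv_apply v).2.1
    simpa using this
  have hGW : ∀ t ∈ puncturedPlane, HasW G
      (dz χ t * (gp q.1 m t * gp q.2.1 n (t - 1)) +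
        χ t * ((q.1 + m / 2) * gp (q.1 - 1 / 2) (m - 1) t * gp q.2.1 n (t - 1) +
          gp q.1 m t * ((q.2.1 + n / 2) * gp (q.2.1 - 1 / 2) (n - 1) (t - 1))))
      (dzbar χ t * (gp q.1 m t * gp q.2.1 n (t - 1)) +
        χ t * ((q.1 - m / 2) * gp (q.1 - 1 / 2) (m + 1) t * gp q.2.1 n (t - 1) +
          gp q.1 m t * ((q.2.1 - n / 2) * gp (q.2.1 - 1 / 2) (n + 1) (t - 1)))) t := by
    intro t ht
    have h1 : HasW (fun t => gp q.2.1 n (t - 1)) _ _ t :=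
      (hasW_gp (sub_ne_zero.2 ht.2) q.2.1 n).comp_hol (g := fun t => t - 1)
        ((hasDerivAt_id' t).sub_const 1)
    simp only [mul_one, map_one] at h1
    exact (hχ.hasW t).mul ((hasW_gp ht.1 q.1 m).mul h1)
  have hi : ∀ {ψ : ℂ → ℂ}, IsTestFunction ψ → ∀ (m n : ℤ) (x y : ℂ), Integrable
      (fun t => ψ t * (gp x m t * gp y n (t - 1) * gp q.2.2 l (t - z))) := by
    intro ψ hψ m n x y
    exact integrable_integrand (q := (x, y, q.2.2)) hψ.1.continuous.measurable m n l
      (integrable_test_wt hψ (r := reVec (x, y, q.2.2)) hq z)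
  rw [hJ]
  have e1 : dz (convolution H G (ContinuousLinearMap.mul ℝ ℂ) volume) z
      = ∫ t, dz G t * gp q.2.2 l (t - z) := by
    rw [dz, hdir, hdir, ← integral_const_mul, ← integral_sub (hint _) ((hint _).const_mul _),
      ← integral_div]
    refine integral_congr_ae (Filter.Eventually.of_forall fun t => ?_)
    simp only [dz]; ring
  have e2 : dzbar (convolution H G (ContinuousLinearMap.mul ℝ ℂ) volume) z
      = ∫ t, dzbar G t * gp q.2.2 l (t - z) := by
    rw [dzbar, hdir, hdir, ← integral_const_mul, ← integral_add (hint _) ((hint _).const_mul _),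
      ← integral_div]
    refine integral_congr_ae (Filter.Eventually.of_forall fun t => ?_)
    simp only [dzbar]; ring
  convert hW using 1
  · rw [e1, J, J, J]
    refine (integral_lin_three (hi hχ.dz m n q.1 q.2.1) (hi hχ (m - 1) n (q.1 - 1 / 2) q.2.1)
      (hi hχ m (n - 1) q.1 (q.2.1 - 1 / 2)) _ _).trans (integral_congr_ae ?_)
    filter_upwards [ae_ne 0, ae_ne 1] with t h0 h1
    rw [(hGW t ⟨h0, h1⟩).dz_eq]
    ring
  · rw [e2, J, J, J]
    refine (integral_lin_three (hi hχ.dzbar m n q.1 q.2.1) (hi hχ (m + 1) n (q.1 - 1 / 2) q.2.1)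
      (hi hχ m (n + 1) q.1 (q.2.1 - 1 / 2)) _ _).trans (integral_congr_ae ?_)
    filter_upwards [ae_ne 0, ae_ne 1] with t h0 h1
    rw [(hGW t ⟨h0, h1⟩).dzbar_eq]
    ring

theorem nice_J_test {χ : ℂ → ℂ} (hχ : IsTestFunction χ) (m n l : ℤ) (k : ℕ) :
    Nice k (reVec ⁻¹' regInner) Set.univ (J χ m n l) := by
  induction k generalizing χ m n with
  | zero =>
    exact fun z _ => differentiableOn_J isOpen_regInner hχ.1.continuous.measurable m n l
      (fun r hr => integrable_test_wt hχ hr z)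
  | succ k ih =>
    have hd1 : DifferentiableOn ℂ (fun q : ℂ × ℂ × ℂ => (q.1 - 1 / 2, q.2.1, q.2.2))
      (reVec ⁻¹' regInner) := by fun_prop
    have hd2 : DifferentiableOn ℂ (fun q : ℂ × ℂ × ℂ => (q.1, q.2.1 - 1 / 2, q.2.2))
      (reVec ⁻¹' regInner) := by fun_prop
    have s1 : ∀ m n, Nice k (reVec ⁻¹' regInner) Set.univ
        (fun q : ℂ × ℂ × ℂ => J χ m n l (q.1 - 1 / 2, q.2.1, q.2.2)) := fun m n =>
      (ih hχ m n).comp_param hd1 fun q hq => hq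
    have s2 : ∀ m n, Nice k (reVec ⁻¹' regInner) Set.univ
        (fun q : ℂ × ℂ × ℂ => J χ m n l (q.1, q.2.1 - 1 / 2, q.2.2)) := fun m n =>
      (ih hχ m n).comp_param hd2 fun q hq => hq
    refine nice_succ_of_hasW isOpen_univ (fun z hz => (ih hχ m n).hol hz)
      (fun q hq z _ => hasW_J_test hχ m n l hq z) ?_ ?_
    · exact (ih hχ.dz m n).add isOpen_univ (((nice_param isOpen_univ (by fun_prop)).mul isOpen_univ
        (s1 _ _)).add isOpen_univ ((nice_param isOpen_univ (by fun_prop)).mul isOpen_univ (s2 _ _)))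
    · exact (ih hχ.dzbar m n).add isOpen_univ (((nice_param isOpen_univ (by fun_prop)).mul
        isOpen_univ (s1 _ _)).add isOpen_univ
        ((nice_param isOpen_univ (by fun_prop)).mul isOpen_univ (s2 _ _)))

/-! #### Weights that vanish near `z` -/

/-- The parameters for which the integral converges away from `z`. -/
def regOuter : Set (ℝ × ℝ × ℝ) := {r | -1 < r.1 ∧ -1 < r.2.1 ∧ r.1 + r.2.1 + r.2.2 < -1}

theorem isOpen_regOuter : IsOpen regOuter := by
  have c1 : Continuous fun r : ℝ × ℝ × ℝ => r.1 := by fun_prop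
  have c2 : Continuous fun r : ℝ × ℝ × ℝ => r.2.1 := by fun_prop
  have c3 : Continuous fun r : ℝ × ℝ × ℝ => r.1 + r.2.1 + r.2.2 := by fun_prop
  exact (isOpen_lt continuous_const c1).inter
    ((isOpen_lt continuous_const c2).inter (isOpen_lt c3 continuous_const))

theorem norm_sub_rpow_le {z₀ : ℂ} {δ : ℝ} (hδ : 0 < δ) (s : ℝ) :
    ∃ C : ℝ, 0 ≤ C ∧ ∀ z ∈ Metric.ball z₀ δ, ∀ t : ℂ, 2 * δ ≤ ‖t - z₀‖ →
      ‖t - z‖ ^ s ≤ C * (1 + ‖t‖) ^ s := by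
  set M : ℝ := 1 + ‖z₀‖ + δ
  have hM : 0 < M := by positivity
  -- The quotient |t − z| / (1 + |t|) lies between δ/(δ + M) and M; the sum of the two powers covers
  -- both signs of s.
  refine ⟨(δ / (δ + M)) ^ s + M ^ s, by positivity, fun z hz t ht => ?_⟩
  rw [Metric.mem_ball, dist_eq_norm] at hz
  have hX : 0 < 1 + ‖t‖ := by positivity
  have h1 : δ ≤ ‖t - z‖ := by
    have := norm_add_le (t - z) (z - z₀)
    rw [sub_add_sub_cancel] at this
    linarith
  have hz' : ‖z‖ ≤ ‖z₀‖ + δ := by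
    have := norm_sub_norm_le z z₀
    linarith
  have h2 : ‖t - z‖ ≤ M * (1 + ‖t‖) := by
    have := norm_sub_le t z
    have h3 : 0 ≤ (‖z₀‖ + δ) * ‖t‖ := by positivity
    simp only [M]
    nlinarith
  have h3 : δ / (δ + M) * (1 + ‖t‖) ≤ ‖t - z‖ := by
    rw [div_mul_eq_mul_div, div_le_iff₀ (by positivity)]
    have h4 := norm_sub_norm_le t z
    have h5 : 1 + ‖t‖ ≤ ‖t - z‖ + M := by simp only [M]; linarith
    nlinarith
  have hp : 0 < ‖t - z‖ / (1 + ‖t‖) := by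
    have : 0 < ‖t - z‖ := by linarith
    positivity
  have h6 : (‖t - z‖ / (1 + ‖t‖)) ^ s ≤ (δ / (δ + M)) ^ s + M ^ s := by
    have l1 : δ / (δ + M) ≤ ‖t - z‖ / (1 + ‖t‖) := (le_div_iff₀ hX).2 h3
    have l2 : ‖t - z‖ / (1 + ‖t‖) ≤ M := (div_le_iff₀ hX).2 h2
    have n1 : 0 ≤ (δ / (δ + M)) ^ s := by positivity
    have n2 : 0 ≤ M ^ s := by positivity
    rcases le_total 0 s with h | h
    · linarith [Real.rpow_le_rpow hp.le l2 h]
    · linarith [Real.rpow_le_rpow_of_nonpos (by positivity) l1 h]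
  rwa [Real.div_rpow (norm_nonneg _) hX.le, div_le_iff₀ (by positivity)] at h6

/-- `ρ` is a bounded measurable function that vanishes near `z₀`. -/
def IsOuter (ρ : ℂ → ℂ) (z₀ : ℂ) (δ : ℝ) : Prop :=
  0 < δ ∧ Measurable ρ ∧ (∀ t, ‖ρ t‖ ≤ 1) ∧ ∀ t, ‖t - z₀‖ < 2 * δ → ρ t = 0

theorem IsOuter.bound {ρ : ℂ → ℂ} {z₀ : ℂ} {δ : ℝ} (h : IsOuter ρ z₀ δ) {r : ℝ × ℝ × ℝ}
    (hr : r ∈ regOuter) : ∃ B : ℂ → ℝ, Integrable B ∧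
      ∀ z ∈ Metric.ball z₀ δ, ∀ t, ‖ρ t‖ * wt r z t ≤ B t := by
  obtain ⟨hδ, -, h1, h0⟩ := h
  obtain ⟨C, hC, hle⟩ := norm_sub_rpow_le (z₀ := z₀) hδ (2 * r.2.2)
  obtain ⟨r1, r2, r3⟩ := hr
  refine ⟨_, (integrable_two (α := 2 * r.1) (β := 2 * r.2.1) (γ := 2 * r.2.2) (by linarith)
    (by linarith) (by linarith)).const_mul C, fun z hz t => ?_⟩
  by_cases ht : ‖t - z₀‖ < 2 * δ
  · rw [h0 t ht, norm_zero, zero_mul]; positivity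
  · have := hle z hz t (not_lt.1 ht)
    calc ‖ρ t‖ * wt r z t ≤ 1 * wt r z t :=
          mul_le_mul_of_nonneg_right (h1 t) (wt_nonneg _ _ _)
      _ ≤ ‖t‖ ^ (2 * r.1) * ‖t - 1‖ ^ (2 * r.2.1) * (C * (1 + ‖t‖) ^ (2 * r.2.2)) := by
          rw [one_mul, wt]; gcongr
      _ = _ := by ring

theorem IsOuter.integrable {ρ : ℂ → ℂ} {z₀ : ℂ} {δ : ℝ} (h : IsOuter ρ z₀ δ) {r : ℝ × ℝ × ℝ}
    (hr : r ∈ regOuter) {z : ℂ} (hz : z ∈ Metric.ball z₀ δ) :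
    Integrable (fun t => ‖ρ t‖ * wt r z t) := by
  obtain ⟨B, hB, hle⟩ := h.bound hr
  refine hB.mono' (h.2.1.norm.mul (measurable_wt r z)).aestronglyMeasurable
    (Filter.Eventually.of_forall fun t => ?_)
  rw [Real.norm_of_nonneg (mul_nonneg (norm_nonneg _) (wt_nonneg _ _ _))]
  exact hle z hz t

theorem norm_wirt_le (p q : ℂ) : ‖wirt p q‖ ≤ ‖p‖ + ‖q‖ := by
  refine ContinuousLinearMap.opNorm_le_bound _ (by positivity) fun v => ?_
  rw [wirt_apply]
  refine (norm_add_le _ _).trans (le_of_eq ?_)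
  simp
  ring

theorem integral_wirt {p q : ℂ → ℂ} (hp : Integrable p) (hq : Integrable q) :
    ∫ t, wirt (p t) (q t) = wirt (∫ t, p t) (∫ t, q t) := by
  simp only [wirt]
  rw [integral_add (hp.smul_const _) (hq.smul_const _), integral_smul_const, integral_smul_const]

theorem hasW_integrand_sub {t z : ℂ} (h : t ≠ z) (x : ℂ) (l : ℤ) :
    HasW (fun z => gp x l (t - z)) (-((x + l / 2) * gp (x - 1 / 2) (l - 1) (t - z)))
      (-((x - l / 2) * gp (x - 1 / 2) (l + 1) (t - z))) z := by
  have := (hasW_gp (sub_ne_zero.2 h) x l).comp_hol (g := fun z => t - z)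
    ((hasDerivAt_id' z).const_sub t)
  simpa using this

/-- On the support of ρ the distance of t from z is bounded below, so differentiation under the
integral is legitimate. It lowers the exponent at z, which only improves the decay at infinity and
stays in `regOuter`. -/
theorem hasW_J_outer {ρ : ℂ → ℂ} {z₀ : ℂ} {δ : ℝ} (h : IsOuter ρ z₀ δ) (m n l : ℤ)
    {q : ℂ × ℂ × ℂ} (hq : reVec q ∈ regOuter) {z : ℂ} (hz : z ∈ Metric.ball z₀ δ) :
    HasW (J ρ m n l q)
      (-(q.2.2 + l / 2) * J ρ m n (l - 1) (q.1, q.2.1, q.2.2 - 1 / 2) z)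
      (-(q.2.2 - l / 2) * J ρ m n (l + 1) (q.1, q.2.1, q.2.2 - 1 / 2) z) z := by
  have hq' : reVec (q.1, q.2.1, q.2.2 - 1 / 2) ∈ regOuter := by
    obtain ⟨h1, h2, h3⟩ := hq
    refine ⟨h1, h2, ?_⟩
    simp only [reVec, Complex.sub_re] at h3 ⊢
    norm_num
    linarith
  obtain ⟨P, hP⟩ : ∃ P : ℤ → ℂ → ℂ → ℂ, ∀ l z t, P l z t = ρ t * (gp q.1 m t *
    gp q.2.1 n (t - 1) * gp (q.2.2 - 1 / 2) l (t - z)) := ⟨_, fun _ _ _ => rfl⟩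
  obtain ⟨B, hB, hle⟩ := h.bound hq'
  have hPi : ∀ l, Integrable (P l z) := fun l =>
    (integrable_integrand h.2.1 m n l (h.integrable hq' hz)).congr
      (Filter.Eventually.of_forall fun t => (hP l z t).symm)
  have hzero : ∀ w ∈ Metric.ball z₀ δ, ρ w = 0 := fun w hw => h.2.2.2 w (by
    rw [← dist_eq_norm]; linarith [Metric.mem_ball.1 hw, h.1])
  have hm : AEStronglyMeasurable (fun t => wirt (-(q.2.2 + l / 2) * P (l - 1) z t)
      (-(q.2.2 - l / 2) * P (l + 1) z t)) :=
    (((hPi (l - 1)).const_mul _).smul_const (ContinuousLinearMap.id ℝ ℂ)).aestronglyMeasurable.add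
      (((hPi (l + 1)).const_mul _).smul_const (Complex.conjCLE : ℂ →L[ℝ] ℂ)).aestronglyMeasurable
  have hbd : ∀ᵐ t, ∀ w ∈ Metric.ball z₀ δ, ‖wirt (-(q.2.2 + l / 2) * P (l - 1) w t)
      (-(q.2.2 - l / 2) * P (l + 1) w t)‖ ≤ ‖q.2.2 + l / 2‖ * B t + ‖q.2.2 - l / 2‖ * B t := by
    filter_upwards [ae_ne 0, ae_ne 1] with t h0 h1 w hw
    have hb : ∀ l', ‖P l' w t‖ ≤ B t := fun l' => by
      refine le_trans (le_of_eq ?_) (hle w hw t)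
      by_cases htw : t = w
      · rw [hP, htw, hzero w hw, zero_mul, norm_zero, zero_mul]
      · rw [hP, norm_mul, norm_integrand h0 h1 htw m n l' (q.1, q.2.1, q.2.2 - 1 / 2)]
    refine (norm_wirt_le _ _).trans ?_
    rw [norm_mul, norm_mul, norm_neg, norm_neg]
    gcongr <;> exact hb _
  have hder : ∀ᵐ t, ∀ w ∈ Metric.ball z₀ δ, HasFDerivAt
      (fun z => ρ t * (gp q.1 m t * gp q.2.1 n (t - 1) * gp q.2.2 l (t - z)))
      (wirt (-(q.2.2 + l / 2) * P (l - 1) w t) (-(q.2.2 - l / 2) * P (l + 1) w t)) w := by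
    filter_upwards with t w hw
    change HasW _ _ _ _
    by_cases htw : t = w
    · have := hzero w hw
      simp only [hP, htw, this, zero_mul, mul_zero]
      exact hasW_const 0 w
    · have := ((hasW_integrand_sub htw q.2.2 l).const_mul
        (gp q.1 m t * gp q.2.1 n (t - 1))).const_mul (ρ t)
      convert this using 1
      · rw [hP]; ring
      · rw [hP]; ring
  have key := hasFDerivAt_integral_of_dominated_of_fderiv_le (μ := volume) (𝕜 := ℝ)
    (Metric.isOpen_ball.mem_nhds hz)
    (Filter.Eventually.of_forall fun z =>
      (h.2.1.mul (measurable_integrand m n l q z)).aestronglyMeasurable)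
    (integrable_integrand h.2.1 m n l (h.integrable hq hz)) hm hbd
    ((hB.const_mul _).add (hB.const_mul _)) hder
  rw [integral_wirt ((hPi _).const_mul _) ((hPi _).const_mul _), integral_const_mul,
    integral_const_mul] at key
  simp only [hP] at key
  exact key

theorem nice_J_outer {ρ : ℂ → ℂ} {z₀ : ℂ} {δ : ℝ} (h : IsOuter ρ z₀ δ) (m n l : ℤ) (k : ℕ) :
    Nice k (reVec ⁻¹' regOuter) (Metric.ball z₀ δ) (J ρ m n l) := by
  induction k generalizing l with
  | zero =>
    exact fun z hz => differentiableOn_J isOpen_regOuter h.2.1 m n l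
      (fun r hr => h.integrable hr hz)
  | succ k ih =>
    have hd : DifferentiableOn ℂ (fun q : ℂ × ℂ × ℂ => (q.1, q.2.1, q.2.2 - 1 / 2))
      (reVec ⁻¹' regOuter) := by fun_prop
    have s : ∀ l, Nice k (reVec ⁻¹' regOuter) (Metric.ball z₀ δ)
        (fun q : ℂ × ℂ × ℂ => J ρ m n l (q.1, q.2.1, q.2.2 - 1 / 2)) := fun l =>
      (ih l).comp_param hd fun q hq => by
        obtain ⟨h1, h2, h3⟩ := hq
        refine ⟨h1, h2, ?_⟩
        simp only [reVec, Complex.sub_re] at h3 ⊢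
        norm_num
        linarith
    exact nice_succ_of_hasW Metric.isOpen_ball (fun z hz => (ih l).hol hz)
      (fun q hq z hz => hasW_J_outer h m n l hq hz)
      ((nice_param Metric.isOpen_ball (by fun_prop)).mul Metric.isOpen_ball (s _))
      ((nice_param Metric.isOpen_ball (by fun_prop)).mul Metric.isOpen_ball (s _))

/-! #### The full integral -/

/-- The parameters for which the integral converges. -/
def reg : Set (ℝ × ℝ × ℝ) := {r | -1 < r.1 ∧ -1 < r.2.1 ∧ -1 < r.2.2 ∧ r.1 + r.2.1 + r.2.2 < -1}

/-- The complex parameter vectors for which the integral converges. -/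
def regC : Set (ℂ × ℂ × ℂ) := reVec ⁻¹' reg

/-- The integrand of the Euler type integral. -/
def euler (m n l : ℤ) (q : ℂ × ℂ × ℂ) (z t : ℂ) : ℂ :=
  gp q.1 m t * gp q.2.1 n (t - 1) * gp q.2.2 l (t - z)

/-- The Euler type integral. -/
def K (m n l : ℤ) (q : ℂ × ℂ × ℂ) (z : ℂ) : ℂ := ∫ t, euler m n l q z t

theorem integrable_wt {r : ℝ × ℝ × ℝ} (hr : r ∈ reg) {z : ℂ} (hz : z ∈ puncturedPlane) :
    Integrable (wt r z) := by
  obtain ⟨h1, h2, h3, h4⟩ := hr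
  exact integrable_three (by linarith) (by linarith) (by linarith) (by linarith) hz

theorem integrable_euler (m n l : ℤ) {q : ℂ × ℂ × ℂ} (hq : q ∈ regC) {z : ℂ}
    (hz : z ∈ puncturedPlane) : Integrable (euler m n l q z) := by
  have := integrable_integrand (ρ := fun _ => 1) measurable_const m n l (q := q) (z := z)
    (by simpa using integrable_wt hq hz)
  simp only [one_mul] at this
  exact this

theorem exists_cutoff {z₀ : ℂ} (hz₀ : z₀ ∈ puncturedPlane) : ∃ (χ : ℂ → ℂ) (δ : ℝ),
    IsTestFunction χ ∧ IsOuter (fun t => 1 - χ t) z₀ δ ∧ Metric.ball z₀ δ ⊆ puncturedPlane := by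
  obtain ⟨e, he, hball⟩ := Metric.isOpen_iff.1 isOpen_puncturedPlane z₀ hz₀
  let f : ContDiffBump z₀ := ⟨e / 3, e / 2, by positivity, by linarith⟩
  have hf : ContDiff ℝ ∞ (fun t => ((f t : ℝ) : ℂ)) := Complex.ofRealCLM.contDiff.comp f.contDiff
  have hsupp : tsupport (fun t => ((f t : ℝ) : ℂ)) = tsupport f := by
    rw [tsupport, tsupport]
    congr 1
    ext t
    simp
  -- With δ = e/6 the bump equals 1 up to the radius e/3 = 2δ, as `IsOuter` requires, and its
  -- support, of radius e/2, stays in the punctured plane.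
  refine ⟨fun t => ((f t : ℝ) : ℂ), e / 6, ⟨hf, ?_, ?_⟩, ⟨by positivity, ?_, ?_, ?_⟩, ?_⟩
  · rw [HasCompactSupport, hsupp]; exact f.hasCompactSupport
  · rw [hsupp, f.tsupport_eq]
    exact (Metric.closedBall_subset_ball (by simp only [f]; linarith)).trans hball
  · exact measurable_const.sub hf.continuous.measurable
  · intro t
    simp only
    rw [← Complex.ofReal_one, ← Complex.ofReal_sub, Complex.norm_real, Real.norm_eq_abs, abs_le]
    have h1 := f.nonneg (x := t)
    have h2 := f.le_one (x := t)
    constructor <;> linarith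
  · intro t ht
    have : f t = 1 := f.one_of_mem_closedBall (by
      rw [Metric.mem_closedBall, dist_eq_norm]; simp only [f]; linarith)
    simp [this]
  · exact (Metric.ball_subset_ball (by linarith)).trans hball

theorem regC_inner {q : ℂ × ℂ × ℂ} (hq : q ∈ regC) : reVec q ∈ regInner := hq.2.2.1

theorem regC_outer {q : ℂ × ℂ × ℂ} (hq : q ∈ regC) : reVec q ∈ regOuter :=
  ⟨hq.1, hq.2.1, hq.2.2.2⟩

theorem K_eq_add {χ : ℂ → ℂ} {δ : ℝ} {z₀ : ℂ} (hχ : IsTestFunction χ)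
    (hρ : IsOuter (fun t => 1 - χ t) z₀ δ) (m n l : ℤ) {q : ℂ × ℂ × ℂ} (hq : q ∈ regC) {z : ℂ}
    (hz : z ∈ Metric.ball z₀ δ) : K m n l q z = J (fun t => 1 - χ t) m n l q z + J χ m n l q z := by
  rw [J, J, ← integral_add]
  · refine integral_congr_ae (Filter.Eventually.of_forall fun t => ?_)
    simp only [euler]; ring
  · exact integrable_integrand hρ.2.1 m n l (hρ.integrable (regC_outer hq) hz)
  · exact integrable_integrand hχ.1.continuous.measurable m n l
      (integrable_test_wt hχ (r := reVec q) hq.2.2.1 z)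

/-- The cutoff depends on the point z₀, which is harmless because the property is local in z; near
z₀ the integral is the sum of an outer and an inner part. -/
theorem nice_K (m n l : ℤ) (k : ℕ) : Nice k regC puncturedPlane (K m n l) := by
  refine nice_of_locally fun z₀ hz₀ => ?_
  obtain ⟨χ, δ, hχ, hρ, -⟩ := exists_cutoff hz₀
  refine ⟨Metric.ball z₀ δ, Metric.mem_ball_self hρ.1, ?_⟩
  refine Nice.congr Metric.isOpen_ball
    (((nice_J_outer hρ m n l k).mono (fun q hq => regC_outer hq) subset_rfl).add Metric.isOpen_ball
      ((nice_J_test hχ m n l k).mono (fun q hq => regC_inner hq) (Set.subset_univ _)))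
    fun q hq z hz => K_eq_add hχ hρ m n l hq hz

/-! ### Relations between the Euler type integrals -/

theorem half_re : ((1 / 2 : ℂ)).re = 1 / 2 := by norm_num

/-- A convex set of parameter vectors. -/
def box (a b c d : ℝ) : Set (ℂ × ℂ × ℂ) :=
  {q | a < q.1.re ∧ b < q.2.1.re ∧ c < q.2.2.re ∧ q.1.re + q.2.1.re + q.2.2.re < d}

theorem regC_eq_box : regC = box (-1) (-1) (-1) (-1) := rfl

theorem isOpen_box (a b c d : ℝ) : IsOpen (box a b c d) := by
  have c1 : Continuous fun r : ℂ × ℂ × ℂ => r.1.re := by fun_prop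
  have c2 : Continuous fun r : ℂ × ℂ × ℂ => r.2.1.re := by fun_prop
  have c3 : Continuous fun r : ℂ × ℂ × ℂ => r.2.2.re := by fun_prop
  have c4 : Continuous fun r : ℂ × ℂ × ℂ => r.1.re + r.2.1.re + r.2.2.re := by fun_prop
  exact (isOpen_lt continuous_const c1).inter ((isOpen_lt continuous_const c2).inter
    ((isOpen_lt continuous_const c3).inter (isOpen_lt c4 continuous_const)))

theorem convex_box (a b c d : ℝ) : Convex ℝ (box a b c d) := by
  have h1 : Convex ℝ {q : ℂ × ℂ × ℂ | a < q.1.re} :=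
    convex_halfSpace_gt (by constructor <;> intros <;> simp) a
  have h2 : Convex ℝ {q : ℂ × ℂ × ℂ | b < q.2.1.re} :=
    convex_halfSpace_gt (by constructor <;> intros <;> simp) b
  have h3 : Convex ℝ {q : ℂ × ℂ × ℂ | c < q.2.2.re} :=
    convex_halfSpace_gt (by constructor <;> intros <;> simp) c
  have h4 : Convex ℝ {q : ℂ × ℂ × ℂ | q.1.re + q.2.1.re + q.2.2.re < d} :=
    convex_halfSpace_lt (by constructor <;> intros <;> simp <;> ring) d
  exact h1.inter (h2.inter (h3.inter h4))

theorem box_nonempty {a b c d : ℝ} (h : a + b + c < d) : (box a b c d).Nonempty := by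
  set e := (d - (a + b + c)) / 4
  have he : 0 < e := by simp only [e]; linarith
  refine ⟨((a + e : ℝ), (b + e : ℝ), (c + e : ℝ)), ?_⟩
  simp only [box, Set.mem_ofPred_eq, Complex.ofReal_re]
  refine ⟨by linarith, by linarith, by linarith, ?_⟩
  simp only [e]
  linarith

theorem box_mono {a b c d a' b' c' d' : ℝ} (ha : a ≤ a') (hb : b ≤ b') (hc : c ≤ c')
    (hd : d' ≤ d) : box a' b' c' d' ⊆ box a b c d := fun _ ⟨h1, h2, h3, h4⟩ =>
  ⟨ha.trans_lt h1, hb.trans_lt h2, hc.trans_lt h3, h4.trans_le hd⟩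

/-- The form in which the identity theorem is used: a relation is proved on a small box, where every
integral in its derivation converges, and passes to the box where its two sides are holomorphic. The
inequality on the primed bounds says that the small box is not empty. -/
theorem eqOn_zero_box {a b c d a' b' c' d' : ℝ} (ha : a ≤ a') (hb : b ≤ b') (hc : c ≤ c')
    (hd : d' ≤ d) (hne : a' + b' + c' < d') {f : ℂ × ℂ × ℂ → ℂ}
    (hf : DifferentiableOn ℂ f (box a b c d)) (h0 : ∀ q ∈ box a' b' c' d', f q = 0) :
    ∀ q ∈ box a b c d, f q = 0 :=
  eqOn_zero_of_convex (isOpen_box _ _ _ _) (convex_box _ _ _ _) (isOpen_box _ _ _ _)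
    (box_nonempty hne) (box_mono ha hb hc hd) hf h0

theorem mem_regC {x y c : ℂ} : (x, y, c) ∈ regC ↔
    -1 < x.re ∧ -1 < y.re ∧ -1 < c.re ∧ x.re + y.re + c.re < -1 := Iff.rfl

theorem euler_up_one {t : ℂ} (ht : t ≠ 0) (m n l : ℤ) (x y c z : ℂ) :
    euler (m + 1) n l (x + 1 / 2, y, c) z t = t * euler m n l (x, y, c) z t := by
  simp only [euler, gp_up ht]; ring

theorem euler_up_two {t : ℂ} (ht : t ≠ 1) (m n l : ℤ) (x y c z : ℂ) :
    euler m (n + 1) l (x, y + 1 / 2, c) z t = (t - 1) * euler m n l (x, y, c) z t := by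
  simp only [euler, gp_up (sub_ne_zero.2 ht)]; ring

theorem euler_up_three {t z : ℂ} (ht : t ≠ z) (m n l : ℤ) (x y c : ℂ) :
    euler m n (l + 1) (x, y, c + 1 / 2) z t = (t - z) * euler m n l (x, y, c) z t := by
  simp only [euler, gp_up (sub_ne_zero.2 ht)]; ring

theorem hasW_euler {t z : ℂ} (h0 : t ≠ 0) (h1 : t ≠ 1) (hz : t ≠ z) (m n l : ℤ) (x y c : ℂ) :
    HasW (euler m n l (x, y, c) z)
      ((x + m / 2) * euler (m - 1) n l (x - 1 / 2, y, c) z t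
        + ((y + n / 2) * euler m (n - 1) l (x, y - 1 / 2, c) z t
        + (c + l / 2) * euler m n (l - 1) (x, y, c - 1 / 2) z t))
      ((x - m / 2) * euler (m + 1) n l (x - 1 / 2, y, c) z t
        + ((y - n / 2) * euler m (n + 1) l (x, y - 1 / 2, c) z t
        + (c - l / 2) * euler m n (l + 1) (x, y, c - 1 / 2) z t)) t := by
  have h2 := (hasW_gp (sub_ne_zero.2 h1) y n).comp_hol (g := fun t => t - 1)
    ((hasDerivAt_id' t).sub_const 1)
  have h3 := (hasW_gp (sub_ne_zero.2 hz) c l).comp_hol (g := fun t => t - z)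
    ((hasDerivAt_id' t).sub_const z)
  have := ((hasW_gp h0 x m).mul h2).mul h3
  convert this using 1
  · rfl
  · simp only [euler]; ring
  · simp only [euler, map_one]; ring

theorem integral_eq_zero_of_hasW {S : Set ℂ} (hS : S.Countable) {f p q : ℂ → ℂ}
    (h : ∀ t ∉ S, HasW f (p t) (q t) t) (hf : Integrable f) (hp : Integrable p)
    (hq : Integrable q) : ∫ t, p t = 0 := by
  have hae := hS.ae_notMem volume
  have e1 : p =ᵐ[volume] dz f := by filter_upwards [hae] with t ht using (h t ht).dz_eq.symm
  have e2 : q =ᵐ[volume] dzbar f := by filter_upwards [hae] with t ht using (h t ht).dzbar_eq.symm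
  rw [integral_congr_ae e1]
  exact integral_dz_eq_zero hS (fun t ht => (h t ht).differentiableAt) hf (hp.congr e1)
    (hq.congr e2)

/-- The integral of a total derivative vanishes. The four hypotheses make the integrand and the
three terms of its derivative integrable. They cover the antiholomorphic derivative as well, since
convergence only depends on the real parts of x, y, c. -/
theorem K_parts {z : ℂ} (hz : z ∈ puncturedPlane) (m n l : ℤ) {x y c : ℂ}
    (h0 : (x, y, c) ∈ regC) (h1 : (x - 1 / 2, y, c) ∈ regC) (h2 : (x, y - 1 / 2, c) ∈ regC)
    (h3 : (x, y, c - 1 / 2) ∈ regC) :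
    (x + m / 2) * K (m - 1) n l (x - 1 / 2, y, c) z
        + ((y + n / 2) * K m (n - 1) l (x, y - 1 / 2, c) z
        + (c + l / 2) * K m n (l - 1) (x, y, c - 1 / 2) z) = 0 := by
  have i1 := fun m => integrable_euler m n l h1 hz
  have i2 := fun n => integrable_euler m n l h2 hz
  have i3 := fun l => integrable_euler m n l h3 hz
  have := integral_eq_zero_of_hasW (S := {0, 1, z}) (Set.toFinite _).countable
    (fun t ht => by
      simp only [Set.mem_insert_iff, Set.mem_singleton_iff, not_or] at ht
      exact hasW_euler ht.1 ht.2.1 ht.2.2 m n l x y c)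
    (integrable_euler m n l h0 hz)
    (((i1 _).const_mul _).add (((i2 _).const_mul _).add ((i3 _).const_mul _)))
    (((i1 _).const_mul _).add (((i2 _).const_mul _).add ((i3 _).const_mul _)))
  rw [← this, K, ← integral_const_mul]
  exact integral_lin_three ((i1 (m - 1)).const_mul _) (i2 (n - 1)) (i3 (l - 1)) _ _

theorem J_parts {χ : ℂ → ℂ} (hχ : IsTestFunction χ) (z : ℂ) (m n l : ℤ) {x y c : ℂ}
    (hc : -1 < (c - 1 / 2).re) :
    J (dz χ) m n l (x, y, c) z + ((x + m / 2) * J χ (m - 1) n l (x - 1 / 2, y, c) z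
        + (y + n / 2) * J χ m (n - 1) l (x, y - 1 / 2, c) z)
      = - ((c + l / 2) * J χ m n (l - 1) (x, y, c - 1 / 2) z) := by
  have hc' : -1 < c.re := by rw [Complex.sub_re, half_re] at hc; linarith
  have hi : ∀ {ψ : ℂ → ℂ}, IsTestFunction ψ → ∀ (m n l : ℤ) (x y : ℂ) {c : ℂ}, -1 < c.re →
      Integrable (fun t => ψ t * euler m n l (x, y, c) z t) := by
    intro ψ hψ m n l x y c hc
    exact integrable_integrand (q := (x, y, c)) hψ.1.continuous.measurable m n l
      (integrable_test_wt hψ (r := reVec (x, y, c)) hc z)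
  have := integral_eq_zero_of_hasW (S := {0, 1, z}) (Set.toFinite _).countable
    (f := fun t => χ t * euler m n l (x, y, c) z t)
    (p := fun t => (dz χ t * euler m n l (x, y, c) z t
      + ((x + m / 2) * (χ t * euler (m - 1) n l (x - 1 / 2, y, c) z t)
        + (y + n / 2) * (χ t * euler m (n - 1) l (x, y - 1 / 2, c) z t)))
        + (c + l / 2) * (χ t * euler m n (l - 1) (x, y, c - 1 / 2) z t))
    (q := fun t => (dzbar χ t * euler m n l (x, y, c) z t
      + ((x - m / 2) * (χ t * euler (m + 1) n l (x - 1 / 2, y, c) z t)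
        + (y - n / 2) * (χ t * euler m (n + 1) l (x, y - 1 / 2, c) z t)))
        + (c - l / 2) * (χ t * euler m n (l + 1) (x, y, c - 1 / 2) z t))
    (fun t ht => by
      simp only [Set.mem_insert_iff, Set.mem_singleton_iff, not_or] at ht
      have := (hχ.hasW t).mul (hasW_euler ht.1 ht.2.1 ht.2.2 m n l x y c)
      convert this using 1 <;> ring)
    (hi hχ m n l x y hc')
    (((hi hχ.dz _ _ _ _ _ hc').add (((hi hχ _ _ _ _ _ hc').const_mul _).add
      ((hi hχ _ _ _ _ _ hc').const_mul _))).add ((hi hχ _ _ _ _ _ hc).const_mul _))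
    (((hi hχ.dzbar _ _ _ _ _ hc').add (((hi hχ _ _ _ _ _ hc').const_mul _).add
      ((hi hχ _ _ _ _ _ hc').const_mul _))).add ((hi hχ _ _ _ _ _ hc).const_mul _))
  have h2 := integral_add ((hi hχ.dz m n l x y hc').add
    (((hi hχ (m - 1) n l (x - 1 / 2) y hc').const_mul (x + m / 2)).add
      ((hi hχ m (n - 1) l x (y - 1 / 2) hc').const_mul (y + n / 2))))
    ((hi hχ m n (l - 1) x y hc).const_mul (c + l / 2))
  simp only [Pi.add_apply] at h2
  rw [h2, integral_const_mul] at this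
  rw [← eq_neg_iff_add_eq_zero] at this
  rw [J, J, J, J]
  exact (integral_lin_three (hi hχ.dz m n l x y hc') (hi hχ (m - 1) n l (x - 1 / 2) y hc')
    (hi hχ m (n - 1) l x (y - 1 / 2) hc') _ _).trans this

/-- In the inner part the derivative sits on the cutoff and on the powers of t and t − 1. Since the
lowered exponent at z is still admissible, `J_parts` transfers it to the power of t − z, and the
inner and outer parts recombine. -/
theorem dz_K {z : ℂ} (hz : z ∈ puncturedPlane) (m n l : ℤ) {x y c : ℂ}
    (h0 : (x, y, c) ∈ regC) (h3 : (x, y, c - 1 / 2) ∈ regC) :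
    dz (K m n l (x, y, c)) z = -(c + l / 2) * K m n (l - 1) (x, y, c - 1 / 2) z := by
  obtain ⟨χ, δ, hχ, hρ, hsub⟩ := exists_cutoff hz
  have hzb : z ∈ Metric.ball z δ := Metric.mem_ball_self hρ.1
  have hev : K m n l (x, y, c) =ᶠ[nhds z]
      fun w => J (fun t => 1 - χ t) m n l (x, y, c) w + J χ m n l (x, y, c) w := by
    filter_upwards [Metric.isOpen_ball.mem_nhds hzb] with w hw
    exact K_eq_add hχ hρ m n l h0 hw
  have h := (hasW_J_outer hρ m n l (regC_outer h0) hzb).add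
    (hasW_J_test hχ m n l (regC_inner h0) z)
  rw [(h.congr hev).dz_eq, K_eq_add hχ hρ m n (l - 1) h3 hzb]
  have := J_parts hχ z m n l (x := x) (y := y) (c := c) h3.2.2.1
  simp only at this ⊢
  rw [this]
  ring

/-- This is t = (t − z) + z under the integral; `K_up_two` is t − 1 = (t − z) + (z − 1). -/
theorem K_up_one {z : ℂ} (hz : z ∈ puncturedPlane) (m n l : ℤ) {x y c : ℂ}
    (h0 : (x, y, c) ∈ regC) (h3 : (x, y, c + 1 / 2) ∈ regC) :
    K (m + 1) n l (x + 1 / 2, y, c) z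
      = K m n (l + 1) (x, y, c + 1 / 2) z + z * K m n l (x, y, c) z := by
  rw [K, K, K, ← integral_const_mul, ← integral_add (integrable_euler _ _ _ h3 hz)
    ((integrable_euler _ _ _ h0 hz).const_mul z)]
  refine integral_congr_ae ?_
  filter_upwards [ae_ne 0, ae_ne z] with t t0 tz
  rw [euler_up_one t0, euler_up_three tz]
  ring

theorem K_up_two {z : ℂ} (hz : z ∈ puncturedPlane) (m n l : ℤ) {x y c : ℂ}
    (h0 : (x, y, c) ∈ regC) (h3 : (x, y, c + 1 / 2) ∈ regC) :
    K m (n + 1) l (x, y + 1 / 2, c) z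
      = K m n (l + 1) (x, y, c + 1 / 2) z + (z - 1) * K m n l (x, y, c) z := by
  rw [K, K, K, ← integral_const_mul, ← integral_add (integrable_euler _ _ _ h3 hz)
    ((integrable_euler _ _ _ h0 hz).const_mul (z - 1))]
  refine integral_congr_ae ?_
  filter_upwards [ae_ne 1, ae_ne z] with t t0 tz
  rw [euler_up_two t0, euler_up_three tz]
  ring

/-- The first order operator that raises the exponent at infinity. -/
def raise0 (m n l : ℤ) (q : ℂ × ℂ × ℂ) (z : ℂ) : ℂ :=
  z * (1 - z) * dz (K m n (l - 1) (q.1, q.2.1, q.2.2 - 1 / 2)) z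
    + (((q.1 + m / 2) + (q.2.1 + n / 2) + 2 * (q.2.2 + l / 2)) * z
      - ((q.1 + m / 2) + (q.2.2 + l / 2))) * K m n (l - 1) (q.1, q.2.1, q.2.2 - 1 / 2) z

/-- The first order operator that raises the exponent at `1`. -/
def raise1 (m n l : ℤ) (q : ℂ × ℂ × ℂ) (z : ℂ) : ℂ :=
  z * dz (K (m - 1) (n + 1) l (q.1 - 1 / 2, q.2.1 + 1 / 2, q.2.2)) z
    - ((q.1 + m / 2) + (q.2.2 + l / 2)) *
      K (m - 1) (n + 1) l (q.1 - 1 / 2, q.2.1 + 1 / 2, q.2.2) z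

/-- The first order operator that raises the exponent at `z`. -/
def raise2 (m n l : ℤ) (q : ℂ × ℂ × ℂ) (z : ℂ) : ℂ :=
  dz (K m n (l + 1) (q.1, q.2.1, q.2.2 + 1 / 2)) z

/-- The first order operator that raises the exponent at `0`. -/
def raise3 (m n l : ℤ) (q : ℂ × ℂ × ℂ) (z : ℂ) : ℂ :=
  (z - 1) * dz (K (m + 1) (n - 1) l (q.1 + 1 / 2, q.2.1 - 1 / 2, q.2.2)) z
    - ((q.2.1 + n / 2) + (q.2.2 + l / 2)) *
      K (m + 1) (n - 1) l (q.1 + 1 / 2, q.2.1 - 1 / 2, q.2.2) z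

/-- The box is `regC` translated by the shift of exponents inside the operator. It exceeds `regC` by
one half in one direction (here the bound on the sum, that is, the point at infinity), and this
surplus provides the continuation. The other three operators do the same at 1, z and 0. -/
theorem nice_raise0 (m n l : ℤ) (k : ℕ) :
    Nice k (box (-1) (-1) (-1 / 2) (-1 / 2)) puncturedPlane (raise0 m n l) := by
  have h : Nice (k + 1) (box (-1) (-1) (-1 / 2) (-1 / 2)) puncturedPlane
      (fun q => K m n (l - 1) (q.1, q.2.1, q.2.2 - 1 / 2)) :=
    (nice_K m n (l - 1) (k + 1)).comp_param (by fun_prop) fun q ⟨h1, h2, h3, h4⟩ => by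
      simp only [mem_regC, Complex.sub_re, half_re]
      exact ⟨h1, h2, by linarith, by linarith⟩
  have o := isOpen_puncturedPlane
  have hz : ∀ k, Nice k (box (-1) (-1) (-1 / 2) (-1 / 2)) puncturedPlane (fun _ z => z) :=
    fun k => nice_id o
  have c1 : Nice k (box (-1) (-1) (-1 / 2) (-1 / 2)) puncturedPlane (fun _ z => z * (1 - z)) :=
    ((hz k).mul o ((nice_param o (differentiableOn_const 1)).add o
      ((nice_param o (differentiableOn_const (-1))).mul o (hz k)))).congr o fun _ _ _ _ => by ring
  have c2 : Nice k (box (-1) (-1) (-1 / 2) (-1 / 2)) puncturedPlane (fun q z =>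
      ((q.1 + m / 2) + (q.2.1 + n / 2) + 2 * (q.2.2 + l / 2)) * z
      - ((q.1 + m / 2) + (q.2.2 + l / 2))) :=
    (((nice_param o (g := fun q : ℂ × ℂ × ℂ =>
      (q.1 + m / 2) + (q.2.1 + n / 2) + 2 * (q.2.2 + l / 2)) (by fun_prop)).mul o (hz k)).add o
      (nice_param o (g := fun q : ℂ × ℂ × ℂ => -((q.1 + m / 2) + (q.2.2 + l / 2)))
        (by fun_prop))).congr o fun _ _ _ _ => by ring
  exact (c1.mul o h.2.2.1).add o (c2.mul o h.pred)

theorem nice_raise1 (m n l : ℤ) (k : ℕ) :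
    Nice k (box (-1 / 2) (-3 / 2) (-1) (-1)) puncturedPlane (raise1 m n l) := by
  have h : Nice (k + 1) (box (-1 / 2) (-3 / 2) (-1) (-1)) puncturedPlane
      (fun q => K (m - 1) (n + 1) l (q.1 - 1 / 2, q.2.1 + 1 / 2, q.2.2)) :=
    (nice_K (m - 1) (n + 1) l (k + 1)).comp_param (by fun_prop) fun q ⟨h1, h2, h3, h4⟩ => by
      simp only [mem_regC, Complex.sub_re, Complex.add_re, half_re]
      exact ⟨by linarith, by linarith, h3, by linarith⟩
  have o := isOpen_puncturedPlane
  have hz : Nice k (box (-1 / 2) (-3 / 2) (-1) (-1)) puncturedPlane (fun _ z => z) := nice_id o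
  exact ((hz.mul o h.2.2.1).add o ((nice_param o (g := fun q : ℂ × ℂ × ℂ =>
    -((q.1 + m / 2) + (q.2.2 + l / 2))) (by fun_prop)).mul o h.pred)).congr o
    fun q _ z _ => by rw [raise1]; ring

theorem nice_raise2 (m n l : ℤ) (k : ℕ) :
    Nice k (box (-1) (-1) (-3 / 2) (-3 / 2)) puncturedPlane (raise2 m n l) := by
  have h : Nice (k + 1) (box (-1) (-1) (-3 / 2) (-3 / 2)) puncturedPlane
      (fun q => K m n (l + 1) (q.1, q.2.1, q.2.2 + 1 / 2)) :=
    (nice_K m n (l + 1) (k + 1)).comp_param (by fun_prop) fun q ⟨h1, h2, h3, h4⟩ => by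
      simp only [mem_regC, Complex.add_re, half_re]
      exact ⟨h1, h2, by linarith, by linarith⟩
  exact h.2.2.1

theorem nice_raise3 (m n l : ℤ) (k : ℕ) :
    Nice k (box (-3 / 2) (-1 / 2) (-1) (-1)) puncturedPlane (raise3 m n l) := by
  have h : Nice (k + 1) (box (-3 / 2) (-1 / 2) (-1) (-1)) puncturedPlane
      (fun q => K (m + 1) (n - 1) l (q.1 + 1 / 2, q.2.1 - 1 / 2, q.2.2)) :=
    (nice_K (m + 1) (n - 1) l (k + 1)).comp_param (by fun_prop) fun q ⟨h1, h2, h3, h4⟩ => by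
      simp only [mem_regC, Complex.sub_re, Complex.add_re, half_re]
      exact ⟨by linarith, by linarith, h3, by linarith⟩
  have o := isOpen_puncturedPlane
  have hz : Nice k (box (-3 / 2) (-1 / 2) (-1) (-1)) puncturedPlane (fun _ z => z) := nice_id o
  exact (((hz.add o (nice_param o (differentiableOn_const (-1)))).mul o h.2.2.1).add o
    ((nice_param o (g := fun q : ℂ × ℂ × ℂ =>
    -((q.2.1 + n / 2) + (q.2.2 + l / 2))) (by fun_prop)).mul o h.pred)).congr o
    fun q _ z _ => by rw [raise3]; ring

/-- Integrate the derivative of t(t−1)/(t−z) times the integrand, and expand t and t − 1 in powers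
of t − z. -/
theorem raise0_eq {z : ℂ} (hz : z ∈ puncturedPlane) (m n l : ℤ) :
    ∀ q ∈ box (-1) (-1) (-1 / 2) (-1), raise0 m n l q z
      = -((q.1 + m / 2) + (q.2.1 + n / 2) + (q.2.2 + l / 2) + 1) * K m n l q z := by
  have hd : DifferentiableOn ℂ (fun q => raise0 m n l q z
      - -((q.1 + m / 2) + (q.2.1 + n / 2) + (q.2.2 + l / 2) + 1) * K m n l q z)
      (box (-1) (-1) (-1 / 2) (-1)) := by
    have h1 := ((nice_raise0 m n l 0).hol hz).mono
      (box_mono (le_refl (-1 : ℝ)) (le_refl (-1 : ℝ)) (le_refl (-1 / 2 : ℝ))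
        (by norm_num : (-1 : ℝ) ≤ -1 / 2))
    have h2 := ((nice_K m n l 0).hol hz).mono
      (box_mono (le_refl (-1 : ℝ)) (le_refl (-1 : ℝ)) (by norm_num : (-1 : ℝ) ≤ -1 / 2)
        (le_refl (-1 : ℝ)))
    refine h1.sub (DifferentiableOn.mul (by fun_prop) h2)
  -- The bound 0 permits lowering the exponent at z twice by one half; −3/2 pays for the factor
  -- t(t−1)/(t−z), which grows like t.
  refine fun q hq => sub_eq_zero.1 (eqOn_zero_box (a' := -1) (b' := -1) (c' := 0) (d' := -3 / 2)
    le_rfl le_rfl (by norm_num) (by norm_num) (by norm_num) hd ?_ q hq)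
  rintro ⟨x, y, c⟩ ⟨h1, h2, h3, h4⟩
  simp only at h1 h2 h3 h4
  have r0 : (x, y, c) ∈ regC := mem_regC.2 ⟨h1, h2, by linarith, by linarith⟩
  have r1 : (x, y, c - 1 / 2) ∈ regC := by
    simp only [mem_regC, Complex.sub_re, half_re]
    exact ⟨h1, h2, by linarith, by linarith⟩
  have r2 : (x, y, c - 1 / 2 - 1 / 2) ∈ regC := by
    simp only [mem_regC, Complex.sub_re, half_re]
    exact ⟨h1, h2, by linarith, by linarith⟩
  have r3 : (x + 1 / 2, y + 1 / 2, c - 1 / 2) ∈ regC := by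
    simp only [mem_regC, Complex.sub_re, Complex.add_re, half_re]
    exact ⟨by linarith, by linarith, by linarith, by linarith⟩
  have r4 : (x, y + 1 / 2, c - 1 / 2) ∈ regC := by
    simp only [mem_regC, Complex.sub_re, Complex.add_re, half_re]
    exact ⟨by linarith, by linarith, by linarith, by linarith⟩
  have r5 : (x + 1 / 2, y, c - 1 / 2) ∈ regC := by
    simp only [mem_regC, Complex.sub_re, Complex.add_re, half_re]
    exact ⟨by linarith, by linarith, by linarith, by linarith⟩
  have r6 : (x + 1 / 2, y + 1 / 2, c - 1 / 2 - 1 / 2) ∈ regC := by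
    simp only [mem_regC, Complex.sub_re, Complex.add_re, half_re]
    exact ⟨by linarith, by linarith, by linarith, by linarith⟩
  have r7 : (x + 1 / 2, y, c - 1 / 2 - 1 / 2) ∈ regC := by
    simp only [mem_regC, Complex.sub_re, Complex.add_re, half_re]
    exact ⟨by linarith, by linarith, by linarith, by linarith⟩
  have e0 := dz_K hz m n (l - 1) r1 r2
  have e1 := K_parts hz (m + 1) (n + 1) (l - 1) r3 (by simpa only [add_sub_cancel_right] using r4)
    (by simpa only [add_sub_cancel_right] using r5) r6
  simp only [add_sub_cancel_right] at e1
  have e2 := K_up_one hz m n (l - 1) r1 (by simpa only [sub_add_cancel] using r0)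
  have e3 := K_up_two hz m n (l - 1) r1 (by simpa only [sub_add_cancel] using r0)
  have e4 := K_up_two hz (m + 1) n (l - 1 - 1) r7 (by simpa only [sub_add_cancel] using r5)
  have e5 := K_up_one hz m n (l - 1 - 1) r2 (by simpa only [sub_add_cancel] using r1)
  simp only [sub_add_cancel] at e2 e3 e4 e5
  rw [raise0]
  simp only
  push_cast at e0 e1
  rw [e0]
  rw [e4, e5, e2, e3] at e1
  linear_combination e1

/-- Integrate the derivative of (t − 1) times the integrand. -/
theorem raise1_eq {z : ℂ} (hz : z ∈ puncturedPlane) (m n l : ℤ) :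
    ∀ q ∈ box (-1 / 2) (-1) (-1) (-1), raise1 m n l q z
      = ((q.2.1 + n / 2) + 1) * K m n l q z := by
  have hd : DifferentiableOn ℂ (fun q => raise1 m n l q z
      - ((q.2.1 + n / 2) + 1) * K m n l q z) (box (-1 / 2) (-1) (-1) (-1)) := by
    have h1 := ((nice_raise1 m n l 0).hol hz).mono
      (box_mono (le_refl (-1 / 2 : ℝ)) (by norm_num : (-3 / 2 : ℝ) ≤ -1) (le_refl (-1 : ℝ))
        (le_refl (-1 : ℝ)))
    have h2 := ((nice_K m n l 0).hol hz).mono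
      (box_mono (by norm_num : (-1 : ℝ) ≤ -1 / 2) (le_refl (-1 : ℝ)) (le_refl (-1 : ℝ))
        (le_refl (-1 : ℝ)))
    refine h1.sub (DifferentiableOn.mul (by fun_prop) h2)
  refine fun q hq => sub_eq_zero.1 (eqOn_zero_box (a' := -1 / 2) (b' := -1) (c' := -1 / 2)
    (d' := -3 / 2) le_rfl le_rfl (by norm_num) (by norm_num) (by norm_num) hd ?_ q hq)
  rintro ⟨x, y, c⟩ ⟨h1, h2, h3, h4⟩
  simp only at h1 h2 h3 h4
  have r0 : (x, y, c) ∈ regC := mem_regC.2 ⟨by linarith, h2, by linarith, by linarith⟩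
  have r1 : (x - 1 / 2, y + 1 / 2, c) ∈ regC := by
    simp only [mem_regC, Complex.sub_re, Complex.add_re, half_re]
    exact ⟨by linarith, by linarith, by linarith, by linarith⟩
  have r2 : (x - 1 / 2, y + 1 / 2, c - 1 / 2) ∈ regC := by
    simp only [mem_regC, Complex.sub_re, Complex.add_re, half_re]
    exact ⟨by linarith, by linarith, by linarith, by linarith⟩
  have r3 : (x, y + 1 / 2, c - 1 / 2) ∈ regC := by
    simp only [mem_regC, Complex.sub_re, Complex.add_re, half_re]
    exact ⟨by linarith, by linarith, by linarith, by linarith⟩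
  have r4 : (x, y + 1 / 2, c) ∈ regC := by
    simp only [mem_regC, Complex.add_re, half_re]
    exact ⟨by linarith, by linarith, by linarith, by linarith⟩
  have e0 := dz_K hz (m - 1) (n + 1) l r1 r2
  have e1 := K_parts hz m (n + 1) l r4 r1 (by simpa only [add_sub_cancel_right] using r0) r3
  have e2 := K_up_one hz (m - 1) (n + 1) (l - 1) r2 (by simpa only [sub_add_cancel] using r1)
  simp only [sub_add_cancel, add_sub_cancel_right] at e1 e2
  rw [raise1]
  simp only
  push_cast at e1
  rw [e0]
  rw [e2] at e1
  linear_combination -e1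

/-- This is `dz_K` at the raised exponent, so no identity theorem is needed. -/
theorem raise2_eq {z : ℂ} (hz : z ∈ puncturedPlane) (m n l : ℤ) :
    ∀ q ∈ box (-1) (-1) (-1) (-3 / 2), raise2 m n l q z
      = -((q.2.2 + l / 2) + 1) * K m n l q z := by
  rintro ⟨x, y, c⟩ ⟨h1, h2, h3, h4⟩
  simp only at h1 h2 h3 h4
  have r0 : (x, y, c) ∈ regC := mem_regC.2 ⟨h1, h2, by linarith, by linarith⟩
  have r1 : (x, y, c + 1 / 2) ∈ regC := by
    simp only [mem_regC, Complex.add_re, half_re]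
    exact ⟨h1, h2, by linarith, by linarith⟩
  have := dz_K hz m n (l + 1) r1 (by simpa only [add_sub_cancel_right] using r0)
  simp only [add_sub_cancel_right] at this
  rw [raise2]
  simp only
  rw [this]
  push_cast
  ring

/-- Integrate the derivative of t times the integrand. -/
theorem raise3_eq {z : ℂ} (hz : z ∈ puncturedPlane) (m n l : ℤ) :
    ∀ q ∈ box (-1) (-1 / 2) (-1) (-1), raise3 m n l q z
      = ((q.1 + m / 2) + 1) * K m n l q z := by
  have hd : DifferentiableOn ℂ (fun q => raise3 m n l q z
      - ((q.1 + m / 2) + 1) * K m n l q z) (box (-1) (-1 / 2) (-1) (-1)) := by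
    have h1 := ((nice_raise3 m n l 0).hol hz).mono
      (box_mono (by norm_num : (-3 / 2 : ℝ) ≤ -1) (le_refl (-1 / 2 : ℝ)) (le_refl (-1 : ℝ))
        (le_refl (-1 : ℝ)))
    have h2 := ((nice_K m n l 0).hol hz).mono
      (box_mono (le_refl (-1 : ℝ)) (by norm_num : (-1 : ℝ) ≤ -1 / 2) (le_refl (-1 : ℝ))
        (le_refl (-1 : ℝ)))
    refine h1.sub (DifferentiableOn.mul (by fun_prop) h2)
  refine fun q hq => sub_eq_zero.1 (eqOn_zero_box (a' := -1) (b' := -1 / 2) (c' := -1 / 2)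
    (d' := -3 / 2) le_rfl le_rfl (by norm_num) (by norm_num) (by norm_num) hd ?_ q hq)
  rintro ⟨x, y, c⟩ ⟨h1, h2, h3, h4⟩
  simp only at h1 h2 h3 h4
  have r0 : (x, y, c) ∈ regC := mem_regC.2 ⟨by linarith, by linarith, by linarith, by linarith⟩
  have r1 : (x + 1 / 2, y - 1 / 2, c) ∈ regC := by
    simp only [mem_regC, Complex.sub_re, Complex.add_re, half_re]
    exact ⟨by linarith, by linarith, by linarith, by linarith⟩
  have r2 : (x + 1 / 2, y - 1 / 2, c - 1 / 2) ∈ regC := by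
    simp only [mem_regC, Complex.sub_re, Complex.add_re, half_re]
    exact ⟨by linarith, by linarith, by linarith, by linarith⟩
  have r3 : (x + 1 / 2, y, c - 1 / 2) ∈ regC := by
    simp only [mem_regC, Complex.sub_re, Complex.add_re, half_re]
    exact ⟨by linarith, by linarith, by linarith, by linarith⟩
  have r4 : (x + 1 / 2, y, c) ∈ regC := by
    simp only [mem_regC, Complex.add_re, half_re]
    exact ⟨by linarith, by linarith, by linarith, by linarith⟩
  have e0 := dz_K hz (m + 1) (n - 1) l r1 r2
  have e1 := K_parts hz (m + 1) n l r4 (by simpa only [add_sub_cancel_right] using r0) r1 r3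
  have e2 := K_up_two hz (m + 1) (n - 1) (l - 1) r2 (by simpa only [sub_add_cancel] using r1)
  simp only [sub_add_cancel, add_sub_cancel_right] at e1 e2
  rw [raise3]
  simp only
  push_cast at e1
  rw [e0]
  rw [e2] at e1
  linear_combination -e1

/-! ### The hypergeometric equation -/

/-- The hypergeometric operator in terms of the exponents of the Euler type integral. -/
def hypL (a₁ a₂ a₃ : ℂ) (F : ℂ → ℂ) (z : ℂ) : ℂ :=
  z * (1 - z) * dz (dz F) z + ((a₁ + a₂ + 2 * a₃) * z - (a₁ + a₃)) * dz F z
    - a₃ * (a₁ + a₂ + a₃ + 1) * F z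

/-- The antiholomorphic version of `hypL`. -/
def hypLbar (a₁ a₂ a₃ : ℂ) (F : ℂ → ℂ) (z : ℂ) : ℂ :=
  conj z * (1 - conj z) * dzbar (dzbar F) z
    + ((a₁ + a₂ + 2 * a₃) * conj z - (a₁ + a₃)) * dzbar F z - a₃ * (a₁ + a₂ + a₃ + 1) * F z

/-- `F` is a joint solution of the two hypergeometric equations. -/
def IsSol (m n l : ℤ) (q : ℂ × ℂ × ℂ) (F : ℂ → ℂ) : Prop := ∀ z ∈ puncturedPlane,
  hypL (q.1 + m / 2) (q.2.1 + n / 2) (q.2.2 + l / 2) F z = 0 ∧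
    hypLbar (q.1 - m / 2) (q.2.1 - n / 2) (q.2.2 - l / 2) F z = 0

theorem dz_const_mul {f : ℂ → ℂ} {z : ℂ} (c : ℂ) (h : DifferentiableAt ℝ f z) :
    dz (fun w => c * f w) z = c * dz f z := ((hasW_of_differentiableAt h).const_mul c).dz_eq

theorem dzbar_const_mul {f : ℂ → ℂ} {z : ℂ} (c : ℂ) (h : DifferentiableAt ℝ f z) :
    dzbar (fun w => c * f w) z = c * dzbar f z :=
  ((hasW_of_differentiableAt h).const_mul c).dzbar_eq

theorem dz_of_eqOn {F G : ℂ → ℂ} {c : ℂ} (hFG : ∀ w ∈ puncturedPlane, F w = c * G w)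
    (hG : ∀ w ∈ puncturedPlane, DifferentiableAt ℝ G w) :
    ∀ w ∈ puncturedPlane, dz F w = c * dz G w := fun w hw => by
  rw [← dz_const_mul c (hG w hw)]
  refine dz_congr ?_
  filter_upwards [isOpen_puncturedPlane.mem_nhds hw] with v hv using hFG v hv

theorem dzbar_of_eqOn {F G : ℂ → ℂ} {c : ℂ} (hFG : ∀ w ∈ puncturedPlane, F w = c * G w)
    (hG : ∀ w ∈ puncturedPlane, DifferentiableAt ℝ G w) :
    ∀ w ∈ puncturedPlane, dzbar F w = c * dzbar G w := fun w hw => by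
  rw [← dzbar_const_mul c (hG w hw)]
  refine dzbar_congr ?_
  filter_upwards [isOpen_puncturedPlane.mem_nhds hw] with v hv using hFG v hv

theorem IsSol.of_eqOn {m n l : ℤ} {q : ℂ × ℂ × ℂ} {F G : ℂ → ℂ} (h : IsSol m n l q G) (c : ℂ)
    (hFG : ∀ w ∈ puncturedPlane, F w = c * G w)
    (hG : ∀ w ∈ puncturedPlane, DifferentiableAt ℝ G w)
    (hG1 : ∀ w ∈ puncturedPlane, DifferentiableAt ℝ (dz G) w)
    (hG2 : ∀ w ∈ puncturedPlane, DifferentiableAt ℝ (dzbar G) w) : IsSol m n l q F := by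
  intro z hz
  have e1 := dz_of_eqOn hFG hG
  have e2 := dzbar_of_eqOn hFG hG
  have e3 := dz_of_eqOn e1 hG1
  have e4 := dzbar_of_eqOn e2 hG2
  obtain ⟨h1, h2⟩ := h z hz
  rw [hypL] at h1 ⊢
  rw [hypLbar] at h2 ⊢
  rw [e3 z hz, e1 z hz, e4 z hz, e2 z hz, hFG z hz]
  constructor
  · linear_combination c * h1
  · linear_combination c * h2

theorem hypL_differentiableOn {Ω : Set (ℂ × ℂ × ℂ)} {F : ℂ × ℂ × ℂ → ℂ → ℂ}
    (h : Nice 2 Ω puncturedPlane F) {z : ℂ} (hz : z ∈ puncturedPlane) (m n l : ℤ) :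
    DifferentiableOn ℂ
      (fun q => hypL (q.1 + m / 2) (q.2.1 + n / 2) (q.2.2 + l / 2) (F q) z) Ω := by
  have h0 := h.hol hz
  have h1 := h.2.2.1.hol hz
  have h2 := h.2.2.1.2.2.1.hol hz
  unfold hypL
  fun_prop

theorem hypLbar_differentiableOn {Ω : Set (ℂ × ℂ × ℂ)} {F : ℂ × ℂ × ℂ → ℂ → ℂ}
    (h : Nice 2 Ω puncturedPlane F) {z : ℂ} (hz : z ∈ puncturedPlane) (m n l : ℤ) :
    DifferentiableOn ℂ
      (fun q => hypLbar (q.1 - m / 2) (q.2.1 - n / 2) (q.2.2 - l / 2) (F q) z) Ω := by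
  have h0 := h.hol hz
  have h1 := h.2.2.2.hol hz
  have h2 := h.2.2.2.2.2.2.hol hz
  unfold hypLbar
  fun_prop

theorem isSol_of_nice {a b c d a' b' c' d' : ℝ} (ha : a ≤ a') (hb : b ≤ b') (hc : c ≤ c')
    (hd : d' ≤ d) (hne : a' + b' + c' < d') {F : ℂ × ℂ × ℂ → ℂ → ℂ} {m n l : ℤ}
    (hF : Nice 2 (box a b c d) puncturedPlane F)
    (h0 : ∀ q ∈ box a' b' c' d', IsSol m n l q (F q)) :
    ∀ q ∈ box a b c d, IsSol m n l q (F q) := fun q hq _ hz =>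
  ⟨eqOn_zero_box ha hb hc hd hne (hypL_differentiableOn hF hz m n l)
    (fun p hp => (h0 p hp _ hz).1) q hq,
  eqOn_zero_box ha hb hc hd hne (hypLbar_differentiableOn hF hz m n l)
    (fun p hp => (h0 p hp _ hz).2) q hq⟩

/-- The second order operator factors: ∂ lowers the exponent at z with the factor −γ, and the
operator of `raise0` raises it back with the factor −(α + β + γ + 1). Both steps converge for Re c >
−1/2; the identity theorem removes this restriction. -/
theorem hypL_K {z : ℂ} (hz : z ∈ puncturedPlane) (m n l : ℤ) {q : ℂ × ℂ × ℂ} (hq : q ∈ regC) :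
    hypL (q.1 + m / 2) (q.2.1 + n / 2) (q.2.2 + l / 2) (K m n l q) z = 0 := by
  refine eqOn_zero_box (a' := -1) (b' := -1) (c' := -1 / 2) (d' := -1)
    le_rfl le_rfl (by norm_num) le_rfl (by norm_num)
    (hypL_differentiableOn (nice_K m n l 2) hz m n l) ?_ q hq
  rintro ⟨x, y, c⟩ h
  have hr := raise0_eq hz m n l _ h
  obtain ⟨h1, h2, h3, h4⟩ := h
  simp only at h1 h2 h3 h4 hr ⊢
  have r0 : (x, y, c) ∈ regC := mem_regC.2 ⟨h1, h2, by linarith, by linarith⟩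
  have r1 : (x, y, c - 1 / 2) ∈ regC := by
    simp only [mem_regC, Complex.sub_re, half_re]
    exact ⟨h1, h2, by linarith, by linarith⟩
  have e1 : ∀ w ∈ puncturedPlane, dz (K m n l (x, y, c)) w
      = -(c + l / 2) * K m n (l - 1) (x, y, c - 1 / 2) w := fun w hw => dz_K hw m n l r0 r1
  have e2 := dz_of_eqOn e1 fun w hw => (nice_K m n (l - 1) 1).differentiableAt r1 hw
  rw [raise0] at hr
  simp only at hr
  rw [hypL, e2 z hz, e1 z hz]
  linear_combination -(c + l / 2) * hr

theorem conj_K (m n l : ℤ) (q : ℂ × ℂ × ℂ) (z : ℂ) :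
    conj (K m n l q z) = K (-m) (-n) (-l) (conj q.1, conj q.2.1, conj q.2.2) z := by
  rw [K, K, ← integral_conj]
  refine integral_congr_ae (Filter.Eventually.of_forall fun t => ?_)
  simp only [euler, map_mul, conj_gp]

/-- The conjugate of K is a K with conjugate x-parameters and opposite integers, so its holomorphic
equation is the antiholomorphic equation of K. -/
theorem isSol_K (m n l : ℤ) {q : ℂ × ℂ × ℂ} (hq : q ∈ regC) : IsSol m n l q (K m n l q) := by
  intro z hz
  refine ⟨hypL_K hz m n l hq, ?_⟩
  have hq' : (conj q.1, conj q.2.1, conj q.2.2) ∈ regC := by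
    rw [mem_regC]
    simp only [Complex.conj_re]
    exact hq
  set G := K (-m) (-n) (-l) (conj q.1, conj q.2.1, conj q.2.2) with hG
  have hGn : Nice 2 regC puncturedPlane _ := nice_K (-m) (-n) (-l) 2
  have e0 : K m n l q = fun w => conj (G w) := by
    funext w
    rw [hG, ← conj_K, Complex.conj_conj]
  have e1 : ∀ w ∈ puncturedPlane, dzbar (K m n l q) w = conj (dz G w) := fun w hw => by
    rw [e0, dzbar_conj (hGn.differentiableAt hq' hw)]
  have e2 : dzbar (dzbar (K m n l q)) z = conj (dz (dz G) z) := by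
    rw [← dzbar_conj (hGn.2.2.1.differentiableAt hq' hz)]
    refine dzbar_congr ?_
    filter_upwards [isOpen_puncturedPlane.mem_nhds hz] with w hw using e1 w hw
  have h := congrArg conj (hypL_K hz (-m) (-n) (-l) hq')
  rw [← hG, hypL] at h
  rw [hypLbar, e2, e1 z hz, e0]
  simp only [map_zero, map_sub, map_add, map_mul, map_one, map_div₀, Complex.conj_conj, map_ofNat,
    map_neg, Int.cast_neg, map_intCast] at h
  linear_combination h

theorem K_differentiable (m n l : ℤ) {q : ℂ × ℂ × ℂ} (hq : q ∈ regC) :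
    (∀ w ∈ puncturedPlane, DifferentiableAt ℝ (K m n l q) w) ∧
    (∀ w ∈ puncturedPlane, DifferentiableAt ℝ (dz (K m n l q)) w) ∧
    (∀ w ∈ puncturedPlane, DifferentiableAt ℝ (dzbar (K m n l q)) w) := by
  have h := nice_K m n l 2
  exact ⟨fun w hw => h.differentiableAt hq hw, fun w hw => h.2.2.1.differentiableAt hq hw,
    fun w hw => h.2.2.2.differentiableAt hq hw⟩

theorem isSol_of_eq_K {m n l : ℤ} {q : ℂ × ℂ × ℂ} (hq : q ∈ regC) {F : ℂ → ℂ} (c : ℂ)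
    (h : ∀ w ∈ puncturedPlane, F w = c * K m n l q w) : IsSol m n l q F :=
  have hd := K_differentiable m n l hq
  (isSol_K m n l hq).of_eqOn c h hd.1 hd.2.1 hd.2.2

/-- On the part of the box that lies in `regC` the function is a multiple of K, hence a solution.
The equations are holomorphic in the exponents and so hold on the whole box, beyond the convergence
of K. -/
theorem isSol_raise0 (m n l : ℤ) :
    ∀ q ∈ box (-1) (-1) (-1 / 2) (-1 / 2), IsSol m n l q (raise0 m n l q) :=
  isSol_of_nice (a' := -1) (b' := -1) (c' := -1 / 2) (d' := -1) le_rfl le_rfl le_rfl (by norm_num)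
    (by norm_num) (nice_raise0 m n l 2) fun q hq => isSol_of_eq_K
      (box_mono le_rfl le_rfl (by norm_num) le_rfl hq) _ fun _ hw => raise0_eq hw m n l q hq

theorem isSol_raise1 (m n l : ℤ) :
    ∀ q ∈ box (-1 / 2) (-3 / 2) (-1) (-1), IsSol m n l q (raise1 m n l q) :=
  isSol_of_nice (a' := -1 / 2) (b' := -1) (c' := -1) (d' := -1) le_rfl (by norm_num) le_rfl le_rfl
    (by norm_num) (nice_raise1 m n l 2) fun q hq => isSol_of_eq_K
      (box_mono (by norm_num) le_rfl le_rfl le_rfl hq) _ fun _ hw => raise1_eq hw m n l q hq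

theorem isSol_raise2 (m n l : ℤ) :
    ∀ q ∈ box (-1) (-1) (-3 / 2) (-3 / 2), IsSol m n l q (raise2 m n l q) :=
  isSol_of_nice (a' := -1) (b' := -1) (c' := -1) (d' := -3 / 2) le_rfl le_rfl (by norm_num) le_rfl
    (by norm_num) (nice_raise2 m n l 2) fun q hq => isSol_of_eq_K
      (box_mono le_rfl le_rfl le_rfl (by norm_num) hq) _ fun _ hw => raise2_eq hw m n l q hq

theorem isSol_raise3 (m n l : ℤ) :
    ∀ q ∈ box (-3 / 2) (-1 / 2) (-1) (-1), IsSol m n l q (raise3 m n l q) :=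
  isSol_of_nice (a' := -1) (b' := -1 / 2) (c' := -1) (d' := -1) (by norm_num) le_rfl le_rfl le_rfl
    (by norm_num) (nice_raise3 m n l 2) fun q hq => isSol_of_eq_K
      (box_mono le_rfl (by norm_num) le_rfl le_rfl hq) _ fun _ hw => raise3_eq hw m n l q hq

/-! ### Holomorphic functions of two variables are analytic -/

/-- The integral over the circle as a continuous linear functional. -/
def circleCLM : C(Circle, ℂ) →L[ℂ] ℂ :=
  LinearMap.mkContinuous
    { toFun := fun h => ∫ θ in (0 : ℝ)..2 * Real.pi, h (Circle.exp θ)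
      map_add' := fun g h => by
        simp only [ContinuousMap.add_apply]
        exact intervalIntegral.integral_add (Continuous.intervalIntegrable (by fun_prop) _ _)
          (Continuous.intervalIntegrable (by fun_prop) _ _)
      map_smul' := fun c h => by
        simp only [ContinuousMap.smul_apply, RingHom.id_apply]
        exact intervalIntegral.integral_smul c _ }
    (|2 * Real.pi - 0|) fun h => by
      refine (intervalIntegral.norm_integral_le_of_norm_le_const
        fun θ _ => h.norm_coe_le_norm (Circle.exp θ)).trans_eq (mul_comm _ _)

theorem circleCLM_apply (h : C(Circle, ℂ)) :
    circleCLM h = ∫ θ in (0 : ℝ)..2 * Real.pi, h (Circle.exp θ) := rfl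

/-- **Osgood's lemma** in two variables. -/
theorem analyticOnNhd_of_differentiableOn {f : ℂ × ℂ → ℂ} {U : Set (ℂ × ℂ)} (hU : IsOpen U)
    (hf : DifferentiableOn ℂ f U) : AnalyticOnNhd ℂ f U := by
  rintro ⟨x₀, y₀⟩ hp
  obtain ⟨ε, hε, hball⟩ := Metric.isOpen_iff.1 hU _ hp
  set r : ℝ := ε / 2 with hr
  have hr0 : 0 < r := by positivity
  have hsub : Metric.closedBall x₀ r ×ˢ Metric.closedBall y₀ r ⊆ U := by
    rw [closedBall_prod_same]
    exact (Metric.closedBall_subset_ball (by linarith)).trans hball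
  have hcl : IsClosed (Metric.closedBall x₀ r ×ˢ Metric.closedBall y₀ r) :=
    Metric.isClosed_closedBall.prod Metric.isClosed_closedBall
  -- A Tietze extension of f from the closed bidisc, so that currying gives a continuous map on all
  -- of ℂ.
  obtain ⟨F, hF⟩ := ContinuousMap.exists_restrict_eq hcl
    ⟨_, (hf.continuousOn.mono hsub).domRestrict⟩
  have hFf : ∀ x ∈ Metric.closedBall x₀ r, ∀ y ∈ Metric.closedBall y₀ r, F (x, y) = f (x, y) :=
    fun x hx y hy => congrArg (fun G => G ⟨(x, y), hx, hy⟩) hF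
  set p : C(Circle, ℂ) := ⟨fun u => y₀ + r * u, by fun_prop⟩ with hpdef
  have hpexp : ∀ θ : ℝ, p (Circle.exp θ) = circleMap y₀ r θ := fun θ => by
    simp [hpdef, circleMap]
  have hpsph : ∀ u, p u ∈ Metric.sphere y₀ r := fun u => by
    simp [hpdef, abs_of_pos hr0, Circle.norm_coe]
  set Φ : C(ℂ, C(Circle, ℂ)) :=
    ContinuousMap.curry ⟨fun v : ℂ × Circle => F (v.1, p v.2), by fun_prop⟩ with hΦ
  have hΦa : ∀ x u, Φ x u = F (x, p u) := fun x u => rfl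
  -- A Cauchy integral in x with values in the Banach space C(Circle, ℂ), hence analytic in x; its
  -- value turns out to be the boundary function u ↦ f(x, p u).
  set g : ℂ → C(Circle, ℂ) := fun x =>
    (2 * Real.pi * Complex.I : ℂ)⁻¹ • ∮ η in C(x₀, r), (η - x)⁻¹ • Φ η with hg
  have hga : AnalyticAt ℂ g x₀ := by
    have := hasFPowerSeriesOn_cauchy_integral (c := x₀) (R := ⟨r, hr0.le⟩) (f := Φ)
      (Φ.continuous.continuousOn.circleIntegrable hr0.le) hr0
    exact this.analyticAt
  have hgv : ∀ x ∈ Metric.ball x₀ r, ∀ u, g x u = f (x, p u) := by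
    intro x hx u
    have hy := Metric.sphere_subset_closedBall (hpsph u)
    have hd : DifferentiableOn ℂ (fun η => f (η, p u)) (Metric.closedBall x₀ r) :=
      hf.comp (by fun_prop) fun η hη => hsub ⟨hη, hy⟩
    rw [← hd.diffContOnCl_ball (U := Metric.closedBall x₀ r) subset_rfl
      |>.two_pi_i_inv_smul_circleIntegral_sub_inv_smul hx, hg]
    simp only [ContinuousMap.smul_apply]
    congr 1
    have hc : ContinuousOn (fun η => (η - x)⁻¹ • Φ η) (Metric.sphere x₀ r) := by
      refine ContinuousOn.smul (ContinuousOn.inv₀ (f := fun η => η - x) (by fun_prop) ?_)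
        Φ.continuous.continuousOn
      rintro η hη h0
      rw [sub_eq_zero.1 h0] at hη
      exact (Metric.mem_ball.1 hx).ne (Metric.mem_sphere.1 hη)
    have hi := (hc.circleIntegrable hr0.le).out
    have := (ContinuousMap.evalCLM ℂ (M := ℂ) u).intervalIntegral_comp_comm hi
    rw [circleIntegral, circleIntegral]
    refine this.symm.trans (intervalIntegral.integral_congr fun θ _ => ?_)
    have hm := Metric.sphere_subset_closedBall (circleMap_mem_sphere x₀ hr0.le θ)
    simp only [ContinuousMap.evalCLM_apply, ContinuousMap.smul_apply, hΦa, hFf _ hm _ hy]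
  -- The Cauchy kernel in y as an element of the Banach algebra C(Circle, ℂ), where inversion is
  -- analytic at units. Then f(x, y) is a continuous linear functional of a product of g(x) and
  -- k(y), hence jointly analytic.
  set k : ℂ → C(Circle, ℂ) := fun y => Ring.inverse (p - y • (1 : C(Circle, ℂ))) with hk
  have hne : ∀ y ∈ Metric.ball y₀ r, ∀ u, p u - y ≠ 0 := by
    rintro y hy u h0
    rw [← sub_eq_zero.1 h0] at hy
    exact (Metric.mem_ball.1 hy).ne (Metric.mem_sphere.1 (hpsph u))
  have hunit : ∀ y ∈ Metric.ball y₀ r, ∃ v : C(Circle, ℂ)ˣ, (v : C(Circle, ℂ)) = p - y • 1 := by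
    intro y hy
    have : IsUnit (p - y • (1 : C(Circle, ℂ))) := by
      rw [ContinuousMap.isUnit_iff_forall_ne_zero]
      intro u
      simpa using hne y hy u
    exact this
  have hkv : ∀ y ∈ Metric.ball y₀ r, ∀ u, k y u = (p u - y)⁻¹ := by
    intro y hy u
    obtain ⟨v, hv⟩ := hunit y hy
    have h1 : k y * (p - y • 1) = 1 := by
      rw [hk]
      simp only
      rw [← hv, Ring.inverse_unit, Units.inv_mul]
    have h2 := congrArg (fun G : C(Circle, ℂ) => G u) h1
    simp only [ContinuousMap.mul_apply, ContinuousMap.sub_apply, ContinuousMap.smul_apply,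
      ContinuousMap.one_apply, smul_eq_mul, mul_one] at h2
    exact eq_inv_of_mul_eq_one_left h2
  have hka : AnalyticAt ℂ k y₀ := by
    obtain ⟨v, hv⟩ := hunit y₀ (Metric.mem_ball_self hr0)
    have h1 : AnalyticAt ℂ (fun y : ℂ => p - y • (1 : C(Circle, ℂ))) y₀ := by fun_prop
    have h2 := analyticAt_inverse (𝕜 := ℂ) v
    rw [hv] at h2
    exact AnalyticAt.comp (f := fun y : ℂ => p - y • (1 : C(Circle, ℂ))) h2 h1
  set w : C(Circle, ℂ) := ⟨fun u => r * u * Complex.I, by fun_prop⟩ with hw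
  have hrep : AnalyticAt ℂ (fun q : ℂ × ℂ => (2 * Real.pi * Complex.I : ℂ)⁻¹ •
      circleCLM (w * (k q.2 * g q.1))) (x₀, y₀) := by
    have h1 : AnalyticAt ℂ (fun q : ℂ × ℂ => g q.1) (x₀, y₀) :=
      AnalyticAt.comp (x := (x₀, y₀)) (f := Prod.fst) hga analyticAt_fst
    have h2 : AnalyticAt ℂ (fun q : ℂ × ℂ => k q.2) (x₀, y₀) :=
      AnalyticAt.comp (x := (x₀, y₀)) (f := Prod.snd) hka analyticAt_snd
    have h3 : AnalyticAt ℂ (fun q : ℂ × ℂ => w * (k q.2 * g q.1)) (x₀, y₀) :=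
      analyticAt_const.mul (h2.mul h1)
    have h4 : AnalyticAt ℂ (fun q : ℂ × ℂ => circleCLM (w * (k q.2 * g q.1))) (x₀, y₀) :=
      AnalyticAt.comp (circleCLM.analyticAt _) h3
    exact analyticAt_const.mul h4
  refine hrep.congr ?_
  have hnb : Metric.ball x₀ r ×ˢ Metric.ball y₀ r ∈ nhds (x₀, y₀) :=
    prod_mem_nhds (Metric.ball_mem_nhds _ hr0) (Metric.ball_mem_nhds _ hr0)
  filter_upwards [hnb] with q hq
  obtain ⟨x, y⟩ := q
  obtain ⟨hx, hy⟩ := hq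
  simp only at hx hy ⊢
  have hd : DifferentiableOn ℂ (fun η => f (x, η)) (Metric.closedBall y₀ r) :=
    hf.comp (by fun_prop) fun η hη => hsub ⟨Metric.ball_subset_closedBall hx, hη⟩
  rw [← hd.diffContOnCl_ball (U := Metric.closedBall y₀ r) subset_rfl
      |>.two_pi_i_inv_smul_circleIntegral_sub_inv_smul hy, circleCLM_apply, circleIntegral]
  congr 1
  refine intervalIntegral.integral_congr fun θ _ => ?_
  simp only [ContinuousMap.mul_apply, hkv y hy, hgv x hx, hpexp, deriv_circleMap, smul_eq_mul]
  simp [hw, circleMap]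

/-! ### The Euler type integral after inversion -/

/-- The real Jacobian of t ↦ 1/t is |t|^(−4), which is `gp (-2) 0 t`. -/
theorem integral_comp_inv (g : ℂ → ℂ) :
    ∫ t : ℂ, g t = ∫ t : ℂ, gp (-2) 0 t * g t⁻¹ := by
  have hm : MeasurableSet ({0}ᶜ : Set ℂ) := (measurableSet_singleton 0).compl
  have hae : ∀ h : ℂ → ℂ, ∫ t in ({0}ᶜ : Set ℂ), h t = ∫ t : ℂ, h t := fun h => by
    rw [restrict_compl_singleton]
  have him : (fun t : ℂ => t⁻¹) '' {0}ᶜ = {0}ᶜ := by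
    ext t
    simp only [Set.mem_image, Set.mem_compl_iff, Set.mem_singleton_iff]
    exact ⟨fun ⟨s, hs, h⟩ => h ▸ inv_ne_zero hs, fun h => ⟨t⁻¹, inv_ne_zero h, inv_inv t⟩⟩
  rw [← hae g, ← hae, ← him, integral_image_eq_integral_abs_det_fderiv_smul (μ := volume) hm
    (f' := fun t => (ContinuousLinearMap.toSpanSingleton ℂ (-(t ^ 2)⁻¹)).restrictScalars ℝ)
    (fun t ht => ((hasDerivAt_inv ht).hasFDerivAt.restrictScalars ℝ).hasFDerivWithinAt)
    inv_injective.injOn, him]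
  refine setIntegral_congr_fun hm fun t ht => ?_
  have hdet : ((ContinuousLinearMap.toSpanSingleton ℂ (-(t ^ 2)⁻¹)).restrictScalars ℝ).det
      = Complex.normSq (-(t ^ 2)⁻¹) := by
    rw [← Algebra.norm_complex_apply, Algebra.norm_apply]
    change LinearMap.det _ = _
    congr 1
    exact LinearMap.ext fun v => by simp [mul_comm]
  have hn : 0 < ‖t‖ := norm_pos_iff.2 ht
  have hgp : gp (-2) 0 t = ((‖t‖ ^ 4)⁻¹ : ℝ) := by
    have h1 : (2 * -2 * (Real.log ‖t‖ : ℂ)) = ((Real.log (‖t‖ ^ 4)⁻¹ : ℝ) : ℂ) := by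
      rw [Real.log_inv, Real.log_pow]
      push_cast
      ring
    rw [gp, zpow_zero, mul_one, h1, ← Complex.ofReal_exp, Real.exp_log (by positivity)]
  rw [hdet, hgp, Complex.normSq_eq_norm_sq, norm_neg, norm_inv, norm_pow, Complex.real_smul,
    abs_of_nonneg (by positivity)]
  congr 3
  rw [inv_pow, ← pow_mul]

/-- Inversion replaces 1 − zt by (t − z)/t. Afterwards z enters only through the translation t − z,
which makes convolution available. -/
theorem integral_euler_inv (k : ℤ) (a b θ z : ℂ) :
    ∫ t : ℂ, gpow t (pr (a - θ - 1) (-k)) * gpow (1 - t) (pr (b + θ - 1) k) *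
      gpow (1 - z * t) (pr (-a - θ) (-k)) = K k k (-k) (θ - b, b - 1 + θ, -a - θ) z := by
  rw [integral_comp_inv, K]
  refine integral_congr_ae ?_
  filter_upwards [ae_ne 0, ae_ne 1, ae_ne z] with t h0 h1 hz
  have hi := inv_ne_zero h0
  have e1 : 1 - t⁻¹ = t⁻¹ * (t - 1) := by field_simp
  have e2 : 1 - z * t⁻¹ = t⁻¹ * (t - z) := by field_simp
  have h1' := sub_ne_zero.2 h1
  have hz' := sub_ne_zero.2 hz
  rw [e1, e2, gpow_pr hi, gpow_pr (mul_ne_zero hi h1'), gpow_pr (mul_ne_zero hi hz'),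
    gp_mul hi h1', gp_mul hi hz', gp_inv h0, gp_inv h0, gp_inv h0]
  have hsum : gp (θ - b) k t = gp (-2) 0 t * gp (-(a - θ - 1)) (-(-k)) t
      * gp (-(b + θ - 1)) (-k) t * gp (-(-a - θ)) (-(-k)) t := by
    rw [← gp_add h0, ← gp_add h0, ← gp_add h0]
    congr 1 <;> ring
  have h3 : b - 1 + θ = b + θ - 1 := by ring
  rw [euler]
  simp only
  rw [hsum, h3]
  ring

/-! ### The reciprocal gamma factors -/

/-- The reciprocal of `Γ^ℂ(x + m/2 | x - m/2)` in the strip `0 < Re x < 1`. -/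
def recG (x : ℂ) (m : ℤ) : ℂ :=
  (Complex.I ^ (m.natAbs : ℤ))⁻¹ *
    (Complex.Gamma (1 - x + m.natAbs / 2) * (Complex.Gamma (x + m.natAbs / 2))⁻¹)

/-- The quotient of `recG x m` by `x + m/2`. -/
def recGdiv (x : ℂ) (m : ℤ) : ℂ :=
  if 0 ≤ m then (Complex.I ^ (m.natAbs : ℤ))⁻¹ *
    (Complex.Gamma (1 - x + m.natAbs / 2) * (Complex.Gamma (x + m.natAbs / 2 + 1))⁻¹)
  else recG x m / (x + m / 2)

theorem natAbs_half_re (m : ℤ) : ((m.natAbs : ℂ) / 2).re = (m.natAbs : ℝ) / 2 := by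
  rw [← Complex.ofReal_natCast, ← Complex.ofReal_ofNat, ← Complex.ofReal_div, Complex.ofReal_re]

theorem half_re_int (m : ℤ) : ((m : ℂ) / 2).re = (m : ℝ) / 2 := by
  rw [← Complex.ofReal_intCast, ← Complex.ofReal_ofNat, ← Complex.ofReal_div, Complex.ofReal_re]

theorem ne_neg_nat_of_re_pos {w : ℂ} (h : 0 < w.re) (j : ℕ) : w ≠ -(j : ℂ) := by
  rintro rfl
  simp at h
  exact absurd h (not_lt.2 (Nat.cast_nonneg j))

/-- Euler's reflection formula at p and p', whose sines differ by (−1)^n. It says that the two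
expressions for `gammaC` agree off the integers. -/
theorem gammaC_reflection {p p' : ℂ} {n : ℕ} (hp : p = p' - n) (h : ∀ j : ℤ, p ≠ j) :
    Complex.I ^ (-(n : ℤ)) * (Complex.Gamma p / Complex.Gamma (1 - p'))
      = Complex.I ^ (n : ℤ) * (Complex.Gamma p' / Complex.Gamma (1 - p)) := by
  have hs : ∀ w : ℂ, (∀ j : ℤ, w ≠ j) → Complex.Gamma w ≠ 0 := fun w hw =>
    Complex.Gamma_ne_zero fun j hj => hw (-j) (by rw [hj]; push_cast; rfl)
  have h1 : Complex.Gamma (1 - p) ≠ 0 := hs _ fun j hj => h (1 - j) (by push_cast; rw [← hj]; ring)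
  have h2 : Complex.Gamma (1 - p') ≠ 0 := hs _ fun j hj => h (1 - j - n) (by
    push_cast; rw [← hj, hp]; ring)
  have hsin : Complex.sin (Real.pi * p') = (-1) ^ n * Complex.sin (Real.pi * p) := by
    have : (Real.pi : ℂ) * p' = Real.pi * p + n * Real.pi := by rw [hp]; ring
    rw [this, Complex.sin_antiperiodic.add_nat_mul_eq]
  have hI : Complex.I ^ (n : ℤ) = (-1) ^ n * Complex.I ^ (-(n : ℤ)) := by
    rw [zpow_neg, eq_mul_inv_iff_mul_eq₀ (zpow_ne_zero _ Complex.I_ne_zero), zpow_natCast,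
      ← mul_pow, Complex.I_mul_I]
  have hpm : ((-1 : ℂ) ^ n) * (-1) ^ n = 1 := by rw [← mul_pow]; simp
  have h3 := Complex.Gamma_mul_Gamma_one_sub p
  have h4 := Complex.Gamma_mul_Gamma_one_sub p'
  have h5 : Complex.Gamma p * Complex.Gamma (1 - p)
      = (-1) ^ n * (Complex.Gamma p' * Complex.Gamma (1 - p')) := by
    rw [h3, h4, hsin]
    rcases neg_one_pow_eq_or ℂ n with h | h <;> rw [h] <;> simp [div_neg]
  rw [hI, mul_div_assoc', mul_div_assoc', div_eq_div_iff h2 h1]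
  linear_combination Complex.I ^ (-(n : ℤ)) * h5

/-- `recG` uses |m|, that is, whichever of the two expressions has its gamma arguments in the right
half plane. For negative m, if x + m/2 is an integer then it is at most 0, because Re x < 1, and the
case distinction in `gammaC` selects the matching expression; otherwise the reflection formula
applies. -/
theorem gammaC_pr_eq_inv {x : ℂ} (h0 : 0 < x.re) (h1 : x.re < 1) (m : ℤ) :
    gammaC (pr x m) = (recG x m)⁻¹ := by
  have hr : (recG x m)⁻¹ = Complex.I ^ (m.natAbs : ℤ) *
      (Complex.Gamma (x + m.natAbs / 2) / Complex.Gamma (1 - x + m.natAbs / 2)) := by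
    rw [recG, mul_inv, mul_inv, inv_inv, inv_inv, div_eq_mul_inv]
    ring
  rw [hr, gammaC, pr]
  simp only
  have e1 : x + m / 2 - (x - m / 2) = ((m : ℤ) : ℂ) := by ring
  have e2 : x - m / 2 - (x + m / 2) = ((-m : ℤ) : ℂ) := by push_cast; ring
  rw [e1, e2, Complex.cpow_intCast, Complex.cpow_intCast]
  rcases Int.natAbs_eq m with hm | hm
  · have hc : (m : ℂ) = (m.natAbs : ℂ) := by
      rw [← Int.cast_natCast, ← hm]
    rw [if_neg, hc, ← hm]
    · congr 3; ring
    · rintro ⟨j, hj⟩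
      refine ne_neg_nat_of_re_pos ?_ j hj
      rw [hc, Complex.add_re, natAbs_half_re]
      positivity
  · have hc : (m : ℂ) = -(m.natAbs : ℂ) := by
      rw [← Int.cast_natCast, ← Int.cast_neg, ← hm]
    have e3 : x + (m : ℂ) / 2 = (x - m / 2) - (m.natAbs : ℕ) := by rw [hc]; ring
    have e4 : x - (m : ℂ) / 2 = x + m.natAbs / 2 := by rw [hc]; ring
    have e5 : 1 - x + (m.natAbs : ℂ) / 2 = 1 - (x + m / 2) := by rw [hc]; ring
    have e6 : -m = m.natAbs := by omega
    rw [← e4, e5, e6]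
    split_ifs with h
    · rfl
    · have hz : ∀ j : ℤ, x + (m : ℂ) / 2 ≠ j := by
        intro j hj
        have hre : x.re - (m.natAbs : ℝ) / 2 = j := by
          rw [e3, e4, add_sub_assoc] at hj
          have := congrArg Complex.re hj
          rw [Complex.add_re, Complex.sub_re, natAbs_half_re, Complex.natCast_re,
            Complex.intCast_re] at this
          linarith
        have hn : (0 : ℝ) ≤ m.natAbs := Nat.cast_nonneg _
        have hj0 : j ≤ 0 := by
          have : (j : ℝ) < 1 := by linarith
          exact Int.lt_add_one_iff.1 (by exact_mod_cast this)
        refine h ⟨j.natAbs, ?_⟩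
        rw [hj, ← Int.cast_natCast, ← Int.cast_neg]
        congr 1
        omega
      have := gammaC_reflection e3 hz
      rwa [← hm] at this

theorem differentiableAt_recG {x : ℂ} {m : ℤ} (h : ∀ j : ℕ, 1 - x + m.natAbs / 2 ≠ -j) :
    DifferentiableAt ℂ (fun x => recG x m) x := by
  have h1 : DifferentiableAt ℂ (fun x : ℂ => Complex.Gamma (1 - x + m.natAbs / 2)) x :=
    (Complex.differentiableAt_Gamma _ h).comp x (f := fun x : ℂ => 1 - x + m.natAbs / 2)
      (by fun_prop)
  have h2 : DifferentiableAt ℂ (fun x : ℂ => (Complex.Gamma (x + m.natAbs / 2))⁻¹) x :=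
    (Complex.differentiable_one_div_Gamma _).comp x (f := fun x : ℂ => x + m.natAbs / 2)
      (by fun_prop)
  exact (h1.mul h2).const_mul _

theorem differentiableAt_recG_of_re_lt_one {x : ℂ} (h : x.re < 1) (m : ℤ) :
    DifferentiableAt ℂ (fun x => recG x m) x :=
  differentiableAt_recG <| ne_neg_nat_of_re_pos <| by
    rw [Complex.add_re, natAbs_half_re, Complex.sub_re, Complex.one_re]
    have : (0 : ℝ) ≤ m.natAbs := Nat.cast_nonneg _
    linarith

/-- The only poles are those of Γ(1 − x + |m|/2); for Re x < 3/2 just the first one for m = 0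
remains, at x = 1. -/
theorem differentiableAt_recG_of_re_lt {x : ℂ} (h : x.re < 3 / 2) {m : ℤ}
    (hm : m = 0 → x ≠ 1) : DifferentiableAt ℂ (fun x => recG x m) x := by
  refine differentiableAt_recG fun j hj => ?_
  have hre := congrArg Complex.re hj
  rw [Complex.add_re, natAbs_half_re, Complex.sub_re, Complex.one_re, Complex.neg_re,
    Complex.natCast_re] at hre
  have h1 : (j : ℝ) + m.natAbs / 2 < 1 / 2 := by linarith
  have h2 : 2 * j + m.natAbs < 1 := by
    have : (2 * j + m.natAbs : ℝ) < 1 := by linarith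
    exact_mod_cast this
  obtain ⟨rfl, h3⟩ : j = 0 ∧ m.natAbs = 0 := by omega
  refine hm (Int.natAbs_eq_zero.1 h3) ?_
  rw [h3] at hj
  simp only [Nat.cast_zero, zero_div, add_zero, neg_zero] at hj
  exact (sub_eq_zero.1 hj).symm

/-- For m ≥ 0 the functional equation of Γ absorbs the zero of x + m/2. For m < 0 there is none, as
the real part of x + m/2 is negative. -/
theorem differentiableAt_recGdiv {x : ℂ} (h1 : x.re < 1 / 2) (m : ℤ) :
    DifferentiableAt ℂ (fun x => recGdiv x m) x := by
  have h2 : x.re < 1 := by linarith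
  unfold recGdiv
  split_ifs with hm
  · have d1 : DifferentiableAt ℂ (fun x : ℂ => Complex.Gamma (1 - x + m.natAbs / 2)) x := by
      refine (Complex.differentiableAt_Gamma _ (ne_neg_nat_of_re_pos ?_)).comp x
        (f := fun x : ℂ => 1 - x + m.natAbs / 2) (by fun_prop)
      rw [Complex.add_re, natAbs_half_re, Complex.sub_re, Complex.one_re]
      have : (0 : ℝ) ≤ m.natAbs := Nat.cast_nonneg _
      linarith
    have d2 : DifferentiableAt ℂ (fun x : ℂ => (Complex.Gamma (x + m.natAbs / 2 + 1))⁻¹) x :=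
      (Complex.differentiable_one_div_Gamma _).comp x (f := fun x : ℂ => x + m.natAbs / 2 + 1)
        (by fun_prop)
    exact (d1.mul d2).const_mul _
  · refine (differentiableAt_recG_of_re_lt_one h2 m).div (by fun_prop) fun h => ?_
    have hre := congrArg Complex.re h
    rw [Complex.add_re, half_re_int, Complex.zero_re] at hre
    have : (m : ℝ) ≤ -1 := by
      have : m ≤ -1 := by omega
      exact_mod_cast this
    linarith

theorem recGdiv_mul {x : ℂ} {m : ℤ} (h0 : 0 < x.re) (h1 : x.re < 1 / 2) :
    recGdiv x m * (x + m / 2) = recG x m := by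
  have hx : x + m / 2 ≠ 0 := by
    intro h
    have hre := congrArg Complex.re h
    rw [Complex.add_re, half_re_int, Complex.zero_re] at hre
    have m1 : (-1 : ℝ) < m := by linarith
    have m2 : (m : ℝ) < 0 := by linarith
    have m3 : -1 < m := by exact_mod_cast m1
    have m4 : m < 0 := by exact_mod_cast m2
    omega
  unfold recGdiv
  split_ifs with hm
  · have hc : (m : ℂ) = (m.natAbs : ℂ) := by
      rw [← Int.cast_natCast, ← Int.eq_natAbs_of_nonneg hm]
    rw [← hc, Complex.Gamma_add_one _ hx, recG, ← hc, mul_inv]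
    have h := inv_mul_cancel₀ hx
    linear_combination (Complex.I ^ (m.natAbs : ℤ))⁻¹ * (Complex.Gamma (1 - x + m / 2)
      * (Complex.Gamma (x + m / 2))⁻¹) * h
  · exact div_mul_cancel₀ _ hx

/-! ### The continuation of the kernel -/

theorem pairPlus_eq_pr {θ : ℂ} (hθ : conj θ = -θ) (k : ℤ) (a : ℂ) :
    pairPlus a (θ + k / 2) = pr (a + θ) k := by
  simp only [pairPlus, pr, map_add, map_div₀, map_intCast, map_ofNat, hθ]
  ext1 <;> simp only <;> ring

theorem pairMinus_eq_pr {θ : ℂ} (hθ : conj θ = -θ) (k : ℤ) (a : ℂ) :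
    pairMinus a (θ + k / 2) = pr (a - θ) (-k) := by
  simp only [pairMinus, pr, map_add, map_div₀, map_intCast, map_ofNat, hθ, Int.cast_neg]
  ext1 <;> simp only <;> ring

theorem gammaC_diag_ne_zero {w : ℂ} (h0 : 0 < w.re) (h2 : w.re < 2) (h1 : w ≠ 1) :
    gammaC (w, w) ≠ 0 := by
  have hw := ne_neg_nat_of_re_pos h0
  rw [gammaC, if_neg (fun ⟨j, hj⟩ => hw j hj)]
  simp only [sub_self, Complex.cpow_zero, one_mul]
  refine div_ne_zero (Complex.Gamma_ne_zero hw) (Complex.Gamma_ne_zero fun j hj => ?_)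
  have hre := congrArg Complex.re hj
  rw [Complex.sub_re, Complex.one_re, Complex.neg_re, Complex.natCast_re] at hre
  have : (j : ℝ) < 1 := by linarith
  have hj0 : j = 0 := by
    have : j < 1 := by exact_mod_cast this
    omega
  apply h1
  rw [hj0, Nat.cast_zero, neg_zero] at hj
  exact (sub_eq_zero.1 hj).symm

/-- The exponents of the Euler type integral. -/
def expo (θ : ℂ) (p : ℂ × ℂ) : ℂ × ℂ × ℂ := (θ - p.2, p.2 - 1 + θ, -p.1 - θ)

/-- The normalizing factor in front of the Euler type integral. -/
def normFactor (k : ℤ) (θ : ℂ) (p : ℂ × ℂ) : ℂ :=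
  recG (p.1 - θ) (-k) * recG (p.2 + θ) k / Real.pi

/-- The gamma factor at a + b in the beta function cancels the one in front. Only two reciprocal
gamma factors are left, and nothing singular happens on a + b = 1 in the new expression. -/
theorem euler_kernel_eq {θ : ℂ} (hθ : conj θ = -θ) (k : ℤ) (z : ℂ) {a b : ℂ} (a0 : 0 < a.re)
    (a1 : a.re < 1) (b0 : 0 < b.re) (b1 : b.re < 1) (hab : a + b ≠ 1) :
    1 / gammaC (a + b, a + b) *
      hypC (pairPlus a (θ + k / 2)) (pairMinus a (θ + k / 2)) (a + b, a + b) z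
      = normFactor k θ (a, b) * K k k (-k) (expo θ (a, b)) z := by
  have hθre : θ.re = 0 := by
    have := congrArg Complex.re hθ
    rw [Complex.conj_re, Complex.neg_re] at this
    linarith
  have hsub : (a + b, a + b) - pr (a - θ) (-k) = pr (b + θ) k := by
    simp only [pr, Prod.mk_sub_mk, Int.cast_neg]
    ext1 <;> simp only <;> ring
  have hq1 : pr (a - θ) (-k) - 1 = pr (a - θ - 1) (-k) := by
    simp only [pr, Int.cast_neg]
    ext1 <;> simp only [Prod.fst_sub, Prod.snd_sub, Prod.fst_one, Prod.snd_one] <;> ring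
  have hq2 : pr (b + θ) k - 1 = pr (b + θ - 1) k := by
    simp only [pr]
    ext1 <;> simp only [Prod.fst_sub, Prod.snd_sub, Prod.fst_one, Prod.snd_one] <;> ring
  have hq3 : -pr (a + θ) k = pr (-a - θ) (-k) := by
    simp only [pr, Int.cast_neg]
    ext1 <;> simp only [Prod.fst_neg, Prod.snd_neg] <;> ring
  have hsum : pr (a - θ) (-k) + pr (b + θ) k = (a + b, a + b) := by rw [← hsub]; abel
  have hne : gammaC (a + b, a + b) ≠ 0 := gammaC_diag_ne_zero
    (by rw [Complex.add_re]; linarith) (by rw [Complex.add_re]; linarith) hab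
  rw [pairPlus_eq_pr hθ, pairMinus_eq_pr hθ, hypC, betaC, hsub, hsum, hq1, hq2, hq3,
    integral_euler_inv,
    gammaC_pr_eq_inv (x := a - θ) (by rw [Complex.sub_re]; linarith)
      (by rw [Complex.sub_re]; linarith),
    gammaC_pr_eq_inv (x := b + θ) (by rw [Complex.add_re]; linarith)
      (by rw [Complex.add_re]; linarith), normFactor, expo]
  simp only
  rw [← mul_assoc]
  congr 1
  simp only [mul_inv, inv_inv, div_eq_mul_inv]
  field_simp

/-- The continuation of the kernel, given by the raising operators outside of the domain of
convergence of the Euler type integral. -/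
def cont (k : ℤ) (θ z : ℂ) (p : ℂ × ℂ) : ℂ :=
  if p.1.re ≤ 0 then recGdiv (p.1 - θ) (-k) * recG (p.2 + θ) k / Real.pi
    * raise0 k k (-k) (expo θ p) z
  else if p.2.re ≤ 0 then recG (p.1 - θ) (-k) * recGdiv (p.2 + θ) k / Real.pi
    * raise1 k k (-k) (expo θ p) z
  else if 1 ≤ p.1.re then normFactor k θ p / (p.1 + θ + k / 2 - 1)
    * raise2 k k (-k) (expo θ p) z
  else if 1 ≤ p.2.re then normFactor k θ p / (1 - p.2 + θ + k / 2)
    * raise3 k k (-k) (expo θ p) z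
  else normFactor k θ p * K k k (-k) (expo θ p) z

/-- The domain of the continuation. -/
def contDomain (k : ℤ) (θ : ℂ) : Set (ℂ × ℂ) :=
  {p | (p.1.re, p.2.re) ∈ paramDomain ∧
    (k = 0 → p.1 - θ ≠ 1 ∧ p.1 + θ ≠ 1 ∧ p.2 + θ ≠ 1 ∧ p.2 - θ ≠ 1)}

theorem isOpen_contDomain (k : ℤ) (θ : ℂ) : IsOpen (contDomain k θ) := by
  have c1 : Continuous fun p : ℂ × ℂ => p.1.re := by fun_prop
  have c2 : Continuous fun p : ℂ × ℂ => p.2.re := by fun_prop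
  have h1 : IsOpen {p : ℂ × ℂ | (p.1.re, p.2.re) ∈ paramDomain} :=
    (isOpen_lt continuous_const (c1.add c2)).inter
      ((isOpen_lt (c1.add c2) continuous_const).inter
        ((isOpen_lt continuous_const (c1.sub c2)).inter (isOpen_lt (c1.sub c2) continuous_const)))
  by_cases hk : k = 0
  · have h2 : IsOpen {p : ℂ × ℂ | p.1 - θ ≠ 1 ∧ p.1 + θ ≠ 1 ∧ p.2 + θ ≠ 1 ∧ p.2 - θ ≠ 1} :=
      (isOpen_ne_fun (by fun_prop) (by fun_prop)).inter
        ((isOpen_ne_fun (by fun_prop) (by fun_prop)).inter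
          ((isOpen_ne_fun (by fun_prop) (by fun_prop)).inter
            (isOpen_ne_fun (by fun_prop) (by fun_prop))))
    have : contDomain k θ = {p : ℂ × ℂ | (p.1.re, p.2.re) ∈ paramDomain} ∩
        {p | p.1 - θ ≠ 1 ∧ p.1 + θ ≠ 1 ∧ p.2 + θ ≠ 1 ∧ p.2 - θ ≠ 1} := by
      ext p; simp [contDomain, hk]
    rw [this]
    exact h1.inter h2
  · have : contDomain k θ = {p : ℂ × ℂ | (p.1.re, p.2.re) ∈ paramDomain} := by
      ext p; simp [contDomain, hk]
    rwa [this]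

/-- Near each point the continuation is a product of a holomorphic factor and a holomorphic family
of solutions. -/
theorem cont_local {θ : ℂ} (hθ : θ.re = 0) {k : ℤ} {p : ℂ × ℂ} (hp : p ∈ contDomain k θ) :
    ∃ (c : ℂ × ℂ → ℂ) (W : ℂ × ℂ × ℂ → ℂ → ℂ) (Ω : Set (ℂ × ℂ × ℂ)),
      IsOpen Ω ∧ expo θ p ∈ Ω ∧ DifferentiableAt ℂ c p ∧
      (∀ j, Nice j Ω puncturedPlane W) ∧ (∀ q ∈ Ω, IsSol k k (-k) q (W q)) ∧
      ∀ᶠ p' in nhds p, ∀ z ∈ puncturedPlane, cont k θ z p' = c p' * W (expo θ p') z := by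
  obtain ⟨⟨s0, s1, d0, d1⟩, hk⟩ := hp
  simp only at s0 s1 d0 d1
  have c1 : Continuous fun p : ℂ × ℂ => p.1.re := by fun_prop
  have c2 : Continuous fun p : ℂ × ℂ => p.2.re := by fun_prop
  have lt1 : ∀ {r : ℝ}, p.1.re < r → ∀ᶠ p' in nhds p, p'.1.re < r := fun h =>
    c1.continuousAt.eventually_lt continuousAt_const h
  have gt1 : ∀ {r : ℝ}, r < p.1.re → ∀ᶠ p' in nhds p, r < p'.1.re := fun h =>
    continuousAt_const.eventually_lt c1.continuousAt h
  have lt2 : ∀ {r : ℝ}, p.2.re < r → ∀ᶠ p' in nhds p, p'.2.re < r := fun h =>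
    c2.continuousAt.eventually_lt continuousAt_const h
  have gt2 : ∀ {r : ℝ}, r < p.2.re → ∀ᶠ p' in nhds p, r < p'.2.re := fun h =>
    continuousAt_const.eventually_lt c2.continuousAt h
  have r1 : ∀ w : ℂ, (w - θ).re = w.re := fun w => by rw [Complex.sub_re, hθ, sub_zero]
  have r2 : ∀ w : ℂ, (w + θ).re = w.re := fun w => by rw [Complex.add_re, hθ, add_zero]
  have x1 : ∀ p : ℂ × ℂ, (expo θ p).1.re = -p.2.re := fun p => by simp [expo, hθ]
  have x2 : ∀ p : ℂ × ℂ, (expo θ p).2.1.re = p.2.re - 1 := fun p => by simp [expo, hθ]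
  have x3 : ∀ p : ℂ × ℂ, (expo θ p).2.2.re = -p.1.re := fun p => by simp [expo, hθ]
  have hbox : ∀ {a b c d : ℝ} {p : ℂ × ℂ}, expo θ p ∈ box a b c d ↔
      a < -p.2.re ∧ b < p.2.re - 1 ∧ c < -p.1.re ∧ -p.1.re - 1 < d := by
    intro a b c d p
    rw [box, Set.mem_ofPred_eq, x1, x2, x3]
    have : -p.2.re + (p.2.re - 1) + -p.1.re = -p.1.re - 1 := by ring
    rw [this]
  have hregC : ∀ {p : ℂ × ℂ}, 0 < p.1.re → p.1.re < 1 → 0 < p.2.re → p.2.re < 1 →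
      expo θ p ∈ regC := fun h1 h2 h3 h4 => by
    rw [regC_eq_box, hbox]
    exact ⟨by linarith, by linarith, by linarith, by linarith⟩
  have hk1 : -k = 0 → p.1 - θ ≠ 1 := fun h => (hk (by omega)).1
  have hk2 : k = 0 → p.2 + θ ≠ 1 := fun h => (hk h).2.2.1
  -- holomorphy of the factors
  have g1 : DifferentiableAt ℂ (fun p : ℂ × ℂ => recG (p.1 - θ) (-k)) p :=
    DifferentiableAt.comp p (f := fun p : ℂ × ℂ => p.1 - θ) (g := fun x => recG x (-k))
      (differentiableAt_recG_of_re_lt (by rw [r1]; linarith) hk1) (by fun_prop)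
  have g2 : DifferentiableAt ℂ (fun p : ℂ × ℂ => recG (p.2 + θ) k) p :=
    DifferentiableAt.comp p (f := fun p : ℂ × ℂ => p.2 + θ) (g := fun x => recG x k)
      (differentiableAt_recG_of_re_lt (by rw [r2]; linarith) hk2) (by fun_prop)
  have g3 : DifferentiableAt ℂ (normFactor k θ) p := by
    unfold normFactor
    fun_prop
  -- Here Re a > −1/2 and 0 < Re b < 1, so only convergence at infinity fails, by less than one
  -- half.
  by_cases hA : p.1.re ≤ 0
  · refine ⟨fun p => recGdiv (p.1 - θ) (-k) * recG (p.2 + θ) k / Real.pi, raise0 k k (-k), _,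
      isOpen_box _ _ _ _, hbox.2 ⟨by linarith, by linarith, by linarith, by linarith⟩, ?_,
      nice_raise0 k k (-k), isSol_raise0 k k (-k), ?_⟩
    · have g4 : DifferentiableAt ℂ (fun p : ℂ × ℂ => recGdiv (p.1 - θ) (-k)) p :=
        DifferentiableAt.comp p (f := fun p : ℂ × ℂ => p.1 - θ) (g := fun x => recGdiv x (-k))
          (differentiableAt_recGdiv (by rw [r1]; linarith) _) (by fun_prop)
      fun_prop
    -- Nearby points may have Re a > 0, where `cont` is the Euler integral. On this overlap `raise0`
    -- produces exactly the linear factor by which `recGdiv` differs from `recG`.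
    · filter_upwards [lt1 (r := 1 / 2) (by linarith), gt2 (r := 0) (by linarith),
        lt2 (r := 1) (by linarith)] with p' h1 h2 h3 z hz
      by_cases h0 : p'.1.re ≤ 0
      · rw [cont, if_pos h0]
      · rw [not_le] at h0
        rw [cont, if_neg (not_le.2 h0), if_neg (not_le.2 h2), if_neg (by linarith),
          if_neg (by linarith), normFactor,
          raise0_eq hz k k (-k) _ (hbox.2 ⟨by linarith, by linarith, by linarith, by linarith⟩),
          ← recGdiv_mul (x := p'.1 - θ) (m := -k) (by rw [r1]; exact h0) (by rw [r1]; exact h1)]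
        simp only [expo, Int.cast_neg]
        ring
  rw [not_le] at hA
  -- The same at the singular point 1, where the linear factor is b + θ + k/2.
  by_cases hB : p.2.re ≤ 0
  · refine ⟨fun p => recG (p.1 - θ) (-k) * recGdiv (p.2 + θ) k / Real.pi, raise1 k k (-k), _,
      isOpen_box _ _ _ _, hbox.2 ⟨by linarith, by linarith, by linarith, by linarith⟩, ?_,
      nice_raise1 k k (-k), isSol_raise1 k k (-k), ?_⟩
    · have g4 : DifferentiableAt ℂ (fun p : ℂ × ℂ => recGdiv (p.2 + θ) k) p :=
        DifferentiableAt.comp p (f := fun p : ℂ × ℂ => p.2 + θ) (g := fun x => recGdiv x k)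
          (differentiableAt_recGdiv (by rw [r2]; linarith) _) (by fun_prop)
      fun_prop
    · filter_upwards [lt2 (r := 1 / 2) (by linarith), gt1 (r := 0) (by linarith),
        lt1 (r := 1) (by linarith)] with p' h1 h2 h3 z hz
      by_cases h0 : p'.2.re ≤ 0
      · rw [cont, if_neg (not_le.2 h2), if_pos h0]
      · rw [not_le] at h0
        rw [cont, if_neg (not_le.2 h2), if_neg (not_le.2 h0), if_neg (by linarith),
          if_neg (by linarith), normFactor,
          raise1_eq hz k k (-k) _ (hbox.2 ⟨by linarith, by linarith, by linarith, by linarith⟩),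
          ← recGdiv_mul (x := p'.2 + θ) (m := k) (by rw [r2]; exact h0) (by rw [r2]; exact h1)]
        simp only [expo]
        ring
  rw [not_le] at hB
  have kz : -1 < (k : ℝ) → (k : ℝ) < 1 → k = 0 := fun h1 h2 => by
    have h3 : -1 < k := by exact_mod_cast h1
    have h4 : k < 1 := by exact_mod_cast h2
    omega
  by_cases hC : 1 ≤ p.1.re
  -- Since 1 ≤ Re a < 3/2, the real part can vanish only for k = 0, and then a + θ = 1 is an
  -- excluded pole. No reciprocal gamma factor compensates here.
  · have hne : p.1 + θ + k / 2 - 1 ≠ 0 := by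
      intro h
      have hre := congrArg Complex.re h
      rw [Complex.sub_re, Complex.add_re, half_re_int, r2, Complex.one_re, Complex.zero_re] at hre
      have k0 := kz (by linarith) (by linarith)
      rw [k0, Int.cast_zero, zero_div, add_zero] at h
      exact (hk k0).2.1 (sub_eq_zero.1 h)
    have hev : ∀ᶠ p' : ℂ × ℂ in nhds p, p'.1 + θ + k / 2 - 1 ≠ 0 :=
      ContinuousAt.eventually_ne (g := fun p' : ℂ × ℂ => p'.1 + θ + k / 2 - 1) (by fun_prop) hne
    refine ⟨fun p => normFactor k θ p / (p.1 + θ + k / 2 - 1), raise2 k k (-k), _,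
      isOpen_box _ _ _ _, hbox.2 ⟨by linarith, by linarith, by linarith, by linarith⟩,
      by fun_prop (disch := exact hne), nice_raise2 k k (-k), isSol_raise2 k k (-k), ?_⟩
    filter_upwards [hev, gt1 (r := 1 / 2) (by linarith), gt2 (r := 0) (by linarith),
      lt2 (r := 1) (by linarith)] with p' hne' h1 h2 h3 z hz
    by_cases h0 : 1 ≤ p'.1.re
    · rw [cont, if_neg (by linarith), if_neg (by linarith), if_pos h0]
    · rw [cont, if_neg (by linarith), if_neg (by linarith), if_neg h0, if_neg (by linarith),
        raise2_eq hz k k (-k) _ (hbox.2 ⟨by linarith, by linarith, by linarith, by linarith⟩)]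
      have e : -((expo θ p').2.2 + ((-k : ℤ) : ℂ) / 2 + 1) = p'.1 + θ + k / 2 - 1 := by
        simp only [expo, Int.cast_neg]; ring
      rw [e, ← mul_assoc, div_mul_cancel₀ _ hne']
  by_cases hD : 1 ≤ p.2.re
  -- Likewise for 1 ≤ Re b < 3/2, with the excluded pole b − θ = 1.
  · have hne : 1 - p.2 + θ + k / 2 ≠ 0 := by
      intro h
      have hre := congrArg Complex.re h
      rw [Complex.add_re, half_re_int, r2, Complex.sub_re, Complex.one_re, Complex.zero_re] at hre
      have k0 := kz (by linarith) (by linarith)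
      rw [k0, Int.cast_zero, zero_div, add_zero] at h
      exact (hk k0).2.2.2 (by linear_combination -h)
    have hev : ∀ᶠ p' : ℂ × ℂ in nhds p, 1 - p'.2 + θ + k / 2 ≠ 0 :=
      ContinuousAt.eventually_ne (g := fun p' : ℂ × ℂ => 1 - p'.2 + θ + k / 2) (by fun_prop) hne
    refine ⟨fun p => normFactor k θ p / (1 - p.2 + θ + k / 2), raise3 k k (-k), _,
      isOpen_box _ _ _ _, hbox.2 ⟨by linarith, by linarith, by linarith, by linarith⟩,
      by fun_prop (disch := exact hne), nice_raise3 k k (-k), isSol_raise3 k k (-k), ?_⟩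
    filter_upwards [hev, gt2 (r := 1 / 2) (by linarith), gt1 (r := 0) (by linarith),
      lt1 (r := 1) (by linarith)] with p' hne' h1 h2 h3 z hz
    by_cases h0 : 1 ≤ p'.2.re
    · rw [cont, if_neg (by linarith), if_neg (by linarith), if_neg (by linarith), if_pos h0]
    · rw [cont, if_neg (by linarith), if_neg (by linarith), if_neg (by linarith), if_neg h0,
        raise3_eq hz k k (-k) _ (hbox.2 ⟨by linarith, by linarith, by linarith, by linarith⟩)]
      have e : (expo θ p').1 + (k : ℂ) / 2 + 1 = 1 - p'.2 + θ + k / 2 := by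
        simp only [expo]; ring
      rw [e, ← mul_assoc, div_mul_cancel₀ _ hne']
  rw [not_le] at hC hD
  refine ⟨normFactor k θ, K k k (-k), regC, isOpen_box _ _ _ _, hregC hA hC hB hD, g3,
    nice_K k k (-k), fun q hq => isSol_K k k (-k) hq, ?_⟩
  filter_upwards [gt1 hA, lt1 hC, gt2 hB, lt2 hD] with p' h1 h2 h3 h4 z hz
  rw [cont, if_neg (not_le.2 h1), if_neg (not_le.2 h3), if_neg (not_le.2 h2), if_neg (not_le.2 h4)]

theorem conj_eq_neg {θ : ℂ} (h : θ.re = 0) : conj θ = -θ := by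
  apply Complex.ext <;> simp [h]

theorem exists_of_mem_Lam {l : ℂ} (hl : l ∈ Lam) : ∃ (k : ℤ) (θ : ℂ), θ.re = 0 ∧ l = θ + k / 2 := by
  obtain ⟨k, s, rfl⟩ := hl
  exact ⟨k, s * Complex.I / 2, by simp [mul_div_right_comm, ← Complex.ofReal_ofNat,
    ← Complex.ofReal_div], by ring⟩

/-- Each point removed from `contDomain` has k = 0 and makes one of the four pairs equal to (1, 1).
In exchange `contDomain` is visibly open, which Osgood's lemma needs. -/
theorem kernelDomain_subset_contDomain {θ : ℂ} (hθ : θ.re = 0) (k : ℤ) :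
    kernelDomain (θ + k / 2) ⊆ contDomain k θ := by
  rintro p ⟨h0, n1, n2, n3, n4⟩
  refine ⟨h0, fun hk => ?_⟩
  have hone : IsPosIntPair (1, 1) := ⟨0, 0, by simp⟩
  have hpr : ∀ x : ℂ, x = 1 → IsPosIntPair (pr x k) ∧ IsPosIntPair (pr x (-k)) := by
    rintro x rfl
    subst hk
    simpa [pr] using hone
  rw [pairPlus_eq_pr (conj_eq_neg hθ)] at n1 n3
  rw [pairMinus_eq_pr (conj_eq_neg hθ)] at n2 n4
  exact ⟨fun h => n2 (hpr _ h).2, fun h => n1 (hpr _ h).1, fun h => n3 (hpr _ h).1,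
    fun h => n4 (hpr _ h).2⟩

theorem cont_differentiableOn {θ : ℂ} (hθ : θ.re = 0) (k : ℤ) {z : ℂ} (hz : z ∈ puncturedPlane) :
    DifferentiableOn ℂ (cont k θ z) (contDomain k θ) := by
  intro p hp
  obtain ⟨c, W, Ω, hΩ, hpΩ, hc, hW, -, hev⟩ := cont_local hθ hp
  have h1 : DifferentiableAt ℂ (fun p' => W (expo θ p') z) p :=
    DifferentiableAt.comp p (f := expo θ) (g := fun q => W q z)
      (((hW 0).hol hz).differentiableAt (hΩ.mem_nhds hpΩ)) (by unfold expo; fun_prop)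
  refine ((hc.mul h1).congr_of_eventuallyEq ?_).differentiableWithinAt
  filter_upwards [hev] with p' hp' using hp' z hz

theorem isKernelContinuation_cont {θ : ℂ} (hθ : θ.re = 0) (k : ℤ) {z : ℂ}
    (hz : z ∈ puncturedPlane) : IsKernelContinuation z (θ + k / 2) (cont k θ z) := by
  refine ⟨(analyticOnNhd_of_differentiableOn (isOpen_contDomain k θ)
    (cont_differentiableOn hθ k hz)).mono (kernelDomain_subset_contDomain hθ k), ?_⟩
  intro a b a0 a1 b0 b1 hab
  rw [euler_kernel_eq (conj_eq_neg hθ) k z a0 a1 b0 b1 hab, cont]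
  simp only
  rw [if_neg (not_le.2 a0), if_neg (not_le.2 b0), if_neg (not_le.2 a1), if_neg (not_le.2 b1)]

theorem isKernelContinuation_kernel {l z : ℂ} (hl : l ∈ Lam) (hz : z ∈ puncturedPlane) :
    IsKernelContinuation z l (fun p => kernel p.1 p.2 z l) := by
  obtain ⟨k, θ, hθ, rfl⟩ := exists_of_mem_Lam hl
  have h : ∃ G, IsKernelContinuation z (θ + k / 2) G := ⟨_, isKernelContinuation_cont hθ k hz⟩
  have : (fun p : ℂ × ℂ => kernel p.1 p.2 z (θ + k / 2)) = Classical.choose h := by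
    funext p
    rw [kernel, dif_pos h]
  rw [this]
  exact Classical.choose_spec h

theorem mem_kernelDomain {a b : ℝ} (hab : (a, b) ∈ paramDomain) {l : ℂ}
    (hl : ¬ (l = 0 ∧ (a = 1 ∨ b = 1))) : ((a : ℂ), (b : ℂ)) ∈ kernelDomain l := by
  obtain ⟨h1, h2, h3, h4⟩ := hab
  simp only at h1 h2 h3 h4
  have hpos : ∀ (w : ℝ) (u v : ℂ), v = -conj u → w < 3 / 2 → IsPosIntPair ((w : ℂ) + u, (w : ℂ) + v)
      → u = 0 ∧ w = 1 := by
    intro w u v huv hw h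
    obtain ⟨e1, e2⟩ := eq_of_isPosIntPair huv (by rwa [Complex.ofReal_re]) h
    rw [Complex.ofReal_re] at e2
    rw [e2, Complex.ofReal_one] at e1
    exact ⟨by linear_combination e1, e2⟩
  refine ⟨⟨h1, h2, h3, h4⟩, fun h => ?_, fun h => ?_, fun h => ?_, fun h => ?_⟩
  · obtain ⟨e1, e2⟩ := hpos a l (-conj l) rfl (by linarith) (by simpa [pairPlus, sub_eq_add_neg] using h)
    exact hl ⟨e1, Or.inl e2⟩
  · obtain ⟨e1, e2⟩ := hpos a (-l) (conj l) (by simp) (by linarith)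
      (by simpa [pairMinus, sub_eq_add_neg] using h)
    exact hl ⟨neg_eq_zero.1 e1, Or.inl e2⟩
  · obtain ⟨e1, e2⟩ := hpos b l (-conj l) rfl (by linarith) (by simpa [pairPlus, sub_eq_add_neg] using h)
    exact hl ⟨e1, Or.inr e2⟩
  · obtain ⟨e1, e2⟩ := hpos b (-l) (conj l) (by simp) (by linarith)
      (by simpa [pairMinus, sub_eq_add_neg] using h)
    exact hl ⟨neg_eq_zero.1 e1, Or.inr e2⟩

/-- At a fixed (a, b) the kernel is a constant times one member of a smooth family of solutions, by
`cont_local`. -/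
theorem kernel_eigen {a b : ℝ} (hab : (a, b) ∈ paramDomain) {l : ℂ} (hl : l ∈ Lam)
    (hne : ¬ (l = 0 ∧ (a = 1 ∨ b = 1))) :
    ContDiffOn ℝ ∞ (fun z => kernel a b z l) puncturedPlane ∧
      ∀ z ∈ puncturedPlane,
        opD a b (fun w => kernel a b w l) z = -l ^ 2 * kernel a b z l ∧
        opDbar a b (fun w => kernel a b w l) z = -(conj l) ^ 2 * kernel a b z l := by
  have hmem := mem_kernelDomain hab hne
  have hlam := hl
  obtain ⟨k, θ, hθ, rfl⟩ := exists_of_mem_Lam hl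
  obtain ⟨c, W, Ω, hΩ, hpΩ, hc, hW, hS, hev⟩ :=
    cont_local hθ (kernelDomain_subset_contDomain hθ k hmem)
  -- The kernel is chosen separately for each z; uniqueness of the continuation replaces all these
  -- choices by `cont`, with the same c and W for every z.
  have hK : ∀ z ∈ puncturedPlane,
      kernel a b z (θ + k / 2) = c (a, b) * W (expo θ (a, b)) z := fun z hz =>
    ((isKernelContinuation_kernel hlam hz).eqOn (isKernelContinuation_cont hθ k hz) hmem).trans
      (hev.self_of_nhds z hz)
  refine ⟨(contDiffOn_const.mul (contDiffOn_of_nice isOpen_puncturedPlane hW hpΩ)).congr hK, ?_⟩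
  have hsol : IsSol k k (-k) (expo θ (a, b)) (fun z => kernel a b z (θ + k / 2)) :=
    (hS _ hpΩ).of_eqOn _ hK (fun w hw => (hW 1).differentiableAt hpΩ hw)
      (fun w hw => (hW 2).2.2.1.differentiableAt hpΩ hw)
      (fun w hw => (hW 2).2.2.2.differentiableAt hpΩ hw)
  intro z hz
  obtain ⟨h1, h2⟩ := hsol z hz
  simp only [hypL, hypLbar, expo, Int.cast_neg] at h1 h2
  have hconj : conj (θ + k / 2) = -θ + k / 2 := by
    simp only [map_add, map_div₀, map_intCast, map_ofNat, conj_eq_neg hθ]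
  rw [hconj, opD, opDbar]
  -- With these exponents the coefficients of `hypL` are those of `opD`, and its constant term is (a
  -- + λ)(a − λ) = a² − λ². The barred one gives a² − (conj λ)², because conj λ = −θ + k/2.
  constructor
  · linear_combination h1
  · linear_combination h2

/-! ### Symmetry of the hypergeometric operator -/

theorem dz_contDiffAt {u : ℂ → ℂ} {z : ℂ} (hu : ContDiffAt ℝ ∞ u z) : ContDiffAt ℝ ∞ (dz u) z := by
  have h : ∀ v : ℂ, ContDiffAt ℝ ∞ (fun w => fderiv ℝ u w v) z := fun v =>
    (hu.fderiv_right (m := ∞) le_rfl).clm_apply contDiffAt_const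
  have := ((h 1).sub (contDiffAt_const (c := Complex.I) |>.mul (h Complex.I))).div_const 2
  exact this

theorem dzbar_eq_conj (f : ℂ → ℂ) (z : ℂ) : dzbar f z = conj (dz (fun w => conj (f w)) z) := by
  have h : fderiv ℝ (fun w => conj (f w)) z
      = (Complex.conjCLE : ℂ →L[ℝ] ℂ).comp (fderiv ℝ f z) :=
    Complex.conjCLE.comp_fderiv (f := f)
  simp [dzbar, dz, h, map_ofNat]

/-- For real a, b this reduces each antiholomorphic statement to the holomorphic one. It requires no
differentiability, since conjugation is a real-linear isomorphism. -/
theorem opDbar_eq_conj (a b : ℝ) (f : ℂ → ℂ) (z : ℂ) :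
    opDbar a b f z = conj (opD a b (fun w => conj (f w)) z) := by
  have h : dzbar f = fun w => conj (dz (fun w => conj (f w)) w) := funext (dzbar_eq_conj f)
  rw [opDbar, opD, dzbar_eq_conj (dzbar f), h]
  simp only [map_sub, map_add, map_mul, map_one, Complex.conj_conj, map_ofNat, map_pow,
    Complex.conj_ofReal]

/-- The function `|z|^(2α) |1-z|^(2β)`. -/
def jacobiWeight (α β : ℝ) (z : ℂ) : ℂ := gp α 0 z * gp β 0 (z - 1)

theorem gp_zero_right {z : ℂ} (hz : z ≠ 0) (α : ℝ) : gp α 0 z = ((‖z‖ ^ (2 * α) : ℝ) : ℂ) := by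
  rw [gp, zpow_zero, mul_one, Real.rpow_def_of_pos (norm_pos_iff.2 hz)]
  push_cast
  congr 1
  ring

theorem jacobiWeight_eq {z : ℂ} (hz : z ∈ puncturedPlane) (α β : ℝ) :
    jacobiWeight α β z = ((‖z‖ ^ (2 * α) * ‖1 - z‖ ^ (2 * β) : ℝ) : ℂ) := by
  rw [jacobiWeight, gp_zero_right hz.1, gp_zero_right (sub_ne_zero.2 hz.2), norm_sub_rev 1 z]
  push_cast
  rfl

theorem hasW_jacobiWeight {z : ℂ} (hz : z ∈ puncturedPlane) (α β : ℝ) :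
    HasW (jacobiWeight α β) ((α / z + β / (z - 1)) * jacobiWeight α β z)
      (conj ((α / z + β / (z - 1)) * jacobiWeight α β z)) z := by
  have h1' := sub_ne_zero.2 hz.2
  have h1 := hasW_gp hz.1 α 0
  have h2 : HasDerivAt (fun w : ℂ => w - 1) 1 z := (hasDerivAt_id z).sub_const 1
  have h3 := HasW.comp_hol (g := fun w : ℂ => w - 1) (hasW_gp h1' β 0) h2
  have h4 : HasW (jacobiWeight α β) _ _ z := h1.mul h3
  have hc : conj (jacobiWeight α β z) = jacobiWeight α β z := by
    rw [jacobiWeight_eq hz, Complex.conj_ofReal]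
  have hz0 : conj z ≠ 0 := by simpa using hz.1
  convert h4 using 1
  · rw [gp_down hz.1, gp_down h1', jacobiWeight]
    simp only [Int.cast_zero, zero_div, add_zero]
    ring
  · rw [map_mul, hc, gp_down_bar hz.1, gp_down_bar h1', jacobiWeight]
    simp only [Int.cast_zero, zero_div, sub_zero, map_add, map_div₀, map_sub, map_one,
      Complex.conj_ofReal]
    ring

theorem contDiffAt_jacobiWeight {z : ℂ} (hz : z ∈ puncturedPlane) (α β : ℝ) :
    ContDiffAt ℝ ∞ (jacobiWeight α β) z :=
  (contDiffAt_gp hz.1 _ _).mul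
    (ContDiffAt.comp z (f := fun w : ℂ => w - 1) (contDiffAt_gp (sub_ne_zero.2 hz.2) _ _)
      (contDiffAt_id.sub contDiffAt_const))

theorem weight_eq {z : ℂ} (hz : z ∈ puncturedPlane) (a b : ℝ) :
    (weight a b z : ℂ) = jacobiWeight (a + b - 1) (a - b) z := by
  rw [jacobiWeight_eq hz, weight]
  congr 3 <;> ring_nf

theorem IsTestFunction.congr {f g : ℂ → ℂ} (hf : IsTestFunction f) (h : ∀ z, g z = f z) :
    IsTestFunction g := by
  rwa [funext h]

theorem IsTestFunction.conj {f : ℂ → ℂ} (hf : IsTestFunction f) :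
    IsTestFunction (fun z => conj (f z)) := by
  have hs : Function.support (fun z => (starRingEnd ℂ) (f z)) = Function.support f := by
    ext z; simp
  have ht : tsupport (fun z => (starRingEnd ℂ) (f z)) = tsupport f := by
    rw [tsupport, hs, tsupport]
  refine ⟨Complex.conjCLE.contDiff.comp hf.1, ?_, ?_⟩
  · rw [HasCompactSupport, ht]
    exact hf.2.1
  · rw [ht]
    exact hf.2.2

theorem IsTestFunction.opD {f : ℂ → ℂ} (hf : IsTestFunction f) (a b : ℝ) :
    IsTestFunction (opD a b f) := by
  have h1 := hf.dz.dz.mul_of_contDiffAt (g := fun z => z * (1 - z)) fun z _ => by fun_prop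
  have h2 := hf.dz.mul_of_contDiffAt (g := fun z => (a : ℂ) + b - (2 * a + 1) * z)
    fun z _ => by fun_prop
  refine ((h1.add h2).add (hf.const_mul (-(a : ℂ) ^ 2))).congr fun z => ?_
  rw [ComplexJacobi.opD]
  ring

theorem IsTestFunction.mul_weight {f u : ℂ → ℂ} (hf : IsTestFunction f)
    (hu : ContDiffOn ℝ ∞ u puncturedPlane) (a b : ℝ) :
    IsTestFunction (fun z => u z * f z * (weight a b z : ℂ)) := by
  have hu' : ∀ z ∈ puncturedPlane, ContDiffAt ℝ ∞ u z := fun z hz =>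
    hu.contDiffAt (isOpen_puncturedPlane.mem_nhds hz)
  refine (hf.mul_of_contDiffAt fun z hz => (hu' z hz).mul
    (contDiffAt_jacobiWeight hz (a + b - 1) (a - b))).congr fun z => ?_
  by_cases hz : z ∈ puncturedPlane
  · rw [weight_eq hz]; ring
  · rw [image_eq_zero_of_notMem_tsupport fun h => hz (hf.2.2 h)]; ring

/-- An eigenfunction of the hypergeometric operator defines an eigendistribution. -/
theorem integral_opD {u f : ℂ → ℂ} (hu : ContDiffOn ℝ ∞ u puncturedPlane) (hf : IsTestFunction f)
    {a b : ℝ} {c : ℂ} (h : ∀ z ∈ puncturedPlane, opD a b u z = c * u z) :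
    ∫ z, u z * opD a b f z * (weight a b z : ℂ) = c * ∫ z, u z * f z * (weight a b z : ℂ) := by
  have hu' : ∀ z ∈ puncturedPlane, ContDiffAt ℝ ∞ u z := fun z hz =>
    hu.contDiffAt (isOpen_puncturedPlane.mem_nhds hz)
  -- With w the weight and P = z(1−z)w, the operator has the Sturm–Liouville form w·𝔇f = ∂(P ∂f) −
  -- a² w f.
  set P : ℂ → ℂ := fun z => z * (1 - z) * jacobiWeight (a + b - 1) (a - b) z with hP
  have hPc : ∀ z ∈ puncturedPlane, ContDiffAt ℝ ∞ P z := fun z hz =>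
    ContDiffAt.mul (by fun_prop) (contDiffAt_jacobiWeight hz _ _)
  have t1 := hf.dz.mul_of_contDiffAt fun z hz => (hPc z hz).mul (hu' z hz)
  have t2 := hf.mul_of_contDiffAt fun z hz => (hPc z hz).mul (dz_contDiffAt (hu' z hz))
  have t := t1.add (t2.const_mul (-1))
  -- Lagrange's identity: the difference is ∂(P(u ∂f − f ∂u)), and the function in brackets is a
  -- test function.
  have key : ∀ z, u z * opD a b f z * (weight a b z : ℂ) - c * (u z * f z * (weight a b z : ℂ))
      = dz (fun z => dz f z * (P * u) z + -1 * (f z * (P * dz u) z)) z := by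
    intro z
    by_cases hz : z ∈ puncturedPlane
    · have d0 : ∀ {g : ℂ → ℂ}, ContDiffAt ℝ ∞ g z → HasW g (dz g z) (dzbar g z) z := fun hg =>
        hasW_of_differentiableAt (hg.differentiableAt (by simp))
      have hz0 := hz.1
      have hz1 := sub_ne_zero.2 hz.2
      have e1 : HasW (fun z : ℂ => z * (1 - z)) (1 - 2 * z) 0 z :=
        hasW_of_hasDerivAt (((hasDerivAt_id' z).mul ((hasDerivAt_id' z).const_sub 1)).congr_deriv
          (by ring))
      have e2 := e1.mul (hasW_jacobiWeight hz (a + b - 1) (a - b))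
      have e3 := (hf.dz.hasW z).mul (e2.mul (d0 (hu' z hz)))
      have e4 := ((hf.hasW z).mul (e2.mul (d0 (dz_contDiffAt (hu' z hz))))).const_mul (-1)
      refine Eq.trans ?_ (e3.add e4).dz_eq.symm
      have hopu := h z hz
      rw [opD] at hopu
      rw [weight_eq hz, opD]
      generalize jacobiWeight (a + b - 1) (a - b) z = w
      -- The logarithmic derivative of the weight times z(1−z); it yields ∂P = (a + b − (2a+1)z) w.
      have hw : z * (1 - z) * (((a + b - 1 : ℝ) : ℂ) / z + ((a - b : ℝ) : ℂ) / (z - 1))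
          = (a + b - 1) * (1 - z) - (a - b) * z := by
        push_cast
        field_simp
        ring
      linear_combination f z * w * hopu - (dz f z * u z - f z * dz u z) * w * hw
    · have h1 : opD a b f z = 0 :=
        image_eq_zero_of_notMem_tsupport fun h => hz ((hf.opD a b).2.2 h)
      have h2 : f z = 0 := image_eq_zero_of_notMem_tsupport fun h => hz (hf.2.2 h)
      rw [h1, h2]
      have := image_eq_zero_of_notMem_tsupport fun h => hz (t.dz.2.2 h)
      exact Eq.trans (by ring) this.symm
  have i1 := ((hf.opD a b).mul_weight hu a b).integrable
  have i2 := ((hf.mul_weight hu a b).const_mul c).integrable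
  have hz := t.integral_dz
  rw [← sub_eq_zero, ← integral_const_mul, ← integral_sub i1 i2, integral_congr_ae
    (Filter.Eventually.of_forall key)]
  exact hz

theorem contDiffOn_conj {u : ℂ → ℂ} {s : Set ℂ} (hu : ContDiffOn ℝ ∞ u s) :
    ContDiffOn ℝ ∞ (fun z => conj (u z)) s :=
  Complex.conjCLE.contDiff.comp_contDiffOn hu

/-- The antiholomorphic version of `integral_opD`. -/
theorem integral_opDbar {u f : ℂ → ℂ} (hu : ContDiffOn ℝ ∞ u puncturedPlane)
    (hf : IsTestFunction f) {a b : ℝ} {c : ℂ} (h : ∀ z ∈ puncturedPlane, opDbar a b u z = c * u z) :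
    ∫ z, u z * opDbar a b f z * (weight a b z : ℂ) = c * ∫ z, u z * f z * (weight a b z : ℂ) := by
  have h' : ∀ z ∈ puncturedPlane, opD a b (fun w => conj (u w)) z = conj c * conj (u z) := by
    intro z hz
    have := congrArg conj (h z hz)
    rwa [opDbar_eq_conj, Complex.conj_conj, map_mul] at this
  have := congrArg conj (integral_opD (contDiffOn_conj hu) hf.conj h')
  rw [map_mul, Complex.conj_conj, ← integral_conj, ← integral_conj] at this
  simpa only [map_mul, Complex.conj_conj, Complex.conj_ofReal, ← opDbar_eq_conj] using this

theorem eigendistribution {u : ℂ → ℂ} (hu : ContDiffOn ℝ ∞ u puncturedPlane) {a b : ℝ} {c d : ℂ}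
    (h : ∀ z ∈ puncturedPlane, opD a b u z = c * u z ∧ opDbar a b u z = d * u z)
    {f : ℂ → ℂ} (hf : IsTestFunction f) :
    Integrable (fun z => u z * f z * (weight a b z : ℂ)) ∧
    ∫ z, u z * opD a b f z * (weight a b z : ℂ) = c * ∫ z, u z * f z * (weight a b z : ℂ) ∧
    ∫ z, u z * opDbar a b f z * (weight a b z : ℂ) = d * ∫ z, u z * f z * (weight a b z : ℂ) :=
  ⟨(hf.mul_weight hu a b).integrable, integral_opD hu hf fun z hz => (h z hz).1,
    integral_opDbar hu hf fun z hz => (h z hz).2⟩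

/-! ### The two additional points -/

theorem dz_of_eqOn_jacobiWeight {α β : ℝ} {g : ℂ → ℂ} {c : ℂ}
    (hg : ∀ z ∈ puncturedPlane, g z = c * jacobiWeight α β z) :
    ∀ z ∈ puncturedPlane, dz g z = c * ((α / z + β / (z - 1)) * jacobiWeight α β z) := by
  intro z hz
  rw [dz_of_eqOn hg (fun w hw => (hasW_jacobiWeight hw α β).differentiableAt) z hz,
    (hasW_jacobiWeight hz α β).dz_eq]

/-- The first two hypotheses are the indicial equations at 0 and 1. They remove the simple poles of
𝔇v/v at these points, and what is left is the constant −(α + β + a)². -/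
theorem opD_jacobiWeight {a b α β r : ℝ} (h0 : α ^ 2 - α + (a + b) * α = 0)
    (h1 : β ^ 2 - β * (b - a) = 0) (hr : r ^ 2 = (α + β + a) ^ 2) {v : ℂ → ℂ} {c : ℂ}
    (hv : ∀ z ∈ puncturedPlane, v z = c * jacobiWeight α β z) {z : ℂ} (hz : z ∈ puncturedPlane) :
    opD a b v z = -(r : ℂ) ^ 2 * v z := by
  have e1 := dz_of_eqOn_jacobiWeight hv
  have hz0 := hz.1
  have hz1 := sub_ne_zero.2 hz.2
  have hL : HasW (fun z : ℂ => (α / z + β / (z - 1) : ℂ)) (-α / z ^ 2 + -β / (z - 1) ^ 2) 0 z := by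
    refine hasW_of_hasDerivAt ?_
    have d1 := (hasDerivAt_const z (α : ℂ)).div (hasDerivAt_id' z) hz0
    have d2 := (hasDerivAt_const z (β : ℂ)).div ((hasDerivAt_id' z).sub_const 1) hz1
    exact (d1.add d2).congr_deriv (by simp)
  have e2 : dz (dz v) z = dz (fun z => c * ((α / z + β / (z - 1)) * jacobiWeight α β z)) z := by
    refine dz_congr ?_
    filter_upwards [isOpen_puncturedPlane.mem_nhds hz] with w hw using e1 w hw
  rw [((hL.mul (hasW_jacobiWeight hz α β)).const_mul c).dz_eq] at e2
  rw [opD, e2, e1 z hz, hv z hz]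
  have c0 : (α : ℂ) ^ 2 - α + (a + b) * α = 0 := by exact_mod_cast h0
  have c1 : (β : ℂ) ^ 2 - β * (b - a) = 0 := by exact_mod_cast h1
  have cr : (r : ℂ) ^ 2 = (α + β + a) ^ 2 := by exact_mod_cast hr
  generalize jacobiWeight α β z = w
  rw [cr]
  have key : z * (1 - z) * ((-α / z ^ 2 + -β / (z - 1) ^ 2) + (α / z + β / (z - 1)) ^ 2)
      + ((a : ℂ) + b - (2 * a + 1) * z) * (α / z + β / (z - 1)) - (a : ℂ) ^ 2
      = -((α : ℂ) + β + a) ^ 2 + ((α : ℂ) ^ 2 - α + (a + b) * α) / z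
        - ((β : ℂ) ^ 2 - β * (b - a)) / (z - 1) := by
    field_simp
    ring
  rw [c0, c1, zero_div, zero_div, add_zero, sub_zero] at key
  linear_combination c * w * key

theorem discreteKernel_eigen_of_eq {a b α β r : ℝ} (h0 : α ^ 2 - α + (a + b) * α = 0)
    (h1 : β ^ 2 - β * (b - a) = 0) (hr : r ^ 2 = (α + β + a) ^ 2) {v : ℂ → ℂ} {c : ℂ}
    (hv : ∀ z ∈ puncturedPlane, v z = c * jacobiWeight α β z) :
    ContDiffOn ℝ ∞ v puncturedPlane ∧ ∀ z ∈ puncturedPlane,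
      opD a b v z = -(r : ℂ) ^ 2 * v z ∧ opDbar a b v z = -(r : ℂ) ^ 2 * v z := by
  refine ⟨ContDiffOn.congr (fun z hz => (contDiffAt_const.mul
    (contDiffAt_jacobiWeight hz α β)).contDiffWithinAt) hv, fun z hz =>
    ⟨opD_jacobiWeight h0 h1 hr hv hz, ?_⟩⟩
  have hv' : ∀ z ∈ puncturedPlane, conj (v z) = conj c * jacobiWeight α β z := fun z hz => by
    rw [hv z hz, map_mul, jacobiWeight_eq hz, Complex.conj_ofReal]
  rw [opDbar_eq_conj, opD_jacobiWeight h0 h1 hr hv' hz]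
  simp only [map_mul, map_neg, map_pow, Complex.conj_ofReal, Complex.conj_conj]

/-- The four cases are the four choices of local exponents, α = 0 or 1 − a − b at 0 and β = 0 or b −
a at 1; then α + β + a is a, b, 1 − a or 1 − b. The gamma factor is only a constant. -/
theorem discreteKernel_eigen {a b : ℝ} (hab : (a, b) ∈ paramDomain)
    (hc : (a, b) ∉ paramDomainCont) :
    ContDiffOn ℝ ∞ (discreteKernel a b) puncturedPlane ∧ ∀ z ∈ puncturedPlane,
      opD a b (discreteKernel a b) z = -(discretePoint a b : ℂ) ^ 2 * discreteKernel a b z ∧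
      opDbar a b (discreteKernel a b) z
        = -(discretePoint a b : ℂ) ^ 2 * discreteKernel a b z := by
  by_cases ha : a < 0
  · refine discreteKernel_eigen_of_eq (α := 0) (β := 0) (c := 1 / gammaC ((a : ℂ) + b, (a : ℂ) + b))
      (by ring) (by ring) (by rw [discretePoint, if_pos ha]; ring) fun z hz => ?_
    rw [discreteKernel, if_pos ha, jacobiWeight_eq hz]
    simp
  by_cases hb : b < 0
  · refine discreteKernel_eigen_of_eq (α := 0) (β := b - a)
      (c := 1 / gammaC ((a : ℂ) + b, (a : ℂ) + b)) (by ring) (by ring)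
      (by rw [discretePoint, if_neg ha, if_pos hb]; ring) fun z hz => ?_
    rw [discreteKernel, if_neg ha, if_pos hb, jacobiWeight_eq hz, mul_zero, Real.rpow_zero, one_mul]
    ring
  by_cases ha1 : 1 < a
  · refine discreteKernel_eigen_of_eq (α := 1 - a - b) (β := b - a)
      (c := 1 / gammaC (2 - (a : ℂ) - b, 2 - (a : ℂ) - b)) (by ring) (by ring)
      (by rw [discretePoint, if_neg ha, if_neg hb, if_pos ha1]; ring) fun z hz => ?_
    rw [discreteKernel, if_neg ha, if_neg hb, if_pos ha1, jacobiWeight_eq hz]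
    ring
  by_cases hb1 : 1 < b
  · refine discreteKernel_eigen_of_eq (α := 1 - a - b) (β := 0)
      (c := 1 / gammaC (2 - (a : ℂ) - b, 2 - (a : ℂ) - b)) (by ring) (by ring)
      (by rw [discretePoint, if_neg ha, if_neg hb, if_neg ha1]; ring) fun z hz => ?_
    rw [discreteKernel, if_neg ha, if_neg hb, if_neg ha1, jacobiWeight_eq hz, mul_zero,
      Real.rpow_zero, mul_one]
    ring
  · exact absurd ⟨hab, not_lt.1 ha, not_lt.1 ha1, not_lt.1 hb, not_lt.1 hb1⟩ hc

end ComplexJacobi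

end

/-! ### The theorem: existence of the kernel, eigenfunctions and eigendistributions -/

theorem mainTheorem5 (a b : ℝ) (hab : (a, b) ∈ ComplexJacobi.paramDomain) :
    -- the kernel is well defined: the continuation in the parameters exists
    (∀ l ∈ ComplexJacobi.Lam, ∀ z ∈ ComplexJacobi.puncturedPlane,
      ComplexJacobi.IsKernelContinuation z l
        (fun p => ComplexJacobi.kernel p.1 p.2 z l)) ∧
    -- the points of `Lam`
    (∀ l ∈ ComplexJacobi.Lam, ¬ (l = 0 ∧ (a = 1 ∨ b = 1)) →
      ContDiffOn ℝ ∞ (fun z => ComplexJacobi.kernel a b z l) ComplexJacobi.puncturedPlane ∧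
      (∀ z ∈ ComplexJacobi.puncturedPlane,
        ComplexJacobi.opD a b (fun w => ComplexJacobi.kernel a b w l) z
          = -l ^ 2 * ComplexJacobi.kernel a b z l ∧
        ComplexJacobi.opDbar a b (fun w => ComplexJacobi.kernel a b w l) z
          = -(conj l) ^ 2 * ComplexJacobi.kernel a b z l) ∧
      (∀ f : ℂ → ℂ, ComplexJacobi.IsTestFunction f →
        Integrable
          (fun z => ComplexJacobi.kernel a b z l * f z * (ComplexJacobi.weight a b z : ℂ)) ∧
        ComplexJacobi.transform a b (ComplexJacobi.opD a b f) l
          = -l ^ 2 * ComplexJacobi.transform a b f l ∧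
        ComplexJacobi.transform a b (ComplexJacobi.opDbar a b f) l
          = -(conj l) ^ 2 * ComplexJacobi.transform a b f l)) ∧
    -- the two additional points of the spectrum
    ((a, b) ∉ ComplexJacobi.paramDomainCont →
      ContDiffOn ℝ ∞ (ComplexJacobi.discreteKernel a b) ComplexJacobi.puncturedPlane ∧
      (∀ z ∈ ComplexJacobi.puncturedPlane,
        ComplexJacobi.opD a b (ComplexJacobi.discreteKernel a b) z
          = -(ComplexJacobi.discretePoint a b : ℂ) ^ 2 * ComplexJacobi.discreteKernel a b z ∧
        ComplexJacobi.opDbar a b (ComplexJacobi.discreteKernel a b) z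
          = -(ComplexJacobi.discretePoint a b : ℂ) ^ 2 * ComplexJacobi.discreteKernel a b z) ∧
      (∀ f : ℂ → ℂ, ComplexJacobi.IsTestFunction f →
        Integrable
          (fun z => ComplexJacobi.discreteKernel a b z * f z
            * (ComplexJacobi.weight a b z : ℂ)) ∧
        ComplexJacobi.discreteTransform a b (ComplexJacobi.opD a b f)
          = -(ComplexJacobi.discretePoint a b : ℂ) ^ 2
            * ComplexJacobi.discreteTransform a b f ∧
        ComplexJacobi.discreteTransform a b (ComplexJacobi.opDbar a b f)
          = -(ComplexJacobi.discretePoint a b : ℂ) ^ 2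
            * ComplexJacobi.discreteTransform a b f)) := by
  refine ⟨fun l hl z hz => ComplexJacobi.isKernelContinuation_kernel hl hz, fun l hl hne => ?_,
    fun hc => ?_⟩
  · obtain ⟨h1, h2⟩ := ComplexJacobi.kernel_eigen hab hl hne
    exact ⟨h1, h2, fun f hf => ComplexJacobi.eigendistribution h1 h2 hf⟩
  · obtain ⟨h1, h2⟩ := ComplexJacobi.discreteKernel_eigen hab hc
    exact ⟨h1, h2, fun f hf => ComplexJacobi.eigendistribution h1 h2 hf⟩
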